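/- Let $G$ be a finite simple graph all of whose vertices have degree $2$ or $3$, given with a straight-line planar drawing without sharp vertices: at a degree-3 vertex all three angles between consecutive edges are less than $\pi$, and the two edges at a degree-2 vertex are not collinear. Build a polygonal region from the drawing as follows. **Channels.** Each edge is replaced by a channel: a polygon along the edge bounded by two reflex chains $A_1,\dots,A_7$ (upper) and $B_1,\dots,B_7$ (lower), both listed from left to right, and by two end edges $A_1B_1$, $A_7B_7$, such that every vertex of one chain sees every vertex of the other. The left-inclined triangulation of a channel joins $A_1$ to all $B_j$ and $B_7$ to all $A_i$; the right-inclined one joins $B_1$ to all $A_i$ and $A_7$ to all $B_j$. At the end edge $A_1B_1$ the wide mouth is the part of the plane beyond that edge between the lines $A_1A_2$ and $B_1B_2$, and the narrow mouth the part beyond that edge between the lines $A_6A_7$ and $B_6B_7$; symmetrically at $A_7B_7$. **Vertex gadgets.** Each vertex is replaced by a gadget that contains the end edges $AB$, $A'B'$ (and $A''B''$) of its channels $1,2$ (and $3$) and four further points forming a convex quadrilateral $CDEF$. The mouth of each channel at the vertex passes beside the other channels, whose end edges there lie outside its wide mouth; for a degree-3 vertex it exits between the two other channels. * Degree 2: the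 sector of angle $<\pi$ goes counterclockwise from channel 1 to channel 2. It contains $C$, which lies outside both wide mouths; the other sector contains $D,E,F$, with $D$ in the narrow mouth of channel 1 and outside the wide mouth of channel 2, $F$ in the narrow mouth of channel 2 and outside the wide mouth of channel 1, and $E$ outside both wide mouths. The triangles are $ABC, CAF, CFE, CED, CDB', A'B'C$; counterclockwise, the gadget is the polygon $CA'B'DEFAB$. * Degree 3: channels $1,2,3$ are in counterclockwise order; $C,D$ lie in the sector between channels 2 and 3, $E$ in the sector between 3 and 1, $F$ in the sector between 1 and 2. $D$ lies in the narrow mouths of channels 1 and 2 and outside the wide mouth of channel 3, $F$ in the narrow mouth of channel 3 and outside the wide mouths of channels 1 and 2, and $C,E$ outside all wide mouths. The triangles are $ABF, FAE, FEC, CED, A'B'C, CA'F, A''B''E, EA''D$; counterclockwise, the gadget is the polygon $CDA''B''EABFA'B'$. Channels and gadgets do not overlap; their union is the polygonal region. Let $T_1$ (respectively $T_2$) consist of the gadget triangles above together with the left-inclined (respectively right-inclined) triangulations of all channels. Then $T_1$ and $T_2$ are triangulations of the region, and for every integer $k\ge 0$, $G$ has a vertex cover of size at most $k$ if and only if the flip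 distance between $T_1$ and $T_2$ is at most $2k+28|E|$. Here a flip replaces two triangles that share an edge and form a strictly convex quadrilateral by the two triangles obtained from the other diagonal, and the flip distance is the least number of flips that transforms $T_1$ into $T_2$ through triangulations of the region. -/

import Mathlib

/-! ### Triangulations of planar regions, flips, flip distance -/

/-- The Euclidean plane, as a real vector space (only its affine structure is used). -/
abbrev Plane : Type := ℝ × ℝ

/-- Twice the signed area of the triangle `p q r`: positive iff `p, q, r` is a left
(counterclockwise) turn, i.e. iff `r` lies strictly to the left of the line from `p` to `q`. -/
def orient (p q r : Plane) : ℝ :=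
  (q.1 - p.1) * (r.2 - p.2) - (q.2 - p.2) * (r.1 - p.1)

/-- The closed convex hull of the points with labels in `t`. -/
def hull {N : Type*} (pt : N → Plane) (t : Set N) : Set Plane :=
  convexHull ℝ (pt '' t)

/-- `T` is a triangulation of the region `R` with vertex set exactly the points `pt i`, `i : N`.
Triangles are given by their sets of vertex labels; two triangles are disjoint or meet exactly in
a common vertex or in a common edge. -/
structure IsTriangulation {N : Type*} (pt : N → Plane) (R : Set Plane) (T : Set (Set N)) :
    Prop where
  nondegenerate : ∀ t ∈ T, ∃ a b c, t = {a, b, c} ∧ orient (pt a) (pt b) (pt c) ≠ 0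
  face_to_face : ∀ s ∈ T, ∀ t ∈ T, hull pt s ∩ hull pt t = hull pt (s ∩ t)
  vertices : ∀ i : N, ∃ t ∈ T, i ∈ t
  covers : ⋃ t ∈ T, hull pt t = R

/-- `T'` arises from `T` by one flip: two triangles `abc`, `abd` that share the edge `ab` and form
a strictly convex quadrilateral (its diagonals `ab`, `cd` cross in their interiors) are replaced by
the triangles `acd`, `bcd`. -/
def IsFlip {N : Type*} (pt : N → Plane) (T T' : Set (Set N)) : Prop :=
  ∃ a b c d : N, {a, b, c} ∈ T ∧ {a, b, d} ∈ T ∧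
    (openSegment ℝ (pt a) (pt b) ∩ openSegment ℝ (pt c) (pt d)).Nonempty ∧
    T' = (T \ {{a, b, c}, {a, b, d}}) ∪ {{a, c, d}, {b, c, d}}

/-- The flip distance of two triangulations of `R`: the least number of flips in a sequence of
triangulations of `R` from `T` to `T'` (`⊤` if there is no such sequence). -/
noncomputable def flipDist {N : Type*} (pt : N → Plane) (R : Set Plane) (T T' : Set (Set N)) :
    ℕ∞ :=
  sInf {n : ℕ∞ | ∃ m : ℕ, n = (m : ℕ∞) ∧ ∃ S : ℕ → Set (Set N), S 0 = T ∧ S m = T' ∧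
    (∀ i ≤ m, IsTriangulation pt R (S i)) ∧ ∀ i < m, IsFlip pt (S i) (S (i + 1))}

/-! ### Straight-line planar drawings -/

/-- The straight-line drawing of `G` with vertex positions `pos` is planar: distinct vertices are
at distinct points, and two different edges meet at most in a common endpoint. -/
structure IsPlanarDrawing {V : Type*} (G : SimpleGraph V) (pos : V → Plane) : Prop where
  injective : Function.Injective pos
  noncrossing : ∀ d e : G.Dart, d.edge ≠ e.edge →
    segment ℝ (pos d.fst) (pos d.snd) ∩ segment ℝ (pos e.fst) (pos e.snd) ⊆
      pos '' {v | v ∈ d.edge ∧ v ∈ e.edge}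

/-! ### The polygonal region built from a drawing

A dart `d = (v → w)` of `G` is an edge with a direction, seen from `v`.  The channel of an edge has
two chains of 7 vertices: `chain d 0, …, chain d 6` is the chain on the left hand side when walking
from `v` to `w`, listed from `v` to `w`.  The other chain of the same channel is `chain d.symm`,
listed from `w` to `v`.  If `d` points to the right, then `A_i = chain d (i - 1)` is the upper
chain `A_1, …, A_7` and `B_j = chain d.symm (7 - j)` is the lower chain `B_1, …, B_7`, both listed
from left to right. -/

/-- The vertices of the region: the chain vertices of the channels, and four further vertices
`C, D, E, F` for the gadget of every vertex of the graph. -/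
inductive Node {V : Type*} (G : SimpleGraph V) : Type _
  | chain (d : G.Dart) (i : Fin 7)
  | C (v : V)
  | D (v : V)
  | E (v : V)
  | F (v : V)

/-- The channels attached to the gadget of a vertex, given by the outgoing darts: channels 1, 2 at
a vertex of degree 2, or channels 1, 2, 3 at a vertex of degree 3. -/
inductive Ports {V : Type*} (G : SimpleGraph V) : Type _
  | two (d₁ d₂ : G.Dart)
  | three (d₁ d₂ d₃ : G.Dart)

/-- The data of the construction: a drawing of the graph, the numbering of the channels at every
vertex, and the positions of the vertices of the region. -/
structure Layout {V : Type*} (G : SimpleGraph V) where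
  pos : V → Plane
  ports : V → Ports G
  pt : Node G → Plane

namespace Layout

open Node

variable {V : Type*} {G : SimpleGraph V}

/-- The end vertex of the channel of `d = (v → w)` at `v` that is on the left hand side, looking
from `v` into the channel. -/
def leftEnd (d : G.Dart) : Node G := chain d 0

/-- The end vertex of the channel of `d = (v → w)` at `v` that is on the right hand side, looking
from `v` into the channel. -/
def rightEnd (d : G.Dart) : Node G := chain d.symm 6

/-- The triangulation of the gadget of `v`.  The end edge of channel 1 is `AB`, that of channel 2
is `A'B'`, that of channel 3 is `A''B''`.  In counterclockwise order, the gadget is the polygon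
`C A' B' D E F A B` for degree 2, and `C D A'' B'' E A B F A' B'` for degree 3.  The edge `CE` is
the lock. -/
def gadget (v : V) : Ports G → Set (Set (Node G))
  | .two d₁ d₂ =>
    let A := rightEnd d₁
    let B := leftEnd d₁
    let A' := rightEnd d₂
    let B' := leftEnd d₂
    {{A, B, C v}, {C v, A, F v}, {C v, F v, E v}, {C v, D v, E v}, {C v, D v, B'}, {A', B', C v}}
  | .three d₁ d₂ d₃ =>
    let A := rightEnd d₁
    let B := leftEnd d₁
    let A' := rightEnd d₂
    let B' := leftEnd d₂
    let A'' := rightEnd d₃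
    let B'' := leftEnd d₃
    {{A, B, F v}, {F v, A, E v}, {C v, F v, E v}, {C v, D v, E v},
      {A', B', C v}, {C v, A', F v}, {A'', B'', E v}, {E v, A'', D v}}

/-- The triangles of the left-inclined triangulation of the channel of `d` that have their apex at
the first vertex of the left chain of `d` (in the labelling above, `A_1 B_j B_{j+1}`).  Together
with those of `d.symm` (which are `B_7 A_i A_{i+1}`), they form the left-inclined triangulation. -/
def leftInclined (d : G.Dart) : Set (Set (Node G)) :=
  {t | ∃ i : Fin 6, t = {chain d 0, chain d.symm i.castSucc, chain d.symm i.succ}}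

/-- The triangles of the right-inclined triangulation of the channel of `d` that have their apex at
the last vertex of the left chain of `d` (in the labelling above, `A_7 B_j B_{j+1}`).  Together
with those of `d.symm` (which are `B_1 A_i A_{i+1}`), they form the right-inclined
triangulation. -/
def rightInclined (d : G.Dart) : Set (Set (Node G)) :=
  {t | ∃ i : Fin 6, t = {chain d 6, chain d.symm i.castSucc, chain d.symm i.succ}}

variable (X : Layout G)

/-- All vertex gadgets triangulated as above (locked), all channels left-inclined. -/
def T₁ : Set (Set (Node G)) :=
  (⋃ v, gadget v (X.ports v)) ∪ ⋃ d, leftInclined d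

/-- All vertex gadgets triangulated as above (locked), all channels right-inclined. -/
def T₂ : Set (Set (Node G)) :=
  (⋃ v, gadget v (X.ports v)) ∪ ⋃ d, rightInclined d

/-- The polygonal region: the union of all channels and all vertex gadgets. -/
def region : Set Plane := ⋃ t ∈ X.T₁, hull X.pt t

/-- Signed area spanned by two edges of the drawing, as vectors: positive iff the direction of `e`
is obtained from that of `d` by a counterclockwise rotation by an angle in `(0, π)`. -/
def turn (d e : G.Dart) : ℝ :=
  orient 0 (X.pos d.snd - X.pos d.fst) (X.pos e.snd - X.pos e.fst)

/-- `p` lies outside the wide mouth of the channel of `d = (v → w)` at `v`, on the left hand side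
(looking from `v` into the channel): strictly to the left of the line through the edge of the left
chain that is closest to `v`. -/
def LeftOfWide (d : G.Dart) (p : Node G) : Prop :=
  0 < orient (X.pt (chain d 0)) (X.pt (chain d 1)) (X.pt p)

/-- `p` lies outside the wide mouth of the channel of `d = (v → w)` at `v`, on the right hand
side. -/
def RightOfWide (d : G.Dart) (p : Node G) : Prop :=
  orient (X.pt (chain d.symm 6)) (X.pt (chain d.symm 5)) (X.pt p) < 0

/-- `p` lies outside the wide mouth of the channel of `d = (v → w)` at `v`. -/
def OutsideWide (d : G.Dart) (p : Node G) : Prop :=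
  X.LeftOfWide d p ∨ X.RightOfWide d p

/-- `p` lies inside the narrow mouth of the channel of `d = (v → w)` at `v`: beyond the end edge of
the channel at `v`, and strictly between the lines through those edges of the two chains that are
farthest from `v`. -/
def InNarrow (d : G.Dart) (p : Node G) : Prop :=
  orient (X.pt (chain d 5)) (X.pt (chain d 6)) (X.pt p) < 0 ∧
  0 < orient (X.pt (chain d.symm 1)) (X.pt (chain d.symm 0)) (X.pt p) ∧
  orient (X.pt (leftEnd d)) (X.pt (rightEnd d)) (X.pt p) < 0

/-- For consecutive channels `d, e` at `v` (counterclockwise, at an angle `< π`): the mouth of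
either channel at `v` passes beside the other channel, which stays outside the wide mouth, on the
side given by the cyclic order. -/
def MouthsClear (d e : G.Dart) : Prop :=
  X.LeftOfWide d (leftEnd e) ∧ X.LeftOfWide d (rightEnd e) ∧
  X.RightOfWide e (leftEnd d) ∧ X.RightOfWide e (rightEnd d)

/-- Placement of the channel of `d = (v → w)`: it replaces the edge `vw` of the drawing (its left
chain is to the left of the edge, its end edge at `v` is crossed by the edge), its chain is reflex
(convex towards the inside of the channel), and all vertices of one chain see all vertices of the
other. -/
structure ChannelPlaced (d : G.Dart) : Prop where
  left_of_edge : ∀ i, 0 < orient (X.pos d.fst) (X.pos d.snd) (X.pt (chain d i))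
  end_crossed : (openSegment ℝ (X.pt (leftEnd d)) (X.pt (rightEnd d)) ∩
    openSegment ℝ (X.pos d.fst) (X.pos d.snd)).Nonempty
  reflex : ∀ i j k, i < j → j < k →
    0 < orient (X.pt (chain d i)) (X.pt (chain d j)) (X.pt (chain d k))
  visible : ∀ i j k, i < j →
    orient (X.pt (chain d i)) (X.pt (chain d j)) (X.pt (chain d.symm k)) < 0

/-- Placement of the gadget at `v`.

Degree 2: the angle from channel 1 counterclockwise to channel 2 is the one that is less than `π`;
`C` is in that sector, outside both wide mouths; `D, E, F` are in the other sector; `D` is in the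
narrow mouth of channel 1 and outside the wide mouth of channel 2, `F` is in the narrow mouth of
channel 2 and outside the wide mouth of channel 1, `E` is outside both wide mouths.

Degree 3: channels 1, 2, 3 are in counterclockwise order and the vertex is not sharp (all three
angles are less than `π`); `C` and `D` are in the sector between channels 2 and 3, `E` in the one
between 3 and 1, `F` in the one between 1 and 2; `D` is in the narrow mouths of channels 1 and 2 and
outside the wide mouth of channel 3, `F` is in the narrow mouth of channel 3 and outside the wide
mouths of channels 1 and 2, `C` and `E` are outside all wide mouths.

In a sector going counterclockwise from channel `d` to channel `e`, being outside the wide mouth of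
`d` (of `e`) means being on its left (right) hand side. -/
def GadgetPlaced (v : V) : Ports G → Prop
  | .two d₁ d₂ =>
    (d₁ ≠ d₂ ∧ ∀ d : G.Dart, d.fst = v ↔ d = d₁ ∨ d = d₂) ∧
    0 < X.turn d₁ d₂ ∧ X.MouthsClear d₁ d₂ ∧
    (X.LeftOfWide d₁ (C v) ∧ X.RightOfWide d₂ (C v)) ∧
    (X.InNarrow d₁ (D v) ∧ X.LeftOfWide d₂ (D v)) ∧
    (X.RightOfWide d₁ (E v) ∧ X.LeftOfWide d₂ (E v)) ∧
    (X.InNarrow d₂ (F v) ∧ X.RightOfWide d₁ (F v))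
  | .three d₁ d₂ d₃ =>
    (d₁ ≠ d₂ ∧ d₂ ≠ d₃ ∧ d₃ ≠ d₁ ∧ ∀ d : G.Dart, d.fst = v ↔ d = d₁ ∨ d = d₂ ∨ d = d₃) ∧
    (0 < X.turn d₁ d₂ ∧ 0 < X.turn d₂ d₃ ∧ 0 < X.turn d₃ d₁) ∧
    (X.MouthsClear d₁ d₂ ∧ X.MouthsClear d₂ d₃ ∧ X.MouthsClear d₃ d₁) ∧
    (X.OutsideWide d₁ (C v) ∧ X.LeftOfWide d₂ (C v) ∧ X.RightOfWide d₃ (C v)) ∧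
    (X.InNarrow d₁ (D v) ∧ X.InNarrow d₂ (D v) ∧ X.RightOfWide d₃ (D v)) ∧
    (X.RightOfWide d₁ (E v) ∧ X.OutsideWide d₂ (E v) ∧ X.LeftOfWide d₃ (E v)) ∧
    (X.LeftOfWide d₁ (F v) ∧ X.RightOfWide d₂ (F v) ∧ X.InNarrow d₃ (F v))

/-- `X` is a result of the construction: a planar straight-line drawing of a graph with all degrees
2 or 3 and without sharp vertices, in which every edge is replaced by a channel and every vertex by
a vertex gadget, `CDEF` being a convex quadrilateral with diagonals `CE` and `DF`.  The last
condition says that the channels and gadgets are drawn without overlaps. -/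
structure IsConstruction : Prop where
  planar : IsPlanarDrawing G X.pos
  channel : ∀ d, X.ChannelPlaced d
  gadget_placed : ∀ v, X.GadgetPlaced v (X.ports v)
  convex_quad : ∀ v, (openSegment ℝ (X.pt (C v)) (X.pt (E v)) ∩
    openSegment ℝ (X.pt (D v)) (X.pt (F v))).Nonempty
  no_overlap : IsTriangulation X.pt X.region X.T₁

end Layout

/-! ### Orientations in the plane -/

/-! Upper bound. Let `S` be a vertex cover. Flipping the lock `CE` to `DF` in the gadgets of `S`
costs one flip per vertex (`flipStep_unlock`). Every channel now has an unlocked end, where the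
gadget has triangles `ABP`, `APQ`, `PQW` with `W` in the narrow mouth. Two flips, `PQ` to `AW` and
`PA` to `BW`, put the triangle `ABW` at the end edge (`cap_crossings`, `cap_flipPath`). As `W` sees
both chains, six flips for each of the two fans of an inclined triangulation move all channel
triangles to the apex `W` (`channel_flipPath`). The resulting star does not depend on the
inclination, so 14 flips to the star and 14 flips back turn a left-inclined channel into a
right-inclined one (`flipPath_channel`). Relocking gives 2|S| + 28|E| in total. All intermediate
sets are triangulations because flips preserve this property (`IsTriangulation.flipStep`).

Lower bound. Each of the 12 chain edges of a channel lies in exactly one triangle at all times, and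
a flip changes its apex only if the edge is a side of the flipped quadrilateral (`FlipAt.apex`).
Between `T₁` and `T₂` the apex travels from one end of the opposite chain to the other. As long as
it is never on the inner side of an opposite chain edge (`Tame`), it must pass every opposite edge,
and this happens in a flip whose quadrilateral is spanned by the two edges (`exists_common_flip`).
If this holds for one whole chain, the channel needs 6 · 6 = 36 flips.

Otherwise some chain edge sees a vertex that is not tame. The line of sight leaves the channel
through an end and can only lead to the vertex `W` of the port there. It crosses `PA`, `PQ` and the
lock `CE`, so all three are absent at that time (`unlocked_of_mem_mouth`). If `a` and `b` edges of
the two chains ever have an apex outside the channel, there are still 36 - ab common flips and two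
further flips for each of these a + b edges, at least 24 altogether (`channel_dichotomy`). Removing
and reinserting `PA` and `PQ` adds four.

So every edge accounts for 28 flips and has an end that is unlocked at some time, or it accounts for
at least 30 flips (`nearFlips_dichotomy`). Each lock that is ever opened accounts for two more
flips. These sets of flips are disjoint. The vertices unlocked at some time, together with one end
of every edge of the second kind, form a vertex cover, and each of its members is paid for by two
flips beyond 28|E| (`exists_cover`). -/

theorem orient_rotate (p q r : Plane) : orient q r p = orient p q r := by
  unfold orient; ring

theorem orient_rotate' (p q r : Plane) : orient r p q = orient p q r := by
  unfold orient; ring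

theorem orient_swap (p q r : Plane) : orient q p r = -orient p q r := by
  unfold orient; ring

theorem orient_swap_right (p q r : Plane) : orient p r q = -orient p q r := by
  unfold orient; ring

@[simp] theorem orient_self_left (p q : Plane) : orient p p q = 0 := by
  unfold orient; ring

@[simp] theorem orient_self_right (p q : Plane) : orient p q q = 0 := by
  unfold orient; ring

@[simp] theorem orient_self_outer (p q : Plane) : orient p q p = 0 := by
  unfold orient; ring

theorem orient_combo {α β : ℝ} (h : α + β = 1) (p q x y : Plane) :
    orient p q (α • x + β • y) = α * orient p q x + β * orient p q y := by
  obtain rfl : β = 1 - α := by linarith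
  simp only [orient, Prod.fst_add, Prod.snd_add, Prod.smul_fst, Prod.smul_snd, smul_eq_mul]
  ring

theorem orient_combo_three {α β γ : ℝ} (h : α + β + γ = 1) (p q x y z : Plane) :
    orient p q (α • x + β • y + γ • z) =
      α * orient p q x + β * orient p q y + γ * orient p q z := by
  obtain rfl : γ = 1 - α - β := by linarith
  simp only [orient, Prod.fst_add, Prod.snd_add, Prod.smul_fst, Prod.smul_snd, smul_eq_mul]
  ring

/-- The four triangles spanned by four points. -/
theorem orient_four (a b c d : Plane) :
    orient a b c + orient a c d = orient a b d + orient b c d := by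
  unfold orient; ring

/-- A point in barycentric coordinates. -/
theorem orient_smul_eq (a b c x : Plane) :
    orient a b c • x = orient b c x • a + orient c a x • b + orient a b x • c := by
  ext <;> simp only [orient, Prod.fst_add, Prod.snd_add, Prod.smul_fst, Prod.smul_snd,
    smul_eq_mul] <;> ring

theorem orient_sum (a b c x : Plane) :
    orient b c x + orient c a x + orient a b x = orient a b c := by
  unfold orient; ring

theorem mem_convexHull_triple {a b c x : Plane} :
    x ∈ convexHull ℝ {a, b, c} ↔
      ∃ α β γ : ℝ, 0 ≤ α ∧ 0 ≤ β ∧ 0 ≤ γ ∧ α + β + γ = 1 ∧ α • a + β • b + γ • c = x := by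
  constructor
  · intro h
    rw [convexHull_insert (by simp), convexHull_pair, mem_convexJoin] at h
    obtain ⟨_, rfl, y, ⟨s, t, hs, ht, hst, rfl⟩, u, v, hu, hv, huv, rfl⟩ := h
    refine ⟨u, v * s, v * t, hu, by positivity, by positivity, ?_, ?_⟩
    · rw [add_assoc, ← mul_add, hst, mul_one, huv]
    · rw [smul_add, smul_smul, smul_smul, add_assoc]
  · rintro ⟨α, β, γ, hα, hβ, hγ, h, rfl⟩
    have hc := convex_convexHull ℝ ({a, b, c} : Set Plane)
    have hs := hc.sum_mem (t := Finset.univ) (w := ![α, β, γ]) (z := ![a, b, c])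
      (by intro i _; fin_cases i <;> simpa) (by simpa [Fin.sum_univ_three] using h)
      (by intro i _; apply subset_convexHull; fin_cases i <;> simp)
    simpa [Fin.sum_univ_three] using hs

/-- Points on the inner side of all three edges lie in the triangle. -/
theorem mem_convexHull_triple_of_orient {σ : ℝ} {a b c x : Plane} (h : 0 < σ * orient a b c)
    (h₁ : 0 ≤ σ * orient b c x) (h₂ : 0 ≤ σ * orient c a x) (h₃ : 0 ≤ σ * orient a b x) :
    x ∈ convexHull ℝ {a, b, c} := by
  rw [mem_convexHull_triple]
  have hs := orient_sum a b c x
  refine ⟨σ * orient b c x / (σ * orient a b c), σ * orient c a x / (σ * orient a b c),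
    σ * orient a b x / (σ * orient a b c), by positivity, by positivity, by positivity, ?_, ?_⟩
  · rw [← add_div, ← add_div, ← mul_add, ← mul_add, hs, div_self h.ne']
  · have e := orient_smul_eq a b c x
    have h0 : orient a b c ≠ 0 := by rintro h0; simp [h0] at h
    have hσ : σ ≠ 0 := by rintro h0; simp [h0] at h
    simp only [mul_div_mul_left _ _ hσ]
    rw [← smul_right_injective Plane h0 |>.eq_iff]
    simp only [smul_add, smul_smul, mul_div_cancel₀ _ h0]
    exact e.symm

/-- The factor `s` carries a sign, so that mirror-image situations are handled by one statement. The
same device is used for channels below. -/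
theorem convex_orient_nonneg (s : ℝ) (p q : Plane) : Convex ℝ {x | 0 ≤ s * orient p q x} := by
  intro x hx y hy α β hα hβ h
  simp only [Set.mem_ofPred_eq] at *
  rw [orient_combo h]
  nlinarith [mul_nonneg hα hx, mul_nonneg hβ hy]

theorem convex_orient_pos (s : ℝ) (p q : Plane) : Convex ℝ {x | 0 < s * orient p q x} := by
  intro x hx y hy α β hα hβ h
  simp only [Set.mem_ofPred_eq] at *
  rw [orient_combo h]
  rcases hα.eq_or_lt with rfl | hα
  · obtain rfl : β = 1 := by linarith
    simpa using hy
  · nlinarith [mul_pos hα hx, mul_nonneg hβ hy.le]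

/-- Two segments whose end points are separated by each other's lines cross. -/
theorem openSegment_inter_nonempty {σ : ℝ} {a b c d : Plane} (h₁ : 0 < σ * orient a b c)
    (h₂ : σ * orient a b d < 0) (h₃ : 0 < σ * orient c d b) (h₄ : σ * orient c d a < 0) :
    (openSegment ℝ a b ∩ openSegment ℝ c d).Nonempty := by
  set u := σ * orient a b c with hu
  set v := -(σ * orient a b d) with hv
  set s := σ * orient c d b with hs
  set t := -(σ * orient c d a) with ht
  have hv0 : 0 < v := by linarith
  have ht0 : 0 < t := by linarith
  have e : u + v = s + t := by
    rw [hu, hv, hs, ht]; unfold orient; ring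
  -- The crossing point divides each segment in the ratio of the areas on the two sides of the other
  -- one. By `e` both denominators are the same scaled area of the quadrilateral.
  refine ⟨(s / (s + t)) • a + (t / (s + t)) • b,
    ⟨s / (s + t), t / (s + t), by positivity, by positivity, ?_, rfl⟩,
    ⟨v / (u + v), u / (u + v), by positivity, by positivity, ?_, ?_⟩⟩
  · field_simp
  · field_simp; ring
  · rw [e]
    have h0 : s + t ≠ 0 := by positivity
    rw [← smul_right_injective Plane h0 |>.eq_iff]
    simp only [smul_add, smul_smul, mul_div_cancel₀ _ h0]
    rw [hu, hv, hs, ht]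
    ext <;> simp only [orient, Prod.fst_add, Prod.snd_add, Prod.smul_fst, Prod.smul_snd,
      smul_eq_mul] <;> ring

/-- This makes nondegeneracy of a triangle independent of the order in which its label set is
written. -/
theorem orient_eq_of_collinear {a b c : Plane} {p q r : Plane} (h : orient p q r = 0)
    (ha : a = p ∨ a = q ∨ a = r) (hb : b = p ∨ b = q ∨ b = r) (hc : c = p ∨ c = q ∨ c = r) :
    orient a b c = 0 := by
  rcases ha with rfl | rfl | rfl <;> rcases hb with rfl | rfl | rfl <;>
    rcases hc with rfl | rfl | rfl <;> unfold orient at * <;>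
    first | linear_combination h | linear_combination -h | linear_combination (0 : ℝ) * h

/-! ### Convex hulls of labelled points. -/

section Hull

variable {N : Type*} (pt : N → Plane)

theorem hull_pair (a b : N) : hull pt {a, b} = segment ℝ (pt a) (pt b) := by
  rw [hull, Set.image_pair, convexHull_pair]

theorem hull_triple (a b c : N) : hull pt {a, b, c} = convexHull ℝ {pt a, pt b, pt c} := by
  rw [hull, Set.image_insert_eq, Set.image_pair]

theorem hull_mono {s t : Set N} (h : s ⊆ t) : hull pt s ⊆ hull pt t :=
  convexHull_mono (Set.image_mono h)

theorem mem_hull {t : Set N} {a : N} (h : a ∈ t) : pt a ∈ hull pt t :=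
  subset_convexHull ℝ _ (Set.mem_image_of_mem _ h)

theorem convex_hull (t : Set N) : Convex ℝ (hull pt t) := convex_convexHull ℝ _

theorem segment_subset_hull {t : Set N} {x y : Plane} (hx : x ∈ hull pt t) (hy : y ∈ hull pt t) :
    segment ℝ x y ⊆ hull pt t :=
  (convex_hull pt t).segment_subset hx hy

variable {pt}

theorem orient_nonneg_of_mem_hull {s : ℝ} {p q x : Plane} {t : Set N}
    (h : ∀ i ∈ t, 0 ≤ s * orient p q (pt i)) (hx : x ∈ hull pt t) : 0 ≤ s * orient p q x := by
  refine convexHull_min ?_ (convex_orient_nonneg s p q) hx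
  rintro _ ⟨i, hi, rfl⟩
  exact h i hi

theorem orient_nonpos_of_mem_hull {s : ℝ} {p q x : Plane} {t : Set N}
    (h : ∀ i ∈ t, s * orient p q (pt i) ≤ 0) (hx : x ∈ hull pt t) : s * orient p q x ≤ 0 := by
  have := orient_nonneg_of_mem_hull (pt := pt) (s := -s) (p := p) (q := q) (t := t)
    (fun i hi => by have := h i hi; linarith) hx
  linarith

theorem isClosed_hull [Finite N] (t : Set N) : IsClosed (hull pt t) :=
  ((Set.toFinite (pt '' t)).isCompact_convexHull ℝ).isClosed

end Hull

/-! ### Triangulations -/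

namespace IsTriangulation

variable {N : Type*} {pt : N → Plane} {R : Set Plane} {T : Set (Set N)}

theorem orient_ne_zero (h : IsTriangulation pt R T) {a b c : N} (ht : {a, b, c} ∈ T) :
    orient (pt a) (pt b) (pt c) ≠ 0 := by
  obtain ⟨a', b', c', e, hn⟩ := h.nondegenerate _ ht
  intro h0
  apply hn
  have mem : ∀ x ∈ ({a', b', c'} : Set N), pt x = pt a ∨ pt x = pt b ∨ pt x = pt c := by
    intro x hx
    rw [← e] at hx
    rcases hx with rfl | rfl | rfl <;> simp
  exact orient_eq_of_collinear h0 (mem _ (by simp)) (mem _ (by simp)) (mem _ (by simp))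

theorem distinct (h : IsTriangulation pt R T) {a b c : N} (ht : {a, b, c} ∈ T) :
    a ≠ b ∧ a ≠ c ∧ b ≠ c := by
  have := h.orient_ne_zero ht
  refine ⟨?_, ?_, ?_⟩ <;> rintro rfl <;> simp at this

theorem exists_third (h : IsTriangulation pt R T) {t : Set N} (ht : t ∈ T) {p q : N} (hp : p ∈ t)
    (hq : q ∈ t) (hpq : p ≠ q) : ∃ r, t = {p, q, r} := by
  obtain ⟨a, b, c, rfl, -⟩ := h.nondegenerate _ ht
  rcases hp with rfl | rfl | rfl <;> rcases hq with rfl | rfl | rfl <;>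
    first
      | exact absurd rfl hpq
      | exact ⟨a, by ext x; simp only [Set.mem_insert_iff, Set.mem_singleton_iff]; tauto⟩
      | exact ⟨b, by ext x; simp only [Set.mem_insert_iff, Set.mem_singleton_iff]; tauto⟩
      | exact ⟨c, rfl⟩
      | exact ⟨c, by ext x; simp only [Set.mem_insert_iff, Set.mem_singleton_iff]; tauto⟩

theorem exists_pair (h : IsTriangulation pt R T) {t : Set N} (ht : t ∈ T) {p : N} (hp : p ∈ t) :
    ∃ q r, t = {p, q, r} := by
  obtain ⟨a, b, c, rfl, -⟩ := h.nondegenerate _ ht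
  rcases hp with rfl | rfl | rfl
  · exact ⟨b, c, rfl⟩
  · exact ⟨a, c, by ext x; simp only [Set.mem_insert_iff, Set.mem_singleton_iff]; tauto⟩
  · exact ⟨a, b, by ext x; simp only [Set.mem_insert_iff, Set.mem_singleton_iff]; tauto⟩

/-- If a point of the triangle `t` with positive weight at the vertex `p` lies in the triangle
`s`, then `p` is a vertex of `s`. -/
theorem mem_of_weight (h : IsTriangulation pt R T) {s : Set N} (hs : s ∈ T) {p q r : N}
    (ht : {p, q, r} ∈ T) {z : Plane} (hz : z ∈ hull pt s) (hz' : z ∈ hull pt {p, q, r})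
    (hw : orient (pt q) (pt r) z ≠ 0) : p ∈ s := by
  by_contra hp
  apply hw
  have hz2 : z ∈ hull pt (s ∩ {p, q, r}) := h.face_to_face _ hs _ ht ▸ ⟨hz, hz'⟩
  -- Without `p`, the common face is spanned by points of the line `qr`, so `z` would have weight
  -- zero at `p`.
  have hsub : ∀ i ∈ s ∩ {p, q, r}, orient (pt q) (pt r) (pt i) = 0 := by
    rintro i ⟨hi, rfl | rfl | rfl⟩
    · exact absurd hi hp
    · simp
    · simp
  have h1 := orient_nonneg_of_mem_hull (s := 1) (fun i hi => by rw [hsub i hi]; simp) hz2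
  have h2 := orient_nonpos_of_mem_hull (s := 1) (fun i hi => by rw [hsub i hi]; simp) hz2
  linarith

/-- The point `pt p` has nonzero weight at `p` in any triangle that has `p` as a vertex, and such a
triangle exists by `vertices`. -/
theorem mem_of_mem_hull (h : IsTriangulation pt R T) {t : Set N} (ht : t ∈ T) {p : N}
    (hp : pt p ∈ hull pt t) : p ∈ t := by
  obtain ⟨t', ht', hpt'⟩ := h.vertices p
  obtain ⟨q, r, rfl⟩ := h.exists_pair ht' hpt'
  refine h.mem_of_weight ht ht' hp (mem_hull pt hpt') ?_
  rw [orient_rotate]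
  exact h.orient_ne_zero ht'

/-- A triangle that contains an interior point of an edge contains the edge. -/
theorem left_mem_of_openSegment (h : IsTriangulation pt R T) {s t : Set N} (hs : s ∈ T)
    (ht : t ∈ T) {p q : N} (hp : p ∈ t) (hq : q ∈ t) {z : Plane}
    (hz : z ∈ openSegment ℝ (pt p) (pt q)) (hzs : z ∈ hull pt s) : p ∈ s := by
  by_cases hpq : p = q
  · subst hpq
    rw [openSegment_same] at hz
    exact h.mem_of_mem_hull hs (hz ▸ hzs)
  obtain ⟨r, rfl⟩ := h.exists_third ht hp hq hpq
  refine h.mem_of_weight hs ht hzs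
    (segment_subset_hull pt (mem_hull pt hp) (mem_hull pt hq)
      (openSegment_subset_segment ℝ _ _ hz)) ?_
  obtain ⟨α, β, hα, hβ, hαβ, rfl⟩ := hz
  rw [orient_combo hαβ, orient_rotate, orient_self_outer, mul_zero, add_zero]
  exact mul_ne_zero hα.ne' (h.orient_ne_zero ht)

theorem mem_of_openSegment (h : IsTriangulation pt R T) {s t : Set N} (hs : s ∈ T)
    (ht : t ∈ T) {p q : N} (hp : p ∈ t) (hq : q ∈ t) {z : Plane}
    (hz : z ∈ openSegment ℝ (pt p) (pt q)) (hzs : z ∈ hull pt s) : p ∈ s ∧ q ∈ s :=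
  ⟨h.left_mem_of_openSegment hs ht hp hq hz hzs,
    h.left_mem_of_openSegment hs ht hq hp (openSegment_symm ℝ (pt p) (pt q) ▸ hz) hzs⟩

/-- Edges of a triangulation do not cross. -/
theorem edges_noncrossing (h : IsTriangulation pt R T) {s t : Set N} (hs : s ∈ T) (ht : t ∈ T)
    {a b c d : N} (ha : a ∈ s) (hb : b ∈ s) (hab : a ≠ b) (hc : c ∈ t) (hd : d ∈ t) (hcd : c ≠ d)
    (hx : (openSegment ℝ (pt a) (pt b) ∩ openSegment ℝ (pt c) (pt d)).Nonempty) :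
    ({a, b} : Set N) = {c, d} := by
  obtain ⟨z, hz, hz'⟩ := hx
  -- Both `c` and `d` are vertices of `s`. Were `c` the vertex opposite to `ab`, no point in the
  -- interior of `cd` would be on the line `ab`.
  have key : ∀ {s t : Set N}, s ∈ T → t ∈ T → ∀ {a b c d : N}, a ∈ s → b ∈ s →
      a ≠ b → c ∈ t → d ∈ t → ∀ z, z ∈ openSegment ℝ (pt a) (pt b) → z ∈ openSegment ℝ (pt c) (pt d) →
      c = a ∨ c = b := by
    intro s t hs ht a b c d ha hb hab hc hd z hz hz'
    have hzs : z ∈ hull pt s := segment_subset_hull pt (mem_hull pt ha) (mem_hull pt hb)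
      (openSegment_subset_segment ℝ _ _ hz)
    have hcs := h.left_mem_of_openSegment hs ht hc hd hz' hzs
    by_contra hne
    push Not at hne
    obtain ⟨r, rfl⟩ := h.exists_third hs ha hb hab
    obtain rfl : c = r := by
      rcases hcs with h1 | h1 | h1
      · exact absurd h1 hne.1
      · exact absurd h1 hne.2
      · exact h1
    have ho := h.orient_ne_zero hs
    have hds := (h.mem_of_openSegment hs ht hc hd hz' hzs).2
    have hdz : orient (pt a) (pt b) z = 0 := by
      obtain ⟨α, β, hα, hβ, hαβ, rfl⟩ := hz
      rw [orient_combo hαβ]; simp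
    obtain ⟨α, β, hα, hβ, hαβ, rfl⟩ := hz'
    rw [orient_combo hαβ] at hdz
    rcases hds with rfl | rfl | rfl
    · simp [hα.ne', ho] at hdz
    · simp [hα.ne', ho] at hdz
    · rw [← add_mul, hαβ, one_mul] at hdz
      exact ho hdz
  have hz1 := openSegment_symm ℝ (pt a) (pt b) ▸ hz
  have hz2 := openSegment_symm ℝ (pt c) (pt d) ▸ hz'
  apply Set.Subset.antisymm
  · rintro x (rfl | rfl)
    · exact key ht hs hc hd hcd ha hb z hz' hz
    · exact key ht hs hc hd hcd hb ha z hz' hz1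
  · rintro x (rfl | rfl)
    · exact key hs ht ha hb hab hc hd z hz hz'
    · exact key hs ht ha hb hab hd hc z hz hz2

/-- Two triangles at an edge lie on different sides of it. -/
theorem opposite_sides (h : IsTriangulation pt R T) {p q r s : N} (hr : {p, q, r} ∈ T)
    (hs : {p, q, s} ∈ T) (hrs : r ≠ s) :
    orient (pt p) (pt q) (pt r) * orient (pt p) (pt q) (pt s) < 0 := by
  have hr0 := h.orient_ne_zero hr
  have hs0 := h.orient_ne_zero hs
  refine lt_of_le_of_ne (le_of_not_gt fun hpos => ?_) (mul_ne_zero hr0 hs0)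
  set w := orient (pt p) (pt q) (pt r) / orient (pt p) (pt q) (pt s) with hw
  set u := orient (pt q) (pt s) (pt r) / orient (pt p) (pt q) (pt s) with hu
  set v := orient (pt s) (pt p) (pt r) / orient (pt p) (pt q) (pt s) with hv
  have hw0 : 0 < w := by
    rw [hw]
    rcases pos_and_pos_or_neg_and_neg_of_mul_pos hpos with ⟨h1, h2⟩ | ⟨h1, h2⟩
    · exact div_pos h1 h2
    · exact div_pos_of_neg_of_neg h1 h2
  have hsum : u + v + w = 1 := by
    rw [hu, hv, hw, ← add_div, ← add_div, orient_sum, div_self hs0]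
  have hrpt : pt r = u • pt p + v • pt q + w • pt s := by
    rw [← smul_right_injective Plane hs0 |>.eq_iff]
    simp only [smul_add, smul_smul, hu, hv, hw, mul_div_cancel₀ _ hs0]
    exact orient_smul_eq _ _ _ _
  -- If `r` and `s` were on the same side, the point `x` near the midpoint of `pq`, displaced
  -- towards `r`, would be in both triangles. The coordinates `u`, `v` of `r` may be negative; this
  -- `ε` keeps the weights of `x` at `p` and `q` nonnegative.
  set ε := 1 / (2 * (1 + |u| + |v|)) with hε
  have hε0 : 0 < ε := by positivity
  have hε1 : ε * (1 + |u| + |v|) = 1 / 2 := by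
    rw [hε]; field_simp
  have hu' := neg_abs_le u
  have hv' := neg_abs_le v
  have b1 : 0 ≤ (1 - ε) / 2 + ε * u := by
    nlinarith [abs_nonneg u, abs_nonneg v, mul_le_mul_of_nonneg_left hu' hε0.le,
      mul_nonneg hε0.le (abs_nonneg v)]
  have b2 : 0 ≤ (1 - ε) / 2 + ε * v := by
    nlinarith [abs_nonneg u, abs_nonneg v, mul_le_mul_of_nonneg_left hv' hε0.le,
      mul_nonneg hε0.le (abs_nonneg u)]
  have b3 : ε ≤ 1 := by
    nlinarith [mul_nonneg hε0.le (abs_nonneg u), mul_nonneg hε0.le (abs_nonneg v)]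
  set x := ((1 - ε) / 2) • pt p + ((1 - ε) / 2) • pt q + ε • pt r with hx
  have hxr : x ∈ hull pt {p, q, r} := by
    rw [hull_triple, mem_convexHull_triple]
    exact ⟨_, _, _, by linarith, by linarith, hε0.le, by ring, rfl⟩
  have hxs : x ∈ hull pt {p, q, s} := by
    rw [hull_triple, mem_convexHull_triple]
    refine ⟨_, _, _, b1, b2, mul_nonneg hε0.le hw0.le, ?_, ?_⟩
    · linear_combination ε * hsum
    · rw [hx, hrpt]
      module
  have hr' : r ∈ ({p, q, s} : Set N) := by
    have e : ({r, p, q} : Set N) = {p, q, r} := by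
      ext y; simp only [Set.mem_insert_iff, Set.mem_singleton_iff]; tauto
    refine h.mem_of_weight hs (e ▸ hr) hxs (e ▸ hxr) ?_
    rw [hx, orient_combo_three (by ring)]
    simp [hε0.ne', hr0]
  have hd := h.distinct hr
  rcases hr' with h1 | h1 | h1
  · exact hd.2.1 h1.symm
  · exact hd.2.2 h1.symm
  · exact hrs h1

end IsTriangulation

/-! ### Flips preserve triangulations -/

theorem triple_perm_right {N : Type*} (a b c : N) : ({a, c, b} : Set N) = {a, b, c} := by
  rw [Set.pair_comm]

theorem triple_perm_left {N : Type*} (a b c : N) : ({b, a, c} : Set N) = {a, b, c} :=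
  Set.insert_comm _ _ _

theorem triple_rotate {N : Type*} (a b c : N) : ({b, c, a} : Set N) = {a, b, c} := by
  rw [triple_perm_right, triple_perm_left]

/-- In a quadrilateral with crossing diagonals `ab` and `cd`, the triangle `acd` is covered by
`abc` and `abd`. -/
theorem triangle_subset_union {a b c d : Plane}
    (h : (openSegment ℝ a b ∩ openSegment ℝ c d).Nonempty) :
    convexHull ℝ {a, c, d} ⊆ convexHull ℝ {a, b, c} ∪ convexHull ℝ {a, b, d} := by
  obtain ⟨z, ⟨s, t, hs, ht, hst, rfl⟩, u, v, hu, hv, huv, e⟩ := h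
  intro x hx
  obtain ⟨α, γ, δ, hα, hγ, hδ, h1, rfl⟩ := mem_convexHull_triple.1 hx
  -- The alternative is the side of the line `ab`: eliminating `d` by means of the crossing point
  -- leaves the weight `γ - δu/v` at `c`.
  by_cases hc : δ * u ≤ γ * v
  · left
    rw [mem_convexHull_triple]
    refine ⟨α + δ * s / v, δ * t / v, γ - δ * u / v, by positivity, by positivity, ?_, ?_, ?_⟩
    · rw [sub_nonneg, div_le_iff₀ hv]; exact hc
    · field_simp
      linear_combination v * h1 + δ * hst - δ * huv
    · have ed : d = (s / v) • a + (t / v) • b - (u / v) • c := by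
        rw [← smul_right_injective Plane hv.ne' |>.eq_iff]
        simp only [smul_add, smul_sub, smul_smul, mul_div_cancel₀ _ hv.ne']
        rw [← e]; abel
      have e2 := congrArg (fun y => α • a + γ • c + δ • y) ed
      rw [e2]
      module
  · right
    rw [mem_convexHull_triple]
    push Not at hc
    refine ⟨α + γ * s / u, γ * t / u, δ - γ * v / u, by positivity, by positivity, ?_, ?_, ?_⟩
    · rw [sub_nonneg, div_le_iff₀ hu]; exact hc.le
    · field_simp
      linear_combination u * h1 + γ * hst - γ * huv
    · have ec : c = (s / u) • a + (t / u) • b - (v / u) • d := by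
        rw [← smul_right_injective Plane hu.ne' |>.eq_iff]
        simp only [smul_add, smul_sub, smul_smul, mul_div_cancel₀ _ hu.ne']
        rw [← e]; abel
      have e2 := congrArg (fun y => α • a + γ • y + δ • d) ec
      rw [e2]
      module

/-- The crossing point is a positive combination of `c` and `d` and lies on the line `ab`, so the
orientations of `c` and `d` cancel with positive weights. -/
theorem orient_mul_neg_of_crossing {a b c d : Plane}
    (h : (openSegment ℝ a b ∩ openSegment ℝ c d).Nonempty) (hc : orient a b c ≠ 0) :
    orient a b c * orient a b d < 0 := by
  obtain ⟨z, ⟨s, t, hs, ht, hst, rfl⟩, u, v, hu, hv, huv, e⟩ := h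
  have h0 : orient a b (u • c + v • d) = 0 := by
    rw [e, orient_combo hst]; simp
  rw [orient_combo huv] at h0
  have : v * (orient a b c * orient a b d) = -(u * orient a b c ^ 2) := by
    linear_combination orient a b c * h0
  have h2 : 0 < u * orient a b c ^ 2 := by positivity
  by_contra hn
  push Not at hn
  nlinarith [mul_nonneg hv.le hn]

/-- If `a` were on the line `cd`, so would be `b`, because of the crossing point. Then `orient_four`
makes the triangles `abc` and `abd` equally oriented, against their being on opposite sides. -/
theorem orient_ne_zero_of_crossing {a b c d : Plane}
    (h : (openSegment ℝ a b ∩ openSegment ℝ c d).Nonempty) (hc : orient a b c ≠ 0) :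
    orient c d a ≠ 0 := by
  intro h0
  have hneg := orient_mul_neg_of_crossing h hc
  obtain ⟨z, ⟨s, t, hs, ht, hst, rfl⟩, u, v, hu, hv, huv, e⟩ := h
  have h1 : orient c d (s • a + t • b) = 0 := by
    rw [← e, orient_combo huv]; simp
  rw [orient_combo hst, h0] at h1
  have h2 : orient c d b = 0 := by simpa [ht.ne'] using h1
  have h4 := orient_four a b c d
  have h5 : orient a c d = orient c d a := (orient_rotate a c d).symm
  have h6 : orient b c d = orient c d b := (orient_rotate b c d).symm
  rw [h5, h6, h0, h2, add_zero, add_zero] at h4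
  rw [h4] at hneg
  exact absurd hneg (not_lt.2 (mul_self_nonneg _))

/-- A flip, with the unchanged part of the triangulation made explicit. -/
def FlipStep {N : Type*} (pt : N → Plane) (T T' : Set (Set N)) : Prop :=
  ∃ (U : Set (Set N)) (a b c d : N), {a, b, c} ∉ U ∧ {a, b, d} ∉ U ∧ {a, c, d} ∉ U ∧
    {b, c, d} ∉ U ∧ T = U ∪ {{a, b, c}, {a, b, d}} ∧ T' = U ∪ {{a, c, d}, {b, c, d}} ∧
    (openSegment ℝ (pt a) (pt b) ∩ openSegment ℝ (pt c) (pt d)).Nonempty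

namespace FlipStep

variable {N : Type*} {pt : N → Plane} {T T' : Set (Set N)}

theorem isFlip (h : FlipStep pt T T') : IsFlip pt T T' := by
  obtain ⟨U, a, b, c, d, h1, h2, -, -, rfl, rfl, hx⟩ := h
  refine ⟨a, b, c, d, by simp, by simp, hx, ?_⟩
  congr 1
  ext t
  simp only [Set.mem_sdiff, Set.mem_union, Set.mem_insert_iff, Set.mem_singleton_iff]
  constructor
  · intro ht
    refine ⟨Or.inl ht, ?_⟩
    rintro (rfl | rfl) <;> contradiction
  · tauto

theorem symm (h : FlipStep pt T T') : FlipStep pt T' T := by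
  obtain ⟨U, a, b, c, d, h1, h2, h3, h4, rfl, rfl, hx⟩ := h
  have e1 : ({c, d, a} : Set N) = {a, c, d} := triple_rotate _ _ _
  have e2 : ({c, d, b} : Set N) = {b, c, d} := triple_rotate _ _ _
  have e3 : ({c, a, b} : Set N) = {a, b, c} := (triple_rotate _ _ _).symm
  have e4 : ({d, a, b} : Set N) = {a, b, d} := (triple_rotate _ _ _).symm
  refine ⟨U, c, d, a, b, ?_⟩
  rw [e1, e2, e3, e4]
  exact ⟨h3, h4, h1, h2, rfl, rfl, by rwa [Set.inter_comm]⟩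

end FlipStep

namespace IsTriangulation

variable {N : Type*} {pt : N → Plane} {R : Set Plane}

/-- If `s` misses `b`, its common face with `abc` is already a face of `acd`. If `s` contains `b`,
it cannot contain `a`: three triangles at the edge `ab` would be pairwise on opposite sides. So the
common face is within `bc`, and `acd` meets `bc` only in `c`, since `b` is strictly beyond the line
`cd`. -/
theorem inter_flipped_half {U : Set (Set N)} {a b c d : N}
    (h : IsTriangulation pt R (U ∪ {{a, b, c}, {a, b, d}}))
    (h1 : {a, b, c} ∉ U) (h2 : {a, b, d} ∉ U)
    (hx : (openSegment ℝ (pt a) (pt b) ∩ openSegment ℝ (pt c) (pt d)).Nonempty)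
    {s : Set N} (hs : s ∈ U) {x : Plane} (hxs : x ∈ hull pt s) (hxc : x ∈ hull pt {a, b, c})
    (hxa : x ∈ hull pt {a, c, d}) : x ∈ hull pt (s ∩ {a, c, d}) := by
  have hsT : s ∈ U ∪ {{a, b, c}, {a, b, d}} := Or.inl hs
  have hc : ({a, b, c} : Set N) ∈ U ∪ {{a, b, c}, {a, b, d}} := by simp
  have hd : ({a, b, d} : Set N) ∈ U ∪ {{a, b, c}, {a, b, d}} := by simp
  have hx2 : x ∈ hull pt (s ∩ {a, b, c}) := h.face_to_face _ hsT _ hc ▸ ⟨hxs, hxc⟩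
  have hc0 := h.orient_ne_zero hc
  have hcd := h.orient_ne_zero hd
  by_cases hb : b ∈ s
  · have ha : a ∉ s := by
      intro ha
      obtain ⟨e, rfl⟩ := h.exists_third hsT ha hb (h.distinct hc).1
      have hce : c ≠ e := by rintro rfl; exact h1 hs
      have hde : d ≠ e := by rintro rfl; exact h2 hs
      have o1 := h.opposite_sides hc hsT hce
      have o2 := h.opposite_sides hd hsT hde
      have o3 := orient_mul_neg_of_crossing hx hc0
      have p1 := mul_pos_of_neg_of_neg o1 o2
      have p2 : 0 < orient (pt a) (pt b) (pt e) ^ 2 := by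
        have := h.orient_ne_zero hsT
        positivity
      nlinarith [mul_neg_of_neg_of_pos o3 p2]
    have hbc : s ∩ {a, b, c} ⊆ {b, c} := by
      rintro y ⟨hy, rfl | rfl | rfl⟩
      · exact absurd hy ha
      · simp
      · simp
    have hx3 := hull_mono pt hbc hx2
    rw [hull_pair] at hx3
    obtain ⟨β, γ, hβ, hγ, h1', rfl⟩ := hx3
    have hx' : (openSegment ℝ (pt c) (pt d) ∩ openSegment ℝ (pt a) (pt b)).Nonempty := by
      rwa [Set.inter_comm]
    have ho := orient_mul_neg_of_crossing hx' (orient_ne_zero_of_crossing hx hc0)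
    have hp := orient_nonneg_of_mem_hull (s := orient (pt c) (pt d) (pt a)) (p := pt c)
      (q := pt d) (by
        rintro i (rfl | rfl | rfl)
        · exact mul_self_nonneg _
        · simp
        · simp) hxa
    rw [orient_combo h1', orient_self_outer, mul_zero, add_zero] at hp
    have hβ0 : β = 0 := by
      by_contra hne
      have : 0 < β := lt_of_le_of_ne hβ (Ne.symm hne)
      nlinarith
    subst hβ0
    obtain rfl : γ = 1 := by linarith
    simp only [zero_smul, one_smul, zero_add] at hxs ⊢
    exact mem_hull pt ⟨h.mem_of_mem_hull hsT hxs, by simp⟩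
  · refine hull_mono pt ?_ hx2
    rintro y ⟨hy, rfl | rfl | rfl⟩
    · exact ⟨hy, by simp⟩
    · exact absurd hy hb
    · exact ⟨hy, by simp⟩

/-- The old triangles `abc` and `abd` cover `acd`; exchanging `c` and `d` reduces the second part to
the first. -/
theorem inter_flipped {U : Set (Set N)} {a b c d : N}
    (h : IsTriangulation pt R (U ∪ {{a, b, c}, {a, b, d}}))
    (h1 : {a, b, c} ∉ U) (h2 : {a, b, d} ∉ U)
    (hx : (openSegment ℝ (pt a) (pt b) ∩ openSegment ℝ (pt c) (pt d)).Nonempty)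
    {s : Set N} (hs : s ∈ U) :
    hull pt s ∩ hull pt {a, c, d} = hull pt (s ∩ {a, c, d}) := by
  refine Set.Subset.antisymm ?_ (Set.subset_inter (hull_mono pt Set.inter_subset_left)
    (hull_mono pt Set.inter_subset_right))
  rintro x ⟨hxs, hxa⟩
  have hcov := triangle_subset_union hx
  rw [← hull_triple, ← hull_triple, ← hull_triple] at hcov
  rcases hcov hxa with hc | hd
  · exact inter_flipped_half h h1 h2 hx hs hxs hc hxa
  · have hx' : (openSegment ℝ (pt a) (pt b) ∩ openSegment ℝ (pt d) (pt c)).Nonempty := by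
      rwa [openSegment_symm ℝ (pt d)]
    have := inter_flipped_half (c := d) (d := c) (by rwa [Set.pair_comm ({a, b, d} : Set N)]) h2 h1 hx' hs hxs
      hd (by rwa [Set.pair_comm d c])
    rwa [Set.pair_comm d c] at this

/-- This is why the upper bound only needs crossing diagonals: once `T₁` is known to be a
triangulation, every set reached by flips is one too. -/
theorem flipStep {T T' : Set (Set N)} (h : IsTriangulation pt R T) (hf : FlipStep pt T T') :
    IsTriangulation pt R T' := by
  obtain ⟨U, a, b, c, d, h1, h2, -, -, rfl, rfl, hx⟩ := hf
  have hc : ({a, b, c} : Set N) ∈ U ∪ {{a, b, c}, {a, b, d}} := by simp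
  have hd : ({a, b, d} : Set N) ∈ U ∪ {{a, b, c}, {a, b, d}} := by simp
  have hx1 : (openSegment ℝ (pt b) (pt a) ∩ openSegment ℝ (pt c) (pt d)).Nonempty := by
    rwa [openSegment_symm ℝ (pt b)]
  have hx2 : (openSegment ℝ (pt c) (pt d) ∩ openSegment ℝ (pt a) (pt b)).Nonempty := by
    rwa [Set.inter_comm]
  have hx3 : (openSegment ℝ (pt d) (pt c) ∩ openSegment ℝ (pt a) (pt b)).Nonempty := by
    rwa [openSegment_symm ℝ (pt d)]
  have hc0 := h.orient_ne_zero hc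
  have hd0 := h.orient_ne_zero hd
  have hcda := orient_ne_zero_of_crossing hx hc0
  have hneg := orient_mul_neg_of_crossing hx2 hcda
  have hcdb : orient (pt c) (pt d) (pt b) ≠ 0 := by
    rintro h0; simp [h0] at hneg
  have hb' : IsTriangulation pt R (U ∪ {{b, a, c}, {b, a, d}}) := by
    rwa [triple_perm_left a b c, triple_perm_left a b d]
  have ia : ∀ s ∈ U, hull pt s ∩ hull pt {a, c, d} = hull pt (s ∩ {a, c, d}) := fun s hs =>
    inter_flipped h h1 h2 hx hs
  have ib : ∀ s ∈ U, hull pt s ∩ hull pt {b, c, d} = hull pt (s ∩ {b, c, d}) := fun s hs =>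
    inter_flipped hb' (by rwa [triple_perm_left]) (by rwa [triple_perm_left]) hx1 hs
  have iab : hull pt {a, c, d} ∩ hull pt {b, c, d} = hull pt ({a, c, d} ∩ {b, c, d}) := by
    refine Set.Subset.antisymm ?_ (Set.subset_inter (hull_mono pt Set.inter_subset_left)
      (hull_mono pt Set.inter_subset_right))
    rintro x ⟨hxa, hxb⟩
    have hp := orient_nonneg_of_mem_hull (s := orient (pt c) (pt d) (pt a)) (p := pt c)
      (q := pt d) (by
        rintro i (rfl | rfl | rfl)
        · exact mul_self_nonneg _
        · simp
        · simp) hxa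
    rw [hull_triple, mem_convexHull_triple] at hxb
    obtain ⟨β, γ, δ, hβ, hγ, hδ, hsum, rfl⟩ := hxb
    rw [orient_combo_three hsum] at hp
    simp only [orient_self_outer, orient_self_right, mul_zero, add_zero] at hp
    have hβ0 : β = 0 := by
      by_contra hne
      have : 0 < β := lt_of_le_of_ne hβ (Ne.symm hne)
      nlinarith
    subst hβ0
    have hsub : ({c, d} : Set N) ⊆ {a, c, d} ∩ {b, c, d} := by
      rintro y (rfl | rfl) <;> simp
    apply hull_mono pt hsub
    rw [hull_pair]
    exact ⟨γ, δ, hγ, hδ, by linarith, by simp⟩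
  constructor
  · rintro t (ht | rfl | rfl)
    · exact h.nondegenerate t (Or.inl ht)
    · exact ⟨a, c, d, rfl, by rwa [← orient_rotate]⟩
    · exact ⟨b, c, d, rfl, by rwa [← orient_rotate]⟩
  · rintro s (hs | rfl | rfl) t (ht | rfl | rfl)
    · exact h.face_to_face s (Or.inl hs) t (Or.inl ht)
    · exact ia s hs
    · exact ib s hs
    · rw [Set.inter_comm, ia t ht, Set.inter_comm]
    · simp
    · exact iab
    · rw [Set.inter_comm, ib t ht, Set.inter_comm]
    · rw [Set.inter_comm, iab, Set.inter_comm]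
    · simp
  · intro i
    obtain ⟨t, ht | rfl | rfl, hi⟩ := h.vertices i
    · exact ⟨t, Or.inl ht, hi⟩
    · rcases hi with rfl | rfl | rfl
      · exact ⟨{i, c, d}, by simp, by simp⟩
      · exact ⟨{i, c, d}, by simp, by simp⟩
      · exact ⟨{a, i, d}, by simp, by simp⟩
    · rcases hi with rfl | rfl | rfl
      · exact ⟨{i, c, d}, by simp, by simp⟩
      · exact ⟨{i, c, d}, by simp, by simp⟩
      · exact ⟨{a, c, i}, by simp, by simp⟩
  -- The two pairs of triangles cover each other, by `triangle_subset_union` applied to either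
  -- diagonal.
  · rw [← h.covers, Set.biUnion_union, Set.biUnion_union]
    congr 1
    simp only [Set.mem_insert_iff, Set.mem_singleton_iff, Set.iUnion_iUnion_eq_or_left,
      Set.iUnion_iUnion_eq_left, hull_triple]
    have s1 := triangle_subset_union hx
    have s2 := triangle_subset_union hx1
    have s3 := triangle_subset_union hx2
    have s4 := triangle_subset_union hx3
    rw [triple_perm_left (pt a) (pt b), triple_perm_left (pt a) (pt b)] at s2
    rw [← triple_rotate (pt a) (pt c) (pt d)] at s1
    rw [← triple_rotate (pt b) (pt c) (pt d)] at s2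
    rw [← triple_rotate (pt a) (pt c) (pt d), ← triple_rotate (pt b) (pt c) (pt d)]
    rw [triple_perm_left (pt c) (pt d), triple_perm_left (pt c) (pt d)] at s4
    rw [← triple_rotate (pt c) (pt a) (pt b)] at s3
    rw [← triple_rotate (pt d) (pt a) (pt b)] at s4
    exact Set.Subset.antisymm (Set.union_subset s1 s2) (Set.union_subset s3 s4)

end IsTriangulation

/-! ### Channels -/

/-- Two reflex chains that see each other, up to reflection (`σ = -1`): for `σ = 1`, the chain `l`
is on the left hand side and `r` on the right hand side of the channel, both listed from its near
end to its far end. -/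
structure Chan (σ : ℝ) (l r : Fin 7 → Plane) : Prop where
  reflex_left : ∀ i j k, i < j → j < k → 0 < σ * orient (l i) (l j) (l k)
  reflex_right : ∀ i j k, i < j → j < k → σ * orient (r i) (r j) (r k) < 0
  visible_left : ∀ i j k, i < j → σ * orient (l i) (l j) (r k) < 0
  visible_right : ∀ i j k, i < j → 0 < σ * orient (r i) (r j) (l k)

/-- The point `w` is beyond the near end of the channel and sees both chains. -/
structure IsCap (σ : ℝ) (l r : Fin 7 → Plane) (w : Plane) : Prop where
  beyond : σ * orient (l 0) (r 0) w < 0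
  left : ∀ i : Fin 6, σ * orient (l i.castSucc) (l i.succ) w < 0
  right : ∀ i : Fin 6, 0 < σ * orient (r i.castSucc) (r i.succ) w

/-- The difference is the cross product of `b - a` and `d - c`. The chain turns the same way at `b`
and `c`, and since `p` is on the same side of all three edges, the total turn stays below a half
turn. -/
theorem orient_sub_neg {s : ℝ} {p a b c d : Plane} (h₁ : 0 < s * orient a b p)
    (h₂ : 0 < s * orient b c p) (h₃ : 0 < s * orient c d p) (h₄ : s * orient a b c < 0)
    (h₅ : s * orient b c d < 0) : s * (orient a b d - orient a b c) < 0 := by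
  have e : (s * orient b c p) * (s * (orient a b d - orient a b c)) =
      (s * orient a b p) * (s * orient b c d) +
        (s * orient c d p - s * orient b c d) * (s * orient a b c) := by
    unfold orient; ring
  have h₆ := mul_neg_of_pos_of_neg h₁ h₅
  have h₇ : (s * orient c d p - s * orient b c d) * (s * orient a b c) < 0 :=
    mul_neg_of_pos_of_neg (by linarith) h₄
  by_contra hn
  push Not at hn
  nlinarith [mul_nonneg h₂.le hn]

/-- A point on the outer side of the line `ab` and on the inner side of the line `cd` is on the
same side of the line `pq` as `b`. -/
theorem orient_le_of_sides {s : ℝ} {p q a b c d y : Plane}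
    (h : s * (orient a b d - orient a b c) < 0)
    (hp : s * orient a b q ≤ s * orient a b p) (hp' : s * orient c d q ≤ s * orient c d p)
    (hb : s * orient c d b ≤ 0) (hy : s * orient a b y ≤ 0) (hy' : 0 ≤ s * orient c d y) :
    s * orient p q b ≤ s * orient p q y := by
  -- The three-term Plücker relation for the vectors `b - a`, `d - c`, `q - p` and `y - b`.
  have e : (s * (orient a b d - orient a b c)) * (s * orient p q y - s * orient p q b) =
      (s * orient a b q - s * orient a b p) * (s * orient c d y - s * orient c d b) -
        (s * orient a b y) * (s * orient c d q - s * orient c d p) := by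
    unfold orient; ring
  by_contra hn
  push Not at hn
  have h₁ := mul_pos_of_neg_of_neg h (sub_neg.2 hn)
  have h₂ := mul_nonneg (sub_nonneg.2 hp) (show 0 ≤ s * orient c d y - s * orient c d b by linarith)
  have h₃ := mul_nonneg (neg_nonneg.2 hy) (sub_nonneg.2 hp')
  nlinarith

namespace Chan

variable {σ : ℝ} {l r : Fin 7 → Plane}

theorem swap (h : Chan σ l r) : Chan (-σ) r l where
  reflex_left i j k hij hjk := by have := h.reflex_right i j k hij hjk; linarith
  reflex_right i j k hij hjk := by have := h.reflex_left i j k hij hjk; linarith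
  visible_left i j k hij := by have := h.visible_right i j k hij; linarith
  visible_right i j k hij := by have := h.visible_left i j k hij; linarith

theorem left_inside (h : Chan σ l r) {i : Fin 7} (hi : 0 < i) :
    0 < σ * orient (l 0) (r 0) (l i) := by
  have := h.visible_left 0 i 0 hi
  rw [orient_swap_right] at this
  linarith

theorem right_inside (h : Chan σ l r) {i : Fin 7} (hi : 0 < i) :
    0 < σ * orient (l 0) (r 0) (r i) := by
  have := h.visible_right 0 i 0 hi
  rwa [← orient_rotate'] at this

theorem right_nonpos (h : Chan σ l r) (i : Fin 6) (k : Fin 7) :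
    σ * orient (r i.castSucc) (r i.succ) (r k) ≤ 0 := by
  rcases lt_trichotomy k i.castSucc with hk | rfl | hk
  · rw [orient_rotate]
    exact (h.reflex_right _ _ _ hk Fin.castSucc_lt_succ).le
  · simp
  · rcases (Fin.castSucc_lt_iff_succ_le.1 hk).eq_or_lt with rfl | hk
    · simp
    · exact (h.reflex_right _ _ _ Fin.castSucc_lt_succ hk).le

theorem left_nonneg (h : Chan σ l r) (i : Fin 6) (k : Fin 7) :
    0 ≤ σ * orient (l i.castSucc) (l i.succ) (l k) := by
  have := h.swap.right_nonpos i k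
  linarith

/-- A point outside the channel line `r i, r (i + 1)` and inside a later one is beyond the near
end. -/
theorem inside_of_sides (h : Chan σ l r) {i j : Fin 6} (hij : i < j) {y : Plane}
    (hy : σ * orient (r i.castSucc) (r i.succ) y ≤ 0)
    (hy' : 0 ≤ σ * orient (r j.castSucc) (r j.succ) y) : 0 < σ * orient (l 0) (r 0) y := by
  -- The edges `i` and `j` are not parallel and turn in the direction of the chain. For adjacent
  -- edges this is reflexivity itself; otherwise three consecutive segments are seen from `l 0`.
  have hs : σ * (orient (r i.castSucc) (r i.succ) (r j.succ) -
      orient (r i.castSucc) (r i.succ) (r j.castSucc)) < 0 := by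
    rcases (Fin.succ_le_castSucc_iff.2 hij).eq_or_lt with e | hlt
    · rw [← e]
      have := h.reflex_right i.castSucc i.succ j.succ Fin.castSucc_lt_succ
        (e ▸ Fin.castSucc_lt_succ)
      simpa using this
    · exact orient_sub_neg (h.visible_right _ _ 0 Fin.castSucc_lt_succ)
        (h.visible_right _ _ 0 hlt) (h.visible_right _ _ 0 Fin.castSucc_lt_succ)
        (h.reflex_right _ _ _ Fin.castSucc_lt_succ hlt)
        (h.reflex_right _ _ _ hlt Fin.castSucc_lt_succ)
  refine (h.right_inside (Fin.succ_pos i)).trans_le (orient_le_of_sides hs ?_ ?_ ?_ hy hy')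
  · exact (h.right_nonpos i 0).trans (h.visible_right _ _ 0 Fin.castSucc_lt_succ).le
  · exact (h.right_nonpos j 0).trans (h.visible_right _ _ 0 Fin.castSucc_lt_succ).le
  · exact h.right_nonpos j _

/-- By `inside_of_sides`, a point outside the first chain edge and inside a later one would be on
the channel side of the end line. So behind the end, the wide mouth decides about all chain edges.
-/
theorem outside_of_outside (h : Chan σ l r) {y : Plane} (hg : σ * orient (l 0) (r 0) y ≤ 0)
    (hy : σ * orient (r 0) (r 1) y < 0) (j : Fin 6) :
    σ * orient (r j.castSucc) (r j.succ) y < 0 := by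
  rcases (Fin.zero_le j).eq_or_lt with rfl | hj
  · exact hy
  · by_contra hn
    push Not at hn
    exact hg.not_gt (h.inside_of_sides hj hy.le hn)

/-- Behind the end line, the lines of the last chain edges are the most restrictive ones. Therefore
the narrow mouth, which is defined by these two edges only, consists of points that see both chains.
-/
theorem isCap (h : Chan σ l r) {w : Plane} (hg : σ * orient (l 0) (r 0) w < 0)
    (hl : σ * orient (l 5) (l 6) w < 0) (hr : 0 < σ * orient (r 5) (r 6) w) : IsCap σ l r w := by
  have key : ∀ {σ : ℝ} {l r : Fin 7 → Plane}, Chan σ l r → σ * orient (l 0) (r 0) w < 0 →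
      0 < σ * orient (r 5) (r 6) w → ∀ i : Fin 6, 0 < σ * orient (r i.castSucc) (r i.succ) w := by
    intro σ l r h hg hr i
    rcases (Fin.le_last i).eq_or_lt with rfl | hi
    · exact hr
    · by_contra hn
      push Not at hn
      exact hg.not_ge (h.inside_of_sides hi hn hr.le).le
  refine ⟨hg, fun i => ?_, key h hg hr⟩
  have := key h.swap (by rw [orient_swap]; linarith) (by linarith) i
  linarith

end Chan

/-- Directions from `x` into the open half-plane bounded by the line `pq` through `x` are linearly
ordered by angle; this is transitivity of that order for `l'`, `l`, `w`. -/
theorem orient_pos_of_rotation {s : ℝ} {x l l' w p q : Plane} (hx : orient p q x = 0)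
    (h₁ : 0 < s * orient p q l) (h₂ : 0 < s * orient p q l') (h₃ : 0 < s * orient p q w)
    (h₄ : 0 < s * orient x l' l) (h₅ : 0 < s * orient x l w) : 0 < s * orient x l' w := by
  have e : (s * (orient p q l - orient p q x)) * (s * orient x l' w) =
      (s * (orient p q l' - orient p q x)) * (s * orient x l w) +
        (s * (orient p q w - orient p q x)) * (s * orient x l' l) := by
    unfold orient; ring
  rw [hx, sub_zero, sub_zero, sub_zero] at e
  by_contra hn
  push Not at hn
  nlinarith [mul_pos h₂ h₅, mul_pos h₃ h₄, mul_nonneg h₁.le (neg_nonneg.2 hn)]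

namespace IsCap

variable {σ : ℝ} {l r : Fin 7 → Plane} {w : Plane}

theorem swap (h : IsCap σ l r w) : IsCap (-σ) r l w where
  beyond := by have := h.beyond; rw [orient_swap]; linarith
  left i := by have := h.right i; linarith
  right i := by have := h.left i; linarith

/-- The line of a chain edge at `r j` serves: the preceding edge, or the first edge if `j = 0`. -/
theorem exists_line (hc : Chan σ l r) (h : IsCap σ l r w) (j : Fin 7) :
    ∃ p q, orient p q (r j) = 0 ∧ (∀ i, 0 < σ * orient p q (l i)) ∧ 0 < σ * orient p q w := by
  rcases (Fin.zero_le j).eq_or_lt with rfl | hj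
  · exact ⟨r (Fin.castSucc 0), r (Fin.succ 0), by simp,
      fun i => hc.visible_right _ _ i Fin.castSucc_lt_succ, h.right 0⟩
  · obtain ⟨k, rfl⟩ := Fin.exists_succ_eq.2 hj.ne'
    exact ⟨r k.castSucc, r k.succ, by simp,
      fun i => hc.visible_right _ _ i Fin.castSucc_lt_succ, h.right k⟩

/-- Induction along the left chain: around `r j`, the directions to consecutive left vertices and to
`w` stay in one half-plane, so their angular order propagates. -/
theorem beyond_of_left (hc : Chan σ l r) (h : IsCap σ l r w) (j : Fin 7)
    (h0 : σ * orient (l 0) (r j) w < 0) (i : Fin 7) : σ * orient (l i) (r j) w < 0 := by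
  obtain ⟨p, q, hx, hl, hw⟩ := h.exists_line hc j
  induction i using Fin.induction with
  | zero => exact h0
  | succ i ih =>
    have := orient_pos_of_rotation (s := σ) hx (hl i.castSucc) (hl i.succ) hw
      (by
        have := hc.visible_left i.castSucc i.succ j Fin.castSucc_lt_succ
        rw [orient_swap_right, orient_rotate']
        linarith)
      (by rw [orient_swap]; linarith)
    rw [orient_swap] at this
    linarith

/-- The far ends of the diagonal are moved one after the other: along the right chain with `l 0`
fixed, which is the mirrored case, and then along the left chain. -/
theorem beyond_diagonal (hc : Chan σ l r) (h : IsCap σ l r w) (i j : Fin 7) :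
    σ * orient (l i) (r j) w < 0 := by
  refine h.beyond_of_left hc j ?_ i
  have := h.swap.beyond_of_left hc.swap 0 h.swap.beyond j
  rw [orient_swap] at this
  linarith

/-- The flips in the channel below a cap. -/
theorem crossing (hc : Chan σ l r) (h : IsCap σ l r w) (i : Fin 7) (k : Fin 6) :
    (openSegment ℝ (l i) (r k.castSucc) ∩ openSegment ℝ (r k.succ) w).Nonempty := by
  refine openSegment_inter_nonempty (σ := σ) ?_ (h.beyond_diagonal hc _ _) ?_ ?_
  · have := hc.visible_right k.castSucc k.succ i Fin.castSucc_lt_succ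
    rwa [← orient_rotate'] at this
  · have := h.right k
    rwa [← orient_rotate] at this
  · have := h.beyond_diagonal hc i k.succ
    rwa [← orient_rotate] at this

end IsCap

/-- The two flips by which `w` becomes the cap of a channel with near end `l 0, r 0`, from the
triangles `A B P`, `A P Q`, `P Q w` with `A = r 0`, `B = l 0`. -/
theorem cap_crossings {σ : ℝ} {l r : Fin 7 → Plane} {w p q : Plane} (hc : Chan σ l r)
    (hw : IsCap σ l r w) (hp : 0 < σ * orient (l 0) (l 1) p)
    (gp : σ * orient (l 0) (r 0) p < 0)
    (hq : σ * orient (r 0) (r 1) q < 0)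
    (hpq : orient (r 0) p (l 0) * orient (r 0) p q < 0)
    (hpw : orient p q (r 0) * orient p q w < 0)
    (hwn : w ∉ convexHull ℝ {r 0, p, l 0}) :
    (openSegment ℝ p q ∩ openSegment ℝ (r 0) w).Nonempty ∧
      (openSegment ℝ p (r 0) ∩ openSegment ℝ (l 0) w).Nonempty := by
  have hσ : 0 < σ ^ 2 := by
    have : σ ≠ 0 := by rintro rfl; simp at hp
    positivity
  have flip : ∀ {x y : ℝ}, x * y < 0 → (σ * x) * (σ * y) < 0 := by
    intro x y hxy
    nlinarith [mul_neg_of_pos_of_neg hσ hxy]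
  have g1 := hc.left_inside (i := 1) (by decide)
  have g2 := hc.right_inside (i := 1) (by decide)
  have gw := hw.beyond
  have fw : σ * orient (l 0) (l 1) w < 0 := hw.left 0
  have fw' : 0 < σ * orient (r 0) (r 1) w := hw.right 0
  -- the side of `w` at the segment `p r₀`
  have e1 : (σ * orient (l 0) (r 0) (l 1)) * (σ * orient (l 0) w p) =
      (σ * orient (l 0) (r 0) w) * (σ * orient (l 0) (l 1) p) -
        (σ * orient (l 0) (r 0) p) * (σ * orient (l 0) (l 1) w) := by
    unfold orient; ring
  have k1 : σ * orient (l 0) w p < 0 := by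
    by_contra hn
    push Not at hn
    nlinarith [mul_nonneg g1.le hn, mul_neg_of_neg_of_pos gw hp, mul_pos_of_neg_of_neg gp fw]
  have hA : σ * orient (r 0) p (l 0) < 0 := by
    rwa [← orient_rotate']
  -- On the other side of `r 0`, `p`, or on that line, `w` would be inside the triangle `r 0`, `p`,
  -- `l 0`, because the other two sides of this triangle already have `w` on the inner side.
  have k2 : 0 < σ * orient (r 0) p w := by
    by_contra hn
    push Not at hn
    refine hwn (mem_convexHull_triple_of_orient (σ := -σ) (by linarith) ?_ ?_ (by linarith))
    · have e : orient p (l 0) w = orient (l 0) w p := (orient_rotate _ _ _).symm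
      rw [e]; linarith
    · linarith
  have hAq : 0 < σ * orient (r 0) p q := by
    by_contra hn
    push Not at hn
    nlinarith [flip hpq, mul_nonneg_of_nonpos_of_nonpos hA.le hn]
  have hpqr : orient p q (r 0) = orient (r 0) p q := orient_rotate _ _ _
  have hpqw : σ * orient p q w < 0 := by
    have := flip hpw
    rw [hpqr] at this
    by_contra hn
    push Not at hn
    nlinarith [mul_nonneg hAq.le hn]
  -- the side of `q` at the segment `r₀ w`
  have e2 : (σ * orient (r 0) (l 0) w) * (σ * -orient (r 0) p (r 1)) =
      (σ * orient (r 0) (l 0) p) * (σ * orient (r 0) (r 1) w) +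
        (-(σ * orient (r 0) (l 0) (r 1))) * (σ * orient (r 0) p w) := by
    unfold orient; ring
  have s1 : ∀ x, orient (r 0) (l 0) x = -orient (l 0) (r 0) x := fun x => orient_swap _ _ _
  rw [s1, s1, s1] at e2
  -- The vertex `r 1` is on the same side of the line from `r 0` to `p` as `l 0`. This orders the
  -- directions at `r 0`, and the position of `q` relative to the first chain edge can be compared
  -- with that of `w`.
  have k3 : 0 < σ * -orient (r 0) p (r 1) := by
    by_contra hn
    push Not at hn
    nlinarith [mul_pos (neg_pos.2 gp) fw', mul_pos g2 k2, mul_nonneg (neg_nonneg.2 gw.le)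
      (neg_nonneg.2 hn)]
  have e3 : (σ * -orient (r 0) p (r 1)) * (σ * orient (r 0) w q) =
      (σ * orient (r 0) p w) * -(σ * orient (r 0) (r 1) q) +
        (σ * orient (r 0) p q) * (σ * orient (r 0) (r 1) w) := by
    unfold orient; ring
  have k4 : 0 < σ * orient (r 0) w q := by
    by_contra hn
    push Not at hn
    nlinarith [mul_pos k2 (neg_pos.2 hq), mul_pos hAq fw', mul_nonneg k3.le (neg_nonneg.2 hn)]
  constructor
  · refine openSegment_inter_nonempty (σ := σ) (by rwa [hpqr]) hpqw k4 ?_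
    rw [orient_swap_right]; linarith
  · refine openSegment_inter_nonempty (σ := σ) ?_ ?_ ?_ k1
    · rw [orient_swap]; linarith
    · rw [orient_swap]; linarith
    · rw [orient_swap_right]; linarith

/-! ### Sequences of flips -/

/-- A sequence of `n` flips. -/
def FlipPath {N : Type*} (pt : N → Plane) : ℕ → Set (Set N) → Set (Set N) → Prop
  | 0, T, T' => T = T'
  | n + 1, T, T' => ∃ T'', FlipPath pt n T T'' ∧ FlipStep pt T'' T'

namespace FlipPath

variable {N : Type*} {pt : N → Plane}

theorem trans {m n : ℕ} {T T' T'' : Set (Set N)} (h : FlipPath pt m T T')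
    (h' : FlipPath pt n T' T'') : FlipPath pt (m + n) T T'' := by
  induction n generalizing T'' with
  | zero => cases h'; exact h
  | succ n ih =>
    obtain ⟨S, h1, h2⟩ := h'
    exact ⟨S, ih h1, h2⟩

theorem single {T T' : Set (Set N)} (h : FlipStep pt T T') : FlipPath pt 1 T T' := ⟨T, rfl, h⟩

theorem symm {n : ℕ} {T T' : Set (Set N)} (h : FlipPath pt n T T') : FlipPath pt n T' T := by
  induction n generalizing T' with
  | zero => exact Eq.symm h
  | succ n ih =>
    obtain ⟨S, h1, h2⟩ := h
    have := (single h2.symm).trans (ih h1)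
    rwa [add_comm] at this

theorem exists_seq {n : ℕ} {T T' : Set (Set N)} (h : FlipPath pt n T T') :
    ∃ S : ℕ → Set (Set N), S 0 = T ∧ S n = T' ∧ ∀ i < n, FlipStep pt (S i) (S (i + 1)) := by
  induction n generalizing T' with
  | zero => exact ⟨fun _ => T, rfl, h, by simp⟩
  | succ n ih =>
    obtain ⟨T'', h1, h2⟩ := h
    obtain ⟨S, hS0, hSn, hS⟩ := ih h1
    refine ⟨fun i => if i ≤ n then S i else T', by simpa, by simp, fun i hi => ?_⟩
    rcases (Nat.lt_succ_iff.1 hi).eq_or_lt with rfl | hlt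
    · simpa [hSn] using h2
    · simpa [hlt.le, Nat.succ_le_of_lt hlt] using hS i hlt

theorem isTriangulation {R : Set Plane} {n : ℕ} {T T' : Set (Set N)} (h : FlipPath pt n T T')
    (hT : IsTriangulation pt R T) : IsTriangulation pt R T' := by
  induction n generalizing T' with
  | zero => cases h; exact hT
  | succ n ih =>
    obtain ⟨S, h1, h2⟩ := h
    exact (ih h1).flipStep h2

theorem flipDist_le {R : Set Plane} {n : ℕ} {T T' : Set (Set N)} (h : FlipPath pt n T T')
    (hT : IsTriangulation pt R T) : flipDist pt R T T' ≤ n := by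
  obtain ⟨S, h0, hn, hS⟩ := h.exists_seq
  refine sInf_le ⟨n, rfl, S, h0, hn, fun i hi => ?_, fun i hi => (hS i hi).isFlip⟩
  induction i with
  | zero => rwa [h0]
  | succ i ih => exact (ih (Nat.le_of_succ_le hi)).flipStep (hS i hi)

end FlipPath

/-! ### Fans -/

section Fan

variable {N : Type*}

/-- The triangles with apex `o` over the edges of the chain `c`. -/
def fan (o : N) (c : Fin 7 → N) : Set (Set N) :=
  {t | ∃ i : Fin 6, t = {o, c i.castSucc, c i.succ}}

variable {pt : N → Plane}

/-- After `k` flips the first `k` triangles have the apex `w`, the remaining ones have the apex `o`,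
and the triangle `o`, `c k`, `w` separates them. The next flip replaces the diagonal from `o` to `c
k` by the one from `c (k + 1)` to `w`. By `hU`, triangles of `U` have a vertex elsewhere and are
never confused with those being flipped. -/
theorem fan_flipPath_aux {o w : N} {c : Fin 7 → N} (hc : Function.Injective c)
    (ho : ∀ i, o ≠ c i) (hw : ∀ i, w ≠ c i) (how : o ≠ w) {U : Set (Set N)}
    (hU : ∀ t ∈ U, ∃ n ∈ t, n ≠ o ∧ n ≠ w ∧ ∀ i, n ≠ c i)
    (hx : ∀ k : Fin 6, (openSegment ℝ (pt o) (pt (c k.castSucc)) ∩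
      openSegment ℝ (pt (c k.succ)) (pt w)).Nonempty) (k : Fin 7) :
    FlipPath pt k (U ∪ fan o c ∪ {{o, c 0, w}})
      (U ∪ {t | ∃ i : Fin 6, k ≤ i.castSucc ∧ t = {o, c i.castSucc, c i.succ}} ∪
        {t | ∃ i : Fin 6, i.castSucc < k ∧ t = {w, c i.castSucc, c i.succ}} ∪ {{o, c k, w}}) := by
  induction k using Fin.induction with
  | zero =>
    change _ = _
    congr 1
    ext t
    simp [fan]
  | succ k ih =>
    refine FlipPath.trans (m := k) (n := 1) ih (FlipPath.single ?_)
    refine ⟨U ∪ {t | ∃ i : Fin 6, k.succ ≤ i.castSucc ∧ t = {o, c i.castSucc, c i.succ}} ∪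
        {t | ∃ i : Fin 6, i.castSucc < k.castSucc ∧ t = {w, c i.castSucc, c i.succ}},
      o, c k.castSucc, c k.succ, w, ?_, ?_, ?_, ?_, ?_, ?_, hx k⟩
    · rintro ((h | ⟨i, hi, h⟩) | ⟨i, hi, h⟩)
      · obtain ⟨n, hn, h1, h2, h3⟩ := hU _ h
        rcases hn with rfl | rfl | rfl <;>
          first | exact h1 rfl | exact h2 rfl | exact h3 _ rfl
      · have : c k.castSucc ∈ ({o, c i.castSucc, c i.succ} : Set N) := h ▸ by simp
        rcases this with e | e | e
        · exact ho _ e.symm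
        · have := hc e
          simp only [Fin.ext_iff, Fin.le_def, Fin.val_succ, Fin.val_castSucc] at *; omega
        · have := hc e
          simp only [Fin.ext_iff, Fin.le_def, Fin.val_succ, Fin.val_castSucc] at *; omega
      · have : o ∈ ({w, c i.castSucc, c i.succ} : Set N) := h ▸ by simp
        rcases this with e | e | e
        · exact how e
        · exact ho _ e
        · exact ho _ e
    · rintro ((h | ⟨i, hi, h⟩) | ⟨i, hi, h⟩)
      · obtain ⟨n, hn, h1, h2, h3⟩ := hU _ h
        rcases hn with rfl | rfl | rfl <;>
          first | exact h1 rfl | exact h2 rfl | exact h3 _ rfl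
      · have : w ∈ ({o, c i.castSucc, c i.succ} : Set N) := h ▸ by simp
        rcases this with e | e | e
        · exact how e.symm
        · exact hw _ e
        · exact hw _ e
      · have : o ∈ ({w, c i.castSucc, c i.succ} : Set N) := h ▸ by simp
        rcases this with e | e | e
        · exact how e
        · exact ho _ e
        · exact ho _ e
    · rintro ((h | ⟨i, hi, h⟩) | ⟨i, hi, h⟩)
      · obtain ⟨n, hn, h1, h2, h3⟩ := hU _ h
        rcases hn with rfl | rfl | rfl <;>
          first | exact h1 rfl | exact h2 rfl | exact h3 _ rfl
      · have : w ∈ ({o, c i.castSucc, c i.succ} : Set N) := h ▸ by simp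
        rcases this with e | e | e
        · exact how e.symm
        · exact hw _ e
        · exact hw _ e
      · have : o ∈ ({w, c i.castSucc, c i.succ} : Set N) := h ▸ by simp
        rcases this with e | e | e
        · exact how e
        · exact ho _ e
        · exact ho _ e
    · rintro ((h | ⟨i, hi, h⟩) | ⟨i, hi, h⟩)
      · obtain ⟨n, hn, h1, h2, h3⟩ := hU _ h
        rcases hn with rfl | rfl | rfl <;>
          first | exact h1 rfl | exact h2 rfl | exact h3 _ rfl
      · have : w ∈ ({o, c i.castSucc, c i.succ} : Set N) := h ▸ by simp
        rcases this with e | e | e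
        · exact how e.symm
        · exact hw _ e
        · exact hw _ e
      · have : c k.succ ∈ ({w, c i.castSucc, c i.succ} : Set N) := h ▸ by simp
        rcases this with e | e | e
        · exact hw _ e.symm
        · have := hc e
          simp only [Fin.ext_iff, Fin.lt_def, Fin.val_succ, Fin.val_castSucc] at *; omega
        · have := hc e
          simp only [Fin.ext_iff, Fin.lt_def, Fin.val_succ, Fin.val_castSucc] at *; omega
    · ext t
      simp only [Set.mem_union, Set.mem_ofPred_eq, Set.mem_insert_iff, Set.mem_singleton_iff]
      have : (∃ i : Fin 6, k.castSucc ≤ i.castSucc ∧ t = {o, c i.castSucc, c i.succ}) ↔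
          (∃ i : Fin 6, k.succ ≤ i.castSucc ∧ t = {o, c i.castSucc, c i.succ}) ∨
            t = {o, c k.castSucc, c k.succ} := by
        constructor
        · rintro ⟨i, hi, rfl⟩
          rcases hi.eq_or_lt with e | hlt
          · obtain rfl : k = i := Fin.castSucc_injective _ e
            exact Or.inr rfl
          · exact Or.inl ⟨i, Fin.castSucc_lt_iff_succ_le.1 hlt, rfl⟩
        · rintro (⟨i, hi, rfl⟩ | rfl)
          · exact ⟨i, (Fin.castSucc_lt_succ.le).trans hi, rfl⟩
          · exact ⟨k, le_rfl, rfl⟩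
      rw [this]
      exact Iff.of_eq (by ac_rfl)
    · ext t
      simp only [Set.mem_union, Set.mem_ofPred_eq, Set.mem_insert_iff, Set.mem_singleton_iff]
      have : (∃ i : Fin 6, i.castSucc < k.succ ∧ t = {w, c i.castSucc, c i.succ}) ↔
          (∃ i : Fin 6, i.castSucc < k.castSucc ∧ t = {w, c i.castSucc, c i.succ}) ∨
            t = {c k.castSucc, c k.succ, w} := by
        rw [triple_rotate w]
        constructor
        · rintro ⟨i, hi, rfl⟩
          rcases (Fin.castSucc_lt_succ_iff.1 hi).eq_or_lt with rfl | hlt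
          · exact Or.inr rfl
          · exact Or.inl ⟨i, hlt, rfl⟩
        · rintro (⟨i, hi, rfl⟩ | rfl)
          · exact ⟨i, hi.trans Fin.castSucc_lt_succ, rfl⟩
          · exact ⟨k, Fin.castSucc_lt_succ, rfl⟩
      rw [this]
      exact Iff.of_eq (by ac_rfl)

/-- Six flips that move the apex of a fan from `o` to `w`. -/
theorem fan_flipPath {o w : N} {c : Fin 7 → N} (hc : Function.Injective c)
    (ho : ∀ i, o ≠ c i) (hw : ∀ i, w ≠ c i) (how : o ≠ w) {U : Set (Set N)}
    (hU : ∀ t ∈ U, ∃ n ∈ t, n ≠ o ∧ n ≠ w ∧ ∀ i, n ≠ c i)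
    (hx : ∀ k : Fin 6, (openSegment ℝ (pt o) (pt (c k.castSucc)) ∩
      openSegment ℝ (pt (c k.succ)) (pt w)).Nonempty) :
    FlipPath pt 6 (U ∪ fan o c ∪ {{o, c 0, w}}) (U ∪ fan w c ∪ {{o, c 6, w}}) := by
  have := fan_flipPath_aux hc ho hw how hU hx 6
  have e1 : {t : Set N | ∃ i : Fin 6, (6 : Fin 7) ≤ i.castSucc ∧ t = {o, c i.castSucc, c i.succ}} = ∅ := by
    ext t
    simp only [Set.mem_ofPred_eq, Set.mem_empty_iff_false, iff_false]
    rintro ⟨i, hi, -⟩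
    exact not_le.2 i.castSucc_lt_last hi
  have h2 : ∀ i : Fin 6, i.castSucc < (6 : Fin 7) := fun i => i.castSucc_lt_last
  simp only [e1, h2, true_and, Set.union_empty] at this
  exact this

/-- Twelve flips from an inclined triangulation of a channel with a cap `w` to the one in which all
triangles have the apex `w`. -/
theorem channel_flipPath {σ : ℝ} {l r : Fin 7 → N} {w : N} (hl : Function.Injective l)
    (hr : Function.Injective r) (hlr : ∀ i j, l i ≠ r j) (hwl : ∀ i, w ≠ l i)
    (hwr : ∀ i, w ≠ r i) {U : Set (Set N)}
    (hU : ∀ t ∈ U, ∃ n ∈ t, n ≠ w ∧ (∀ i, n ≠ l i) ∧ ∀ i, n ≠ r i)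
    (hc : Chan σ (pt ∘ l) (pt ∘ r)) (hw : IsCap σ (pt ∘ l) (pt ∘ r) (pt w)) :
    FlipPath pt 12 (U ∪ (fan (l 0) r ∪ fan (r 6) l) ∪ {{l 0, r 0, w}})
      (U ∪ (fan w r ∪ fan w l) ∪ {{l 6, r 6, w}}) := by
  have p1 : FlipPath pt 6 ((U ∪ fan (r 6) l) ∪ fan (l 0) r ∪ {{l 0, r 0, w}})
      ((U ∪ fan (r 6) l) ∪ fan w r ∪ {{l 0, r 6, w}}) := by
    refine fan_flipPath hr (fun i => hlr 0 i) hwr (hwl 0).symm ?_ fun k => hw.crossing hc 0 k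
    rintro t (ht | ⟨i, rfl⟩)
    · obtain ⟨n, hn, h1, h2, h3⟩ := hU t ht
      exact ⟨n, hn, h2 0, h1, h3⟩
    · exact ⟨l i.succ, by simp, fun e => (Fin.succ_ne_zero i) (hl e), (hwl _).symm,
        fun j => hlr _ j⟩
  -- The first fan ends with the triangle `l 0`, `r 6`, `w`, which is the starting triangle for the
  -- second fan, with apex `r 6` over the left chain.
  have p2 : FlipPath pt 6 ((U ∪ fan w r) ∪ fan (r 6) l ∪ {{r 6, l 0, w}})
      ((U ∪ fan w r) ∪ fan w l ∪ {{r 6, l 6, w}}) := by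
    refine fan_flipPath hl (fun i => (hlr i 6).symm) hwl (hwr 6).symm ?_
      fun k => hw.swap.crossing hc.swap 6 k
    rintro t (ht | ⟨i, rfl⟩)
    · obtain ⟨n, hn, h1, h2, h3⟩ := hU t ht
      exact ⟨n, hn, h3 6, h1, h2⟩
    · exact ⟨r i.castSucc, by simp, fun e => i.castSucc_lt_last.ne (hr e), (hwr _).symm,
        fun j => (hlr j _).symm⟩
  rw [triple_perm_left (l 0) (r 6) w, triple_perm_left (l 6) (r 6) w] at p2
  have e1 : U ∪ (fan (l 0) r ∪ fan (r 6) l) ∪ {{l 0, r 0, w}} =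
      (U ∪ fan (r 6) l) ∪ fan (l 0) r ∪ {{l 0, r 0, w}} := by
    rw [Set.union_comm (fan (l 0) r), ← Set.union_assoc U]
  have e2 : (U ∪ fan (r 6) l) ∪ fan w r ∪ {{l 0, r 6, w}} =
      (U ∪ fan w r) ∪ fan (r 6) l ∪ {{l 0, r 6, w}} := by
    rw [Set.union_right_comm U]
  have e3 : U ∪ (fan w r ∪ fan w l) ∪ {{l 6, r 6, w}} =
      (U ∪ fan w r) ∪ fan w l ∪ {{l 6, r 6, w}} := by
    rw [← Set.union_assoc U]
  rw [e1, e3]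
  rw [e2] at p1
  exact p1.trans p2

/-- Two flips that make `w` the cap of a channel with end edge `ab`. -/
theorem cap_flipPath {a b p q w : N} (hd : [a, b, p, q, w].Nodup) {U : Set (Set N)}
    (hU : ∀ t ∈ U, ∃ n ∈ t, n ∉ [a, b, p, q, w])
    (h1 : (openSegment ℝ (pt p) (pt q) ∩ openSegment ℝ (pt a) (pt w)).Nonempty)
    (h2 : (openSegment ℝ (pt p) (pt a) ∩ openSegment ℝ (pt b) (pt w)).Nonempty) :
    FlipPath pt 2 (U ∪ {{a, b, p}, {a, p, q}, {p, q, w}})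
      (U ∪ {{b, p, w}, {a, q, w}} ∪ {{b, a, w}}) := by
  have nU : ∀ t : Set N, t ⊆ {x | x ∈ [a, b, p, q, w]} → t ∉ U := by
    intro t ht htU
    obtain ⟨n, hn, hn'⟩ := hU t htU
    exact hn' (ht hn)
  have nb : ∀ {s : Set N} (x : N) {u v z : N}, x ∈ s → x ≠ u → x ≠ v → x ≠ z →
      s ≠ {u, v, z} := by
    rintro s x u v z hx h1 h2 h3 rfl
    rcases hx with e | e | e <;> contradiction
  simp only [List.nodup_cons, List.mem_cons, List.not_mem_nil, or_false, not_or, not_false_eq_true,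
    List.nodup_nil, and_true] at hd
  obtain ⟨⟨hab, hap, haq, haw⟩, ⟨hbp, hbq, hbw⟩, ⟨hpq, hpw⟩, hqw⟩ := hd
  -- The diagonal `pq` is replaced by `aw`.
  have s1 : FlipStep pt (U ∪ {{a, b, p}, {a, p, q}, {p, q, w}})
      (U ∪ {{a, b, p}, {a, p, w}, {a, q, w}}) := by
    refine ⟨U ∪ {{a, b, p}}, p, q, a, w, ?_, ?_, ?_, ?_, ?_, ?_, h1⟩
    · rintro (h | h)
      · refine nU _ ?_ h
        rintro x (rfl | rfl | rfl) <;> simp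
      · exact nb q (by simp) (Ne.symm haq) (Ne.symm hbq) (Ne.symm hpq) h
    · rintro (h | h)
      · refine nU _ ?_ h
        rintro x (rfl | rfl | rfl) <;> simp
      · exact nb q (by simp) (Ne.symm haq) (Ne.symm hbq) (Ne.symm hpq) h
    · rintro (h | h)
      · refine nU _ ?_ h
        rintro x (rfl | rfl | rfl) <;> simp
      · exact nb w (by simp) (Ne.symm haw) (Ne.symm hbw) (Ne.symm hpw) h
    · rintro (h | h)
      · refine nU _ ?_ h
        rintro x (rfl | rfl | rfl) <;> simp
      · exact nb q (by simp) (Ne.symm haq) (Ne.symm hbq) (Ne.symm hpq) h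
    · rw [triple_rotate a p q, Set.union_assoc]
      rfl
    · rw [triple_perm_left a p w, triple_perm_left a q w, Set.union_assoc]
      rfl
  -- The diagonal `pa` is replaced by `bw`.
  have s2 : FlipStep pt (U ∪ {{a, b, p}, {a, p, w}, {a, q, w}})
      (U ∪ {{b, p, w}, {a, q, w}} ∪ {{b, a, w}}) := by
    refine ⟨U ∪ {{a, q, w}}, p, a, b, w, ?_, ?_, ?_, ?_, ?_, ?_, h2⟩
    · rintro (h | h)
      · refine nU _ ?_ h
        rintro x (rfl | rfl | rfl) <;> simp
      · exact nb p (by simp) (Ne.symm hap) hpq hpw h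
    · rintro (h | h)
      · refine nU _ ?_ h
        rintro x (rfl | rfl | rfl) <;> simp
      · exact nb p (by simp) (Ne.symm hap) hpq hpw h
    · rintro (h | h)
      · refine nU _ ?_ h
        rintro x (rfl | rfl | rfl) <;> simp
      · exact nb p (by simp) (Ne.symm hap) hpq hpw h
    · rintro (h | h)
      · refine nU _ ?_ h
        rintro x (rfl | rfl | rfl) <;> simp
      · exact nb b (by simp) (Ne.symm hab) hbq hbw h
    · rw [triple_rotate p a b, triple_perm_left a p w]
      ext t; simp only [Set.mem_union, Set.mem_insert_iff, Set.mem_singleton_iff]; tauto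
    · rw [triple_perm_left b p w, triple_perm_left b a w]
      ext t; simp only [Set.mem_union, Set.mem_insert_iff, Set.mem_singleton_iff]; tauto
  exact (FlipPath.single s1).trans (FlipPath.single s2)

end Fan

/-! ### Combinatorics of the region -/

namespace Layout

open Node

variable {V : Type*} {G : SimpleGraph V}

theorem dart_symm_ne (d : G.Dart) : d.symm ≠ d := fun h => by
  have := congrArg (fun e : G.Dart => e.fst) h
  exact d.fst_ne_snd this.symm

theorem dart_symm_inj {d e : G.Dart} : d.symm = e.symm ↔ d = e :=
  SimpleGraph.Dart.symm_involutive.injective.eq_iff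

/-- The two chains of the channel of `d`, listed from `d.fst` to `d.snd`: the left hand chain for
`m = false` and the right hand chain for `m = true`. -/
def sideChain (d : G.Dart) : Bool → Fin 7 → Node G
  | false => chain d
  | true => fun i => chain d.symm i.rev

/-- The orientation that goes with `sideChain`. -/
def sideSign : Bool → ℝ
  | false => 1
  | true => -1

theorem sideChain_injective (d : G.Dart) (m : Bool) : Function.Injective (sideChain d m) := by
  intro i j h
  cases m
  · exact (Node.chain.inj h).2
  · exact Fin.rev_injective (Node.chain.inj h).2

theorem sideChain_ne (d : G.Dart) (m : Bool) (i j : Fin 7) :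
    sideChain d m i ≠ sideChain d (!m) j := by
  intro h
  cases m
  · exact dart_symm_ne d (Node.chain.inj h).1.symm
  · exact dart_symm_ne d (Node.chain.inj h).1

theorem sideChain_symm (d : G.Dart) (m : Bool) (i : Fin 7) :
    sideChain d.symm m i = sideChain d (!m) i.rev := by
  cases m <;> simp [sideChain]

/-- The vertices of the channel of `d`. -/
def channelNodes (d : G.Dart) : Set (Node G) := {n | ∃ m i, n = sideChain d m i}

theorem mem_channelNodes_iff {d : G.Dart} {n : Node G} :
    n ∈ channelNodes d ↔ ∃ e i, n = chain e i ∧ e.edge = d.edge := by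
  simp only [SimpleGraph.dart_edge_eq_iff]
  constructor
  · rintro ⟨m, i, rfl⟩
    cases m
    · exact ⟨d, i, rfl, Or.inl rfl⟩
    · exact ⟨d.symm, i.rev, rfl, Or.inr rfl⟩
  · rintro ⟨e, i, rfl, rfl | rfl⟩
    · exact ⟨false, i, rfl⟩
    · exact ⟨true, i.rev, by simp [sideChain]⟩

/-- The vertices of the gadget of `v`. -/
def gadgetNodes (v : V) : Set (Node G) :=
  {n | n = C v ∨ n = D v ∨ n = E v ∨ n = F v ∨ ∃ d : G.Dart, d.fst = v ∧
    (n = leftEnd d ∨ n = rightEnd d)}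

/-- An end vertex determines its gadget: it has index 0 in the chain of the outgoing dart, or index
6 in the chain of the reversed dart. -/
theorem gadgetNodes_disjoint {v w : V} {n : Node G} (hv : n ∈ gadgetNodes v)
    (hw : n ∈ gadgetNodes w) : v = w := by
  rcases hv with rfl | rfl | rfl | rfl | ⟨d, rfl, rfl | rfl⟩ <;>
    rcases hw with h | h | h | h | ⟨e, rfl, h | h⟩ <;>
    simp only [leftEnd, rightEnd, reduceCtorEq, C.injEq, D.injEq, E.injEq, F.injEq,
      chain.injEq, dart_symm_inj] at h
  all_goals first | exact h | exact h.1 ▸ rfl | exact absurd h.2 (by decide)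

/-- Common faces of channel and gadget triangles are thereby confined to end edges, which is how
exits of lines of sight are located. -/
theorem mem_ends_of_mem {v : V} {d : G.Dart} {n : Node G} (hv : n ∈ gadgetNodes v)
    (hd : n ∈ channelNodes d) :
    (d.fst = v ∧ (n = leftEnd d ∨ n = rightEnd d)) ∨
      (d.snd = v ∧ (n = leftEnd d.symm ∨ n = rightEnd d.symm)) := by
  obtain ⟨e', i, rfl, he⟩ := mem_channelNodes_iff.1 hd
  rcases hv with h | h | h | h | ⟨e, rfl, h⟩
  · simp at h
  · simp at h
  · simp at h
  · simp at h
  have he2 : e.edge = d.edge := by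
    rw [← he]
    rcases h with h | h
    · rw [(Node.chain.inj h).1]
    · rw [(Node.chain.inj h).1, SimpleGraph.Dart.edge_symm]
  rcases (SimpleGraph.dart_edge_eq_iff _ _).1 he2 with rfl | rfl
  · exact Or.inl ⟨rfl, h⟩
  · exact Or.inr ⟨rfl, h⟩

/-- The triangles of a gadget that are not adjacent to the lock. -/
def gadgetOuter (v : V) : Ports G → Set (Set (Node G))
  | .two d₁ d₂ => {{rightEnd d₁, leftEnd d₁, C v}, {C v, rightEnd d₁, F v},
      {C v, D v, leftEnd d₂}, {rightEnd d₂, leftEnd d₂, C v}}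
  | .three d₁ d₂ d₃ => {{rightEnd d₁, leftEnd d₁, F v}, {F v, rightEnd d₁, E v},
      {rightEnd d₂, leftEnd d₂, C v}, {C v, rightEnd d₂, F v},
      {rightEnd d₃, leftEnd d₃, E v}, {E v, rightEnd d₃, D v}}

/-- The quadrilateral `CDEF` of a gadget, locked. -/
def lockedQuad (v : V) : Set (Set (Node G)) := {{C v, E v, F v}, {C v, E v, D v}}

/-- The quadrilateral `CDEF` of a gadget, unlocked. -/
def unlockedQuad (v : V) : Set (Set (Node G)) := {{C v, F v, D v}, {E v, F v, D v}}

theorem gadget_eq (v : V) (p : Ports G) : gadget v p = gadgetOuter v p ∪ lockedQuad v := by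
  cases p <;> simp only [gadget, gadgetOuter, lockedQuad, Set.pair_comm (F v) (E v),
    Set.pair_comm (D v) (E v)] <;> ext t <;>
    simp only [Set.mem_union, Set.mem_insert_iff, Set.mem_singleton_iff] <;>
    exact Iff.of_eq (by ac_rfl)

/-! ### Ports: how a channel is attached to its gadget. -/

/-- `d` is a channel of a gadget, with end edge `AB` (in the gadget's labelling, `A` being the end
of the left hand chain iff `m`), and the gadget has triangles `ABP`, `APQ` and, when unlocked,
`PQW`, where `W` is the vertex in the narrow mouth. -/
inductive IsPort (X : Layout G) : G.Dart → Bool → Node G → Node G → Node G → Prop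
  | two_fst {v d₁ d₂} (h : X.ports v = .two d₁ d₂) : IsPort X d₁ false (C v) (F v) (D v)
  | two_snd {v d₁ d₂} (h : X.ports v = .two d₁ d₂) : IsPort X d₂ true (C v) (D v) (F v)
  | three_fst {v d₁ d₂ d₃} (h : X.ports v = .three d₁ d₂ d₃) :
      IsPort X d₁ false (F v) (E v) (D v)
  | three_snd {v d₁ d₂ d₃} (h : X.ports v = .three d₁ d₂ d₃) :
      IsPort X d₂ false (C v) (F v) (D v)
  | three_trd {v d₁ d₂ d₃} (h : X.ports v = .three d₁ d₂ d₃) :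
      IsPort X d₃ false (E v) (D v) (F v)

variable {X : Layout G}

namespace IsConstruction

/-- The placement conditions treat `d` and `d.symm` alike, each chain being listed from its own
source. Listing the second chain backwards reverses its signs; exchanging the chains is the
reflection `Chan.swap`. -/
theorem chan (hX : X.IsConstruction) (d : G.Dart) (m : Bool) :
    Chan (sideSign m) (X.pt ∘ sideChain d m) (X.pt ∘ sideChain d !m) := by
  have h : Chan 1 (X.pt ∘ sideChain d false) (X.pt ∘ sideChain d true) := by
    have h1 := hX.channel d
    have h2 := hX.channel d.symm
    refine ⟨fun i j k hij hjk => ?_, fun i j k hij hjk => ?_, fun i j k hij => ?_,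
      fun i j k hij => ?_⟩
    · simpa [sideChain] using h1.reflex i j k hij hjk
    · have := h2.reflex _ _ _ (Fin.rev_lt_rev.2 hjk) (Fin.rev_lt_rev.2 hij)
      simp only [sideChain, Function.comp]
      unfold orient at *
      linarith
    · simpa [sideChain] using h1.visible i j k.rev hij
    · have := h2.visible _ _ k (Fin.rev_lt_rev.2 hij)
      rw [orient_swap, SimpleGraph.Dart.symm_symm] at this
      simp only [sideChain, Function.comp]
      linarith
  cases m
  · exact h
  · exact h.swap

theorem exists_isPort (hX : X.IsConstruction) (d : G.Dart) : ∃ m P Q W, X.IsPort d m P Q W := by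
  have h := hX.gadget_placed d.fst
  cases hp : X.ports d.fst with
  | two d₁ d₂ =>
    rw [hp] at h
    rcases (h.1.2 d).1 rfl with e | e
    · subst e; exact ⟨_, _, _, _, .two_fst hp⟩
    · subst e; exact ⟨_, _, _, _, .two_snd hp⟩
  | three d₁ d₂ d₃ =>
    rw [hp] at h
    rcases (h.1.2.2.2 d).1 rfl with e | e | e
    · subst e; exact ⟨_, _, _, _, .three_fst hp⟩
    · subst e; exact ⟨_, _, _, _, .three_snd hp⟩
    · subst e; exact ⟨_, _, _, _, .three_trd hp⟩

theorem fst_two (hX : X.IsConstruction) {v : V} {d₁ d₂ : G.Dart} (h : X.ports v = .two d₁ d₂) :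
    d₁.fst = v ∧ d₂.fst = v ∧ d₁ ≠ d₂ := by
  have hg := hX.gadget_placed v
  rw [h] at hg
  exact ⟨(hg.1.2 _).2 (Or.inl rfl), (hg.1.2 _).2 (Or.inr rfl), hg.1.1⟩

theorem fst_three (hX : X.IsConstruction) {v : V} {d₁ d₂ d₃ : G.Dart}
    (h : X.ports v = .three d₁ d₂ d₃) :
    d₁.fst = v ∧ d₂.fst = v ∧ d₃.fst = v ∧ d₁ ≠ d₂ ∧ d₂ ≠ d₃ ∧ d₃ ≠ d₁ := by
  have hg := hX.gadget_placed v
  rw [h] at hg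
  exact ⟨(hg.1.2.2.2 _).2 (Or.inl rfl), (hg.1.2.2.2 _).2 (Or.inr (Or.inl rfl)),
    (hg.1.2.2.2 _).2 (Or.inr (Or.inr rfl)), hg.1.1, hg.1.2.1, hg.1.2.2.1⟩

theorem gadget_subset_gadgetNodes (hX : X.IsConstruction) {v : V} {t : Set (Node G)}
    (ht : t ∈ gadgetOuter v (X.ports v) ∪ (lockedQuad v ∪ unlockedQuad v)) :
    t ⊆ gadgetNodes v := by
  have hC : (C v : Node G) ∈ gadgetNodes v := Or.inl rfl
  have hD : (D v : Node G) ∈ gadgetNodes v := Or.inr (Or.inl rfl)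
  have hE : (E v : Node G) ∈ gadgetNodes v := Or.inr (Or.inr (Or.inl rfl))
  have hF : (F v : Node G) ∈ gadgetNodes v := Or.inr (Or.inr (Or.inr (Or.inl rfl)))
  have hl : ∀ d : G.Dart, d.fst = v → leftEnd d ∈ gadgetNodes v := fun d hd =>
    Or.inr (Or.inr (Or.inr (Or.inr ⟨d, hd, Or.inl rfl⟩)))
  have hr : ∀ d : G.Dart, d.fst = v → rightEnd d ∈ gadgetNodes v := fun d hd =>
    Or.inr (Or.inr (Or.inr (Or.inr ⟨d, hd, Or.inr rfl⟩)))
  rcases ht with ht | ht | ht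
  · cases hp : X.ports v with
    | two d₁ d₂ =>
      obtain ⟨h1, h2, -⟩ := hX.fst_two hp
      rw [hp] at ht
      rcases ht with rfl | rfl | rfl | rfl <;> rintro n (rfl | rfl | rfl) <;>
        first | assumption | exact hl _ ‹_› | exact hr _ ‹_›
    | three d₁ d₂ d₃ =>
      obtain ⟨h1, h2, h3, -⟩ := hX.fst_three hp
      rw [hp] at ht
      rcases ht with rfl | rfl | rfl | rfl | rfl | rfl <;> rintro n (rfl | rfl | rfl) <;>
        first | assumption | exact hl _ ‹_› | exact hr _ ‹_›
  · rcases ht with rfl | rfl <;> rintro n (rfl | rfl | rfl) <;> assumption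
  · rcases ht with rfl | rfl <;> rintro n (rfl | rfl | rfl) <;> assumption

end IsConstruction

/-- One of the four inner vertices of the gadget of `v`. -/
def IsInner (v : V) (n : Node G) : Prop := n = C v ∨ n = D v ∨ n = E v ∨ n = F v

theorem IsInner.ne_chain {v : V} {n : Node G} (h : IsInner v n) (d : G.Dart) (i : Fin 7) :
    n ≠ chain d i := by
  rcases h with rfl | rfl | rfl | rfl <;> simp

theorem IsInner.ne_sideChain {v : V} {n : Node G} (h : IsInner v n) (d : G.Dart) (m : Bool)
    (i : Fin 7) : n ≠ sideChain d m i := by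
  cases m
  · exact h.ne_chain d i
  · exact h.ne_chain _ _

theorem IsInner.eq_of_eq {v w : V} {n : Node G} (h : IsInner v n) (h' : IsInner w n) : v = w := by
  rcases h with rfl | rfl | rfl | rfl <;> rcases h' with h | h | h | h <;> simp_all

theorem IsInner.mem_gadgetNodes {v : V} {n : Node G} (h : IsInner v n) : n ∈ gadgetNodes v := by
  rcases h with h | h | h | h <;> simp [gadgetNodes, h]

theorem exists_inner_mem {v : V} {t : Set (Node G)}
    (ht : t ∈ gadgetOuter v (X.ports v) ∪ (lockedQuad v ∪ unlockedQuad v)) :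
    ∃ n ∈ t, IsInner v n := by
  rcases ht with ht | ht | ht
  · cases hp : X.ports v with
    | two d₁ d₂ =>
      rw [hp] at ht
      rcases ht with rfl | rfl | rfl | rfl <;> exact ⟨C v, by simp, Or.inl rfl⟩
    | three d₁ d₂ d₃ =>
      rw [hp] at ht
      rcases ht with rfl | rfl | rfl | rfl | rfl | rfl <;>
        first
        | exact ⟨C v, Or.inl rfl, Or.inl rfl⟩
        | exact ⟨C v, Or.inr (Or.inr rfl), Or.inl rfl⟩
        | exact ⟨E v, Or.inl rfl, Or.inr (Or.inr (Or.inl rfl))⟩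
        | exact ⟨E v, Or.inr (Or.inr rfl), Or.inr (Or.inr (Or.inl rfl))⟩
        | exact ⟨F v, Or.inr (Or.inr rfl), Or.inr (Or.inr (Or.inr rfl))⟩
  · rcases ht with rfl | rfl <;> exact ⟨C v, by simp, Or.inl rfl⟩
  · rcases ht with rfl | rfl <;> exact ⟨F v, by simp, Or.inr (Or.inr (Or.inr rfl))⟩

namespace IsPort

variable {d : G.Dart} {m : Bool} {P Q W : Node G}

theorem inner (hX : X.IsConstruction) (h : X.IsPort d m P Q W) :
    IsInner d.fst P ∧ IsInner d.fst Q ∧ IsInner d.fst W ∧ P ≠ Q ∧ P ≠ W ∧ Q ≠ W := by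
  cases h with
  | two_fst h => obtain ⟨rfl, -⟩ := hX.fst_two h; simp [IsInner]
  | two_snd h => obtain ⟨-, rfl, -⟩ := hX.fst_two h; simp [IsInner]
  | three_fst h => obtain ⟨rfl, -⟩ := hX.fst_three h; simp [IsInner]
  | three_snd h => obtain ⟨-, rfl, -⟩ := hX.fst_three h; simp [IsInner]
  | three_trd h => obtain ⟨-, -, rfl, -⟩ := hX.fst_three h; simp [IsInner]

/-- The triangles at the port. -/
theorem triangles (hX : X.IsConstruction) (h : X.IsPort d m P Q W) :
    {sideChain d (!m) 0, sideChain d m 0, P} ∈ gadgetOuter d.fst (X.ports d.fst) ∧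
      {sideChain d (!m) 0, P, Q} ∈ gadgetOuter d.fst (X.ports d.fst) ∧
      {P, Q, W} ∈ unlockedQuad d.fst := by
  have e6 : (Fin.rev 0 : Fin 7) = 6 := rfl
  cases h with
  | two_fst h =>
    obtain ⟨rfl, -⟩ := hX.fst_two h
    rw [h]
    simp only [sideChain, Bool.not_false, e6]
    exact ⟨by simp [gadgetOuter, leftEnd, rightEnd],
      by rw [triple_perm_left]; simp [gadgetOuter, rightEnd], by simp [unlockedQuad]⟩
  | two_snd h =>
    obtain ⟨-, rfl, -⟩ := hX.fst_two h
    rw [h]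
    simp only [sideChain, Bool.not_true, e6]
    exact ⟨by rw [triple_perm_left]; simp [gadgetOuter, leftEnd, rightEnd],
      by rw [← triple_rotate]; simp [gadgetOuter, leftEnd], by
        rw [triple_perm_right]; simp [unlockedQuad]⟩
  | three_fst h =>
    obtain ⟨rfl, -⟩ := hX.fst_three h
    rw [h]
    simp only [sideChain, Bool.not_false, e6]
    exact ⟨by simp [gadgetOuter, leftEnd, rightEnd],
      by rw [triple_perm_left]; simp [gadgetOuter, rightEnd],
      by rw [triple_perm_left]; simp [unlockedQuad]⟩
  | three_snd h =>
    obtain ⟨-, rfl, -⟩ := hX.fst_three h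
    rw [h]
    simp only [sideChain, Bool.not_false, e6]
    exact ⟨by simp [gadgetOuter, leftEnd, rightEnd],
      by rw [triple_perm_left]; simp [gadgetOuter, rightEnd], by simp [unlockedQuad]⟩
  | three_trd h =>
    obtain ⟨-, -, rfl, -⟩ := hX.fst_three h
    rw [h]
    simp only [sideChain, Bool.not_false, e6]
    exact ⟨by simp [gadgetOuter, leftEnd, rightEnd],
      by rw [triple_perm_left]; simp [gadgetOuter, rightEnd],
      by rw [triple_perm_right]; simp [unlockedQuad]⟩

/-- These are the inputs of `cap_crossings`, uniform over the five kinds of ports: `P` is outside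
the wide mouth on the side of `B`, `Q` on the side of `A`, and `W` in the narrow mouth is a cap. The
second port of a degree-2 gadget is mirrored. -/
theorem geometry (hX : X.IsConstruction) (h : X.IsPort d m P Q W) :
    0 < sideSign m * orient (X.pt (sideChain d m 0)) (X.pt (sideChain d m 1)) (X.pt P) ∧
      sideSign m * orient (X.pt (sideChain d (!m) 0)) (X.pt (sideChain d (!m) 1)) (X.pt Q) < 0 ∧
      IsCap (sideSign m) (X.pt ∘ sideChain d m) (X.pt ∘ sideChain d !m) (X.pt W) := by
  have hN : ∀ {d : G.Dart} {p : Node G} (m : Bool), X.InNarrow d p →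
      IsCap (sideSign m) (X.pt ∘ sideChain d m) (X.pt ∘ sideChain d !m) (X.pt p) := by
    intro d p m h
    have : IsCap 1 (X.pt ∘ sideChain d false) (X.pt ∘ sideChain d true) (X.pt p) := by
      have e0 : (Fin.rev 0 : Fin 7) = 6 := rfl
      have e5 : (Fin.rev 5 : Fin 7) = 1 := rfl
      have e6 : (Fin.rev 6 : Fin 7) = 0 := rfl
      refine (hX.chan d false).isCap ?_ ?_ ?_
      · simpa [sideSign, sideChain, leftEnd, rightEnd, e0] using h.2.2
      · simpa [sideSign, sideChain] using h.1
      · simpa [sideSign, sideChain, e5, e6] using h.2.1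
    cases m
    · exact this
    · exact this.swap
  have hL : ∀ {d : G.Dart} {p : Node G}, X.LeftOfWide d p →
      0 < sideSign false * orient (X.pt (sideChain d false 0)) (X.pt (sideChain d false 1))
        (X.pt p) := by
    intro d p h
    simpa [sideSign, sideChain, LeftOfWide] using h
  have hR : ∀ {d : G.Dart} {p : Node G}, X.RightOfWide d p →
      sideSign false * orient (X.pt (sideChain d true 0)) (X.pt (sideChain d true 1))
        (X.pt p) < 0 := by
    intro d p h
    have e0 : (Fin.rev 0 : Fin 7) = 6 := rfl
    have e1 : (Fin.rev 1 : Fin 7) = 5 := rfl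
    simpa [sideSign, sideChain, RightOfWide, e0, e1] using h
  cases h with
  | @two_fst v d₁ d₂ h =>
    have hg := hX.gadget_placed v
    rw [h] at hg
    obtain ⟨-, -, -, hC, hD, hE, hF⟩ := hg
    exact ⟨hL hC.1, hR hF.2, hN _ hD.1⟩
  | @two_snd v d₁ d₂ h =>
    have hg := hX.gadget_placed v
    rw [h] at hg
    obtain ⟨-, -, -, hC, hD, hE, hF⟩ := hg
    refine ⟨?_, ?_, hN _ hF.1⟩
    · have := hR hC.2
      simp only [sideSign] at *
      linarith
    · have := hL hD.2
      simp only [sideSign, Bool.not_true] at *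
      linarith
  | @three_fst v d₁ d₂ d₃ h =>
    have hg := hX.gadget_placed v
    rw [h] at hg
    obtain ⟨-, -, -, hC, hD, hE, hF⟩ := hg
    exact ⟨hL hF.1, hR hE.1, hN _ hD.1⟩
  | @three_snd v d₁ d₂ d₃ h =>
    have hg := hX.gadget_placed v
    rw [h] at hg
    obtain ⟨-, -, -, hC, hD, hE, hF⟩ := hg
    exact ⟨hL hC.2.1, hR hF.2.1, hN _ hD.2.1⟩
  | @three_trd v d₁ d₂ d₃ h =>
    have hg := hX.gadget_placed v
    rw [h] at hg
    obtain ⟨-, -, -, hC, hD, hE, hF⟩ := hg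
    exact ⟨hL hE.2.2, hR hD.2.2, hN _ hF.2.2⟩

/-- The other triangles of the unlocked gadget are not contained in the union of the channel and
the triangles at the port. -/
theorem exists_mem_of_ne (hX : X.IsConstruction) (h : X.IsPort d m P Q W) {t : Set (Node G)}
    (ht : t ∈ gadgetOuter d.fst (X.ports d.fst) ∪ unlockedQuad d.fst)
    (h1 : t ≠ {sideChain d (!m) 0, sideChain d m 0, P}) (h2 : t ≠ {sideChain d (!m) 0, P, Q})
    (h3 : t ≠ {P, Q, W}) :
    ∃ n ∈ t, n ≠ P ∧ n ≠ Q ∧ n ≠ W ∧ ∀ m i, n ≠ sideChain d m i := by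
  have e6 : (Fin.rev 0 : Fin 7) = 6 := rfl
  have hi : ∀ {v : V} {n : Node G}, IsInner v n → ∀ m i, n ≠ sideChain d m i :=
    fun h m i => h.ne_sideChain d m i
  have hl : ∀ {e d : G.Dart}, e.fst = d.fst → e ≠ d → ∀ m i, leftEnd e ≠ sideChain d m i := by
    intro e d hf he m i
    cases m
    · exact fun h => he (Node.chain.inj h).1
    · intro h
      have := (Node.chain.inj h).1
      rw [this] at hf
      exact d.fst_ne_snd hf.symm
  have hr : ∀ {e d : G.Dart}, e.fst = d.fst → e ≠ d → ∀ m i, rightEnd e ≠ sideChain d m i := by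
    intro e d hf he m i
    cases m
    · intro h
      have h' := (Node.chain.inj h).1
      rw [← h'] at hf
      exact e.fst_ne_snd hf
    · exact fun h => he (dart_symm_inj.1 (Node.chain.inj h).1)
  have hEi : ∀ v : V, IsInner v (E v : Node G) := fun v => Or.inr (Or.inr (Or.inl rfl))
  have hCi : ∀ v : V, IsInner v (C v : Node G) := fun v => Or.inl rfl
  have hDi : ∀ v : V, IsInner v (D v : Node G) := fun v => Or.inr (Or.inl rfl)
  cases h with
  | two_fst h =>
    obtain ⟨rfl, hf2, hne⟩ := hX.fst_two h
    rw [h] at ht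
    simp only [sideChain, Bool.not_false, e6] at h1 h2
    rcases ht with (rfl | rfl | rfl | rfl) | rfl | rfl
    · exact absurd rfl h1
    · exact absurd (triple_perm_left _ _ _) h2
    · exact ⟨leftEnd _, by simp, by simp [leftEnd], by simp [leftEnd], by simp [leftEnd],
        hl hf2 hne.symm⟩
    · exact ⟨leftEnd _, by simp, by simp [leftEnd], by simp [leftEnd], by simp [leftEnd],
        hl hf2 hne.symm⟩
    · exact absurd rfl h3
    · exact ⟨E d.fst, by simp, by simp, by simp, by simp, hi (hEi _)⟩
  | two_snd h =>
    obtain ⟨hf1, rfl, hne⟩ := hX.fst_two h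
    rw [h] at ht
    simp only [sideChain, Bool.not_true, e6] at h1 h2
    rcases ht with (rfl | rfl | rfl | rfl) | rfl | rfl
    · exact ⟨leftEnd _, by simp, by simp [leftEnd], by simp [leftEnd], by simp [leftEnd],
        hl hf1 hne⟩
    · exact ⟨rightEnd _, by simp, by simp [rightEnd], by simp [rightEnd], by simp [rightEnd],
        hr hf1 hne⟩
    · exact absurd (triple_rotate _ _ _) h2
    · exact absurd (triple_perm_left _ _ _) h1
    · exact absurd (triple_perm_right _ _ _) h3
    · exact ⟨E d.fst, by simp, by simp, by simp, by simp, hi (hEi _)⟩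
  | three_fst h =>
    obtain ⟨rfl, hf2, hf3, hne1, hne2, hne3⟩ := hX.fst_three h
    rw [h] at ht
    simp only [sideChain, Bool.not_false, e6] at h1 h2
    rcases ht with (rfl | rfl | rfl | rfl | rfl | rfl) | rfl | rfl
    · exact absurd rfl h1
    · exact absurd (triple_perm_left _ _ _) h2
    · exact ⟨C d.fst, by simp, by simp, by simp, by simp, hi (hCi _)⟩
    · exact ⟨C d.fst, by simp, by simp, by simp, by simp, hi (hCi _)⟩
    · exact ⟨leftEnd _, by simp, by simp [leftEnd], by simp [leftEnd], by simp [leftEnd],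
        hl hf3 hne3⟩
    · exact ⟨rightEnd _, by simp, by simp [rightEnd], by simp [rightEnd], by simp [rightEnd],
        hr hf3 hne3⟩
    · exact ⟨C d.fst, by simp, by simp, by simp, by simp, hi (hCi _)⟩
    · exact absurd (triple_perm_left _ _ _) h3
  | three_snd h =>
    obtain ⟨hf1, rfl, hf3, hne1, hne2, hne3⟩ := hX.fst_three h
    rw [h] at ht
    simp only [sideChain, Bool.not_false, e6] at h1 h2
    rcases ht with (rfl | rfl | rfl | rfl | rfl | rfl) | rfl | rfl
    · exact ⟨leftEnd _, by simp, by simp [leftEnd], by simp [leftEnd], by simp [leftEnd],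
        hl hf1 hne1⟩
    · exact ⟨E d.fst, by simp, by simp, by simp, by simp, hi (hEi _)⟩
    · exact absurd rfl h1
    · exact absurd (triple_perm_left _ _ _) h2
    · exact ⟨E d.fst, by simp, by simp, by simp, by simp, hi (hEi _)⟩
    · exact ⟨E d.fst, by simp, by simp, by simp, by simp, hi (hEi _)⟩
    · exact absurd rfl h3
    · exact ⟨E d.fst, by simp, by simp, by simp, by simp, hi (hEi _)⟩
  | three_trd h =>
    obtain ⟨hf1, hf2, rfl, hne1, hne2, hne3⟩ := hX.fst_three h
    rw [h] at ht
    simp only [sideChain, Bool.not_false, e6] at h1 h2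
    rcases ht with (rfl | rfl | rfl | rfl | rfl | rfl) | rfl | rfl
    · exact ⟨leftEnd _, by simp, by simp [leftEnd], by simp [leftEnd], by simp [leftEnd],
        hl hf1 hne3.symm⟩
    · exact ⟨rightEnd _, by simp, by simp [rightEnd], by simp [rightEnd], by simp [rightEnd],
        hr hf1 hne3.symm⟩
    · exact ⟨C d.fst, by simp, by simp, by simp, by simp, hi (hCi _)⟩
    · exact ⟨C d.fst, by simp, by simp, by simp, by simp, hi (hCi _)⟩
    · exact absurd rfl h1
    · exact absurd (triple_perm_left _ _ _) h2
    · exact ⟨C d.fst, by simp, by simp, by simp, by simp, hi (hCi _)⟩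
    · exact absurd (triple_perm_right _ _ _) h3

end IsPort

end Layout

/-! ### The upper bound -/

namespace Layout

open Node

variable {V : Type*} {G : SimpleGraph V}

/-- The triangulation of a channel with apex at the near end of `sideChain d m` and at the far end
of the other chain: left-inclined for `m = false`, right-inclined for `m = true`. -/
def inclined (d : G.Dart) (m : Bool) : Set (Set (Node G)) :=
  fan (sideChain d m 0) (sideChain d !m) ∪ fan (sideChain d (!m) 6) (sideChain d m)

theorem fan_chain_rev (o : Node G) (d : G.Dart) :
    fan o (sideChain d true) = {t | ∃ i : Fin 6, t = {o, chain d.symm i.castSucc,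
      chain d.symm i.succ}} := by
  ext t
  constructor
  · rintro ⟨i, rfl⟩
    refine ⟨i.rev, ?_⟩
    rw [← Fin.rev_succ, ← Fin.rev_castSucc, triple_perm_right]
    rfl
  · rintro ⟨i, rfl⟩
    refine ⟨i.rev, ?_⟩
    simp only [sideChain]
    rw [Fin.rev_castSucc, Fin.rev_succ, Fin.rev_rev, triple_perm_right]

theorem leftInclined_union (d : G.Dart) :
    leftInclined d ∪ leftInclined d.symm = inclined d false := by
  simp only [inclined, Bool.not_false, fan_chain_rev]
  congr 1

theorem rightInclined_union (d : G.Dart) :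
    rightInclined d ∪ rightInclined d.symm = inclined d true := by
  simp only [inclined, Bool.not_true, fan_chain_rev]
  rw [Set.union_comm]
  congr 1

theorem exists_mem_inclined {d : G.Dart} {m : Bool} {t : Set (Node G)} (ht : t ∈ inclined d m) :
    ∃ m' i, 0 < i ∧ sideChain d m' i ∈ t := by
  rcases ht with ⟨i, rfl⟩ | ⟨i, rfl⟩
  · exact ⟨_, i.succ, Fin.succ_pos i, Or.inr (Or.inr rfl)⟩
  · exact ⟨_, i.succ, Fin.succ_pos i, Or.inr (Or.inr rfl)⟩

theorem subset_channelNodes_of_leftInclined {d : G.Dart} {t : Set (Node G)}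
    (ht : t ∈ leftInclined d) : t ⊆ channelNodes d := by
  obtain ⟨i, rfl⟩ := ht
  rintro n (rfl | rfl | rfl) <;> rw [mem_channelNodes_iff]
  · exact ⟨_, _, rfl, rfl⟩
  · exact ⟨_, _, rfl, d.edge_symm⟩
  · exact ⟨_, _, rfl, d.edge_symm⟩

variable (X : Layout G)

/-- The gadget triangles when the vertices in `U` are unlocked. -/
def gadgets (U : Set V) : Set (Set (Node G)) :=
  {t | (∃ v, t ∈ gadgetOuter v (X.ports v)) ∨ (∃ v, v ∉ U ∧ t ∈ lockedQuad v) ∨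
    ∃ v ∈ U, t ∈ unlockedQuad v}

/-- The channel triangles when the channels of the edges in `J` are right-inclined and the other
ones are left-inclined. -/
def channels (J : Set (Sym2 V)) : Set (Set (Node G)) :=
  {t | ∃ d : G.Dart, d.edge ∉ J ∧ t ∈ leftInclined d ∨ d.edge ∈ J ∧ t ∈ rightInclined d}

/-- The triangulation with the gadgets in `U` unlocked and the channels in `J` right-inclined. -/
def mixed (U : Set V) (J : Set (Sym2 V)) : Set (Set (Node G)) := X.gadgets U ∪ channels J

theorem iUnion_gadget : ⋃ v, gadget v (X.ports v) = X.gadgets ∅ := by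
  ext t
  simp only [Set.mem_iUnion, gadget_eq, gadgets, Set.mem_union, Set.mem_ofPred_eq,
    Set.mem_empty_iff_false, not_false_eq_true, true_and, false_and, exists_false, or_false,
    exists_or]

theorem T₁_eq : X.T₁ = X.mixed ∅ ∅ := by
  rw [T₁, iUnion_gadget, mixed]
  congr 1
  ext t
  simp [channels]

theorem T₂_eq : X.T₂ = X.mixed ∅ G.edgeSet := by
  rw [T₂, iUnion_gadget, mixed]
  congr 1
  ext t
  simp [channels, SimpleGraph.Dart.edge_mem]

variable {X}

theorem mem_gadgets {U : Set V} {t : Set (Node G)} (ht : t ∈ X.gadgets U) :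
    ∃ v, t ∈ gadgetOuter v (X.ports v) ∪ (lockedQuad v ∪ unlockedQuad v) := by
  rcases ht with ⟨v, hv⟩ | ⟨v, -, hv⟩ | ⟨v, -, hv⟩
  · exact ⟨v, Or.inl hv⟩
  · exact ⟨v, Or.inr (Or.inl hv)⟩
  · exact ⟨v, Or.inr (Or.inr hv)⟩

theorem exists_chain_mem_gadgetOuter {v : V} {t : Set (Node G)}
    (ht : t ∈ gadgetOuter v (X.ports v)) : ∃ d i, chain d i ∈ t := by
  cases hp : X.ports v <;> rw [hp] at ht
  · rcases ht with rfl | rfl | rfl | rfl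
    · exact ⟨_, _, Or.inl rfl⟩
    · exact ⟨_, _, Or.inr (Or.inl rfl)⟩
    · exact ⟨_, _, Or.inr (Or.inr rfl)⟩
    · exact ⟨_, _, Or.inl rfl⟩
  · rcases ht with rfl | rfl | rfl | rfl | rfl | rfl
    · exact ⟨_, _, Or.inl rfl⟩
    · exact ⟨_, _, Or.inr (Or.inl rfl)⟩
    · exact ⟨_, _, Or.inl rfl⟩
    · exact ⟨_, _, Or.inr (Or.inl rfl)⟩
    · exact ⟨_, _, Or.inl rfl⟩
    · exact ⟨_, _, Or.inr (Or.inl rfl)⟩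

theorem exists_chain_mem_channels {J : Set (Sym2 V)} {t : Set (Node G)} (ht : t ∈ channels J) :
    ∃ d i, chain d i ∈ t := by
  obtain ⟨d, ⟨-, i, rfl⟩ | ⟨-, i, rfl⟩⟩ := ht <;> exact ⟨_, _, Or.inl rfl⟩

/-! ### The flips of the upper bound. -/

namespace IsConstruction

theorem isTriangulation (hX : X.IsConstruction) :
    IsTriangulation X.pt X.region (X.mixed ∅ ∅) := by
  rw [← T₁_eq]; exact hX.no_overlap

/-- Unlocking the gadget of `v`. -/
theorem flipStep_unlock (hX : X.IsConstruction) {U : Set V} {v : V} (hv : v ∉ U)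
    (J : Set (Sym2 V)) : FlipStep X.pt (X.mixed U J) (X.mixed (insert v U) J) := by
  -- The part that the flip leaves unchanged. None of the four triangles involved belongs to it,
  -- since these have only inner vertices of the gadget of `v`.
  set W : Set (Set (Node G)) := {t | (∃ w, t ∈ gadgetOuter w (X.ports w)) ∨
    (∃ w, w ∉ insert v U ∧ t ∈ lockedQuad w) ∨ ∃ w ∈ U, t ∈ unlockedQuad w} ∪ channels J with hW
  have key : ∀ t : Set (Node G), (∀ n ∈ t, IsInner v n) → t ∉ W := by
    intro t ht hn
    rcases hn with (⟨w, h⟩ | ⟨w, hw, h⟩ | ⟨w, hw, h⟩) | h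
    · obtain ⟨d, i, hd⟩ := exists_chain_mem_gadgetOuter h
      exact (ht _ hd).ne_chain d i rfl
    · obtain ⟨n, hn, hi⟩ := exists_inner_mem (X := X) (Or.inr (Or.inl h))
      exact hw (Or.inl (hi.eq_of_eq (ht n hn)))
    · obtain ⟨n, hn, hi⟩ := exists_inner_mem (X := X) (Or.inr (Or.inr h))
      exact hv ((hi.eq_of_eq (ht n hn)) ▸ hw)
    · obtain ⟨d, i, hd⟩ := exists_chain_mem_channels h
      exact (ht _ hd).ne_chain d i rfl
  refine ⟨W, C v, E v, F v, D v, key _ ?_, key _ ?_, key _ ?_, key _ ?_, ?_, ?_, ?_⟩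
  · rintro n (rfl | rfl | rfl) <;> simp [IsInner]
  · rintro n (rfl | rfl | rfl) <;> simp [IsInner]
  · rintro n (rfl | rfl | rfl) <;> simp [IsInner]
  · rintro n (rfl | rfl | rfl) <;> simp [IsInner]
  · change _ = W ∪ lockedQuad v
    ext t
    simp only [mixed, gadgets, hW, Set.mem_union, Set.mem_ofPred_eq, Set.mem_insert_iff, not_or]
    constructor
    · rintro ((h | ⟨w, hw, h⟩ | h) | h)
      · exact Or.inl (Or.inl (Or.inl h))
      · by_cases hwv : w = v
        · exact Or.inr (hwv ▸ h)
        · exact Or.inl (Or.inl (Or.inr (Or.inl ⟨w, ⟨hwv, hw⟩, h⟩)))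
      · exact Or.inl (Or.inl (Or.inr (Or.inr h)))
      · exact Or.inl (Or.inr h)
    · rintro (((h | ⟨w, ⟨-, hw⟩, h⟩ | h) | h) | h)
      · exact Or.inl (Or.inl h)
      · exact Or.inl (Or.inr (Or.inl ⟨w, hw, h⟩))
      · exact Or.inl (Or.inr (Or.inr h))
      · exact Or.inr h
      · exact Or.inl (Or.inr (Or.inl ⟨v, hv, h⟩))
  · change _ = W ∪ unlockedQuad v
    ext t
    simp only [mixed, gadgets, hW, Set.mem_union, Set.mem_ofPred_eq, Set.mem_insert_iff,
      exists_eq_or_imp]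
    exact Iff.of_eq (by ac_rfl)
  · rw [openSegment_symm ℝ (X.pt (F v))]
    exact hX.convex_quad v

/-- The apex of the gadget triangle at an end edge is beyond that edge. -/
theorem port_beyond (hX : X.IsConstruction) {d : G.Dart} {m : Bool} {P Q W : Node G}
    (h : X.IsPort d m P Q W) :
    sideSign m * orient (X.pt (sideChain d m 0)) (X.pt (sideChain d (!m) 0)) (X.pt P) < 0 := by
  have hT := hX.isTriangulation
  have e6 : (Fin.rev 0 : Fin 7) = 6 := rfl
  -- The channel triangle of `T₁` at the end edge. Its apex is inside the channel, so the gadget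
  -- triangle at the same edge has its apex beyond.
  have h1 : {sideChain d false 0, sideChain d true 0, sideChain d true 1} ∈ X.mixed ∅ ∅ := by
    refine Or.inr ⟨d, Or.inl ⟨by simp, 5, ?_⟩⟩
    simp only [sideChain]
    rw [triple_perm_right]
    rfl
  have h2 : {sideChain d (!m) 0, sideChain d m 0, P} ∈ X.mixed ∅ ∅ :=
    Or.inl (Or.inl ⟨d.fst, (h.triangles hX).1⟩)
  have hne : sideChain d true 1 ≠ P := ((h.inner hX).1.ne_sideChain d true 1).symm
  have hg := (hX.chan d false).right_inside (i := 1) (by decide)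
  simp only [sideSign, one_mul, Function.comp, Bool.not_false] at hg
  cases m
  · rw [Bool.not_false, triple_perm_left] at h2
    have := hT.opposite_sides h1 h2 hne
    simp only [sideSign, one_mul, Bool.not_false]
    by_contra hn
    push Not at hn
    nlinarith [mul_nonneg hg.le hn]
  · rw [Bool.not_true] at h2
    have := hT.opposite_sides h1 h2 hne
    simp only [sideSign, Bool.not_true]
    rw [orient_swap]
    by_contra hn
    push Not at hn
    nlinarith [mul_nonneg hg.le (show 0 ≤ orient (X.pt (sideChain d false 0))
      (X.pt (sideChain d true 0)) (X.pt P) by linarith)]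

/-- Fourteen flips from an inclined channel at an unlocked gadget to the one with all triangles at
the vertex `W` in the narrow mouth. -/
theorem flipPath_star (hX : X.IsConstruction) {d : G.Dart} {m : Bool} {P Q W : Node G}
    (h : X.IsPort d m P Q W) {R : Set (Set (Node G))}
    (hR : ∀ t ∈ R, ∃ n ∈ t, n ≠ P ∧ n ≠ Q ∧ n ≠ W ∧ ∀ m i, n ≠ sideChain d m i)
    (h1 : (openSegment ℝ (X.pt P) (X.pt Q) ∩
      openSegment ℝ (X.pt (sideChain d (!m) 0)) (X.pt W)).Nonempty)
    (h2 : (openSegment ℝ (X.pt P) (X.pt (sideChain d (!m) 0)) ∩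
      openSegment ℝ (X.pt (sideChain d m 0)) (X.pt W)).Nonempty) (k : Bool) :
    FlipPath X.pt 14 (R ∪ inclined d k ∪ {{sideChain d (!m) 0, sideChain d m 0, P},
        {sideChain d (!m) 0, P, Q}, {P, Q, W}})
      (R ∪ {{sideChain d m 0, P, W}, {sideChain d (!m) 0, Q, W}} ∪
        (fan W (sideChain d false) ∪ fan W (sideChain d true)) ∪
          {{sideChain d false 6, sideChain d true 6, W}}) := by
  obtain ⟨iP, iQ, iW, hPQ, hPW, hQW⟩ := h.inner hX
  have p1 := cap_flipPath (pt := X.pt) (a := sideChain d (!m) 0) (b := sideChain d m 0) (p := P)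
    (q := Q) (w := W) (U := R ∪ inclined d k) (by
      simp only [List.nodup_cons, List.mem_cons, List.not_mem_nil, or_false, not_or,
        not_false_eq_true, List.nodup_nil, and_true]
      exact ⟨⟨(sideChain_ne d m 0 0).symm, (iP.ne_sideChain d _ _).symm,
        (iQ.ne_sideChain d _ _).symm, (iW.ne_sideChain d _ _).symm⟩,
        ⟨(iP.ne_sideChain d _ _).symm, (iQ.ne_sideChain d _ _).symm,
          (iW.ne_sideChain d _ _).symm⟩, ⟨hPQ, hPW⟩, hQW⟩) (by
      simp only [List.mem_cons, List.not_mem_nil, or_false, not_or]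
      rintro t (ht | ht)
      · obtain ⟨n, hn, a1, a2, a3, a4⟩ := hR t ht
        exact ⟨n, hn, a4 _ _, a4 _ _, a1, a2, a3⟩
      · obtain ⟨m', i, hi, ht⟩ := exists_mem_inclined ht
        refine ⟨_, ht, ?_, ?_, (iP.ne_sideChain d _ _).symm, (iQ.ne_sideChain d _ _).symm,
          (iW.ne_sideChain d _ _).symm⟩
        · cases m <;> cases m' <;> intro e <;>
            first
              | exact hi.ne' (sideChain_injective d _ e)
              | exact sideChain_ne d false _ _ e
              | exact sideChain_ne d true _ _ e
        · cases m <;> cases m' <;> intro e <;>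
            first
              | exact hi.ne' (sideChain_injective d _ e)
              | exact sideChain_ne d false _ _ e
              | exact sideChain_ne d true _ _ e) h1 h2
  -- Being a cap is symmetric in the two chains, so the side `m` of the port and the inclination `k`
  -- need not agree.
  have hcap : IsCap (sideSign k) (X.pt ∘ sideChain d k) (X.pt ∘ sideChain d !k) (X.pt W) := by
    have h0 := (h.geometry hX).2.2
    have h0' := h0.swap
    cases m <;> cases k
    · exact h0
    · simpa [sideSign] using h0'
    · simpa [sideSign] using h0'
    · exact h0
  have p2 := channel_flipPath (pt := X.pt) (U := R ∪ {{sideChain d m 0, P, W},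
    {sideChain d (!m) 0, Q, W}}) (sideChain_injective d k) (sideChain_injective d !k)
    (sideChain_ne d k) (iW.ne_sideChain d _) (iW.ne_sideChain d _) (by
      rintro t (ht | rfl | rfl)
      · obtain ⟨n, hn, a1, a2, a3, a4⟩ := hR t ht
        exact ⟨n, hn, a3, a4 _, a4 _⟩
      · exact ⟨P, by simp, hPW, iP.ne_sideChain d _, iP.ne_sideChain d _⟩
      · exact ⟨Q, by simp, hQW, iQ.ne_sideChain d _, iQ.ne_sideChain d _⟩)
    (hX.chan d k) hcap
  have e1 : R ∪ inclined d k ∪ {{sideChain d m 0, P, W}, {sideChain d (!m) 0, Q, W}} ∪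
      {{sideChain d m 0, sideChain d (!m) 0, W}} =
      R ∪ {{sideChain d m 0, P, W}, {sideChain d (!m) 0, Q, W}} ∪
      (fan (sideChain d k 0) (sideChain d !k) ∪ fan (sideChain d (!k) 6) (sideChain d k)) ∪
      {{sideChain d k 0, sideChain d (!k) 0, W}} := by
    rw [Set.union_right_comm R]
    congr 2
    cases m <;> cases k <;> simp only [Bool.not_false, Bool.not_true] <;>
      first | rfl | exact triple_perm_left _ _ _
  have e2 : R ∪ {{sideChain d m 0, P, W}, {sideChain d (!m) 0, Q, W}} ∪
      (fan W (sideChain d !k) ∪ fan W (sideChain d k)) ∪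
      {{sideChain d k 6, sideChain d (!k) 6, W}} =
      R ∪ {{sideChain d m 0, P, W}, {sideChain d (!m) 0, Q, W}} ∪
        (fan W (sideChain d false) ∪ fan W (sideChain d true)) ∪
          {{sideChain d false 6, sideChain d true 6, W}} := by
    cases k
    · rw [Bool.not_false, Set.union_comm (fan W (sideChain d true))]
    · rw [Bool.not_true, triple_perm_left (sideChain d false 6)]
  rw [e1] at p1
  rw [e2] at p2
  exact p1.trans p2

/-- Changing a channel at an unlocked gadget from left-inclined to right-inclined. -/
theorem flipPath_channel (hX : X.IsConstruction) {U : Set V} {J : Set (Sym2 V)} {d : G.Dart}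
    (hd : d.fst ∈ U) (hJ : d.edge ∉ J) (hT : IsTriangulation X.pt X.region (X.mixed U J)) :
    FlipPath X.pt 28 (X.mixed U J) (X.mixed U (insert d.edge J)) := by
  obtain ⟨m, P, Q, W, h⟩ := hX.exists_isPort d
  obtain ⟨t1, t2, t3⟩ := h.triangles hX
  obtain ⟨iP, iQ, iW, hPQ, hPW, hQW⟩ := h.inner hX
  -- The triangulation is split into the three port triangles `S`, the channel of `d`, and a rest
  -- `R` that takes part in no flip.
  set S : Set (Set (Node G)) := {{sideChain d (!m) 0, sideChain d m 0, P},
        {sideChain d (!m) 0, P, Q}, {P, Q, W}} with hS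
  set Ch : Set (Set (Node G)) := {t | ∃ e : G.Dart, e.edge ≠ d.edge ∧
      (e.edge ∉ J ∧ t ∈ leftInclined e ∨ e.edge ∈ J ∧ t ∈ rightInclined e)} with hCh
  set R : Set (Set (Node G)) := (X.gadgets U \ S) ∪ Ch with hR
  have hSG : S ⊆ X.gadgets U := by
    rintro t (rfl | rfl | rfl)
    · exact Or.inl ⟨_, t1⟩
    · exact Or.inl ⟨_, t2⟩
    · exact Or.inr (Or.inr ⟨_, hd, t3⟩)
  have hG : X.gadgets U \ S ∪ S = X.gadgets U := Set.sdiff_union_of_subset hSG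
  have c1 : channels J = inclined d false ∪ Ch := by
    rw [← leftInclined_union]
    ext t
    simp only [channels, hCh, Set.mem_ofPred_eq, Set.mem_union]
    constructor
    · rintro ⟨e, he⟩
      by_cases hde : e.edge = d.edge
      · rcases he with ⟨-, he⟩ | ⟨he, -⟩
        · rcases (SimpleGraph.dart_edge_eq_iff _ _).1 hde with rfl | rfl
          · exact Or.inl (Or.inl he)
          · exact Or.inl (Or.inr he)
        · exact absurd (hde ▸ he) hJ
      · exact Or.inr ⟨e, hde, he⟩
    · rintro ((he | he) | ⟨e, -, he⟩)
      · exact ⟨d, Or.inl ⟨hJ, he⟩⟩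
      · exact ⟨d.symm, Or.inl ⟨by rwa [d.edge_symm], he⟩⟩
      · exact ⟨e, he⟩
  have c2 : channels (insert d.edge J) = inclined d true ∪ Ch := by
    rw [← rightInclined_union]
    ext t
    simp only [channels, hCh, Set.mem_ofPred_eq, Set.mem_union, Set.mem_insert_iff, not_or]
    constructor
    · rintro ⟨e, he⟩
      by_cases hde : e.edge = d.edge
      · rcases he with ⟨⟨he, -⟩, -⟩ | ⟨-, he⟩
        · exact absurd hde he
        · rcases (SimpleGraph.dart_edge_eq_iff _ _).1 hde with rfl | rfl
          · exact Or.inl (Or.inl he)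
          · exact Or.inl (Or.inr he)
      · refine Or.inr ⟨e, hde, ?_⟩
        rcases he with ⟨⟨-, he⟩, ht⟩ | ⟨he | he, ht⟩
        · exact Or.inl ⟨he, ht⟩
        · exact absurd he hde
        · exact Or.inr ⟨he, ht⟩
    · rintro ((he | he) | ⟨e, hde, ⟨he, ht⟩ | ⟨he, ht⟩⟩)
      · exact ⟨d, Or.inr ⟨Or.inl rfl, he⟩⟩
      · exact ⟨d.symm, Or.inr ⟨Or.inl d.edge_symm, he⟩⟩
      · exact ⟨e, Or.inl ⟨⟨hde, he⟩, ht⟩⟩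
      · exact ⟨e, Or.inr ⟨Or.inr he, ht⟩⟩
  have e1 : X.mixed U J = R ∪ inclined d false ∪ S := by
    rw [mixed, c1, ← hG, hR]
    ext t
    simp only [Set.mem_union]
    tauto
  have e2 : X.mixed U (insert d.edge J) = R ∪ inclined d true ∪ S := by
    rw [mixed, c2, ← hG, hR]
    ext t
    simp only [Set.mem_union]
    tauto
  have hRn : ∀ t ∈ R, ∃ n ∈ t, n ≠ P ∧ n ≠ Q ∧ n ≠ W ∧ ∀ m i, n ≠ sideChain d m i := by
    rintro t (⟨ht, htS⟩ | ⟨e, hed, he⟩)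
    · by_cases hv : t ∈ gadgetOuter d.fst (X.ports d.fst) ∪ unlockedQuad d.fst
      · simp only [hS, Set.mem_insert_iff, Set.mem_singleton_iff, not_or] at htS
        exact h.exists_mem_of_ne hX hv htS.1 htS.2.1 htS.2.2
      · have : ∃ v, v ≠ d.fst ∧
            t ∈ gadgetOuter v (X.ports v) ∪ (lockedQuad v ∪ unlockedQuad v) := by
          rcases ht with ⟨v, ht⟩ | ⟨v, hvU, ht⟩ | ⟨v, hvU, ht⟩
          · exact ⟨v, fun e => hv (Or.inl (e ▸ ht)), Or.inl ht⟩
          · exact ⟨v, fun e => hvU (e ▸ hd), Or.inr (Or.inl ht)⟩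
          · exact ⟨v, fun e => hv (Or.inr (e ▸ ht)), Or.inr (Or.inr ht)⟩
        obtain ⟨v, hvd, ht'⟩ := this
        obtain ⟨n, hn, hi⟩ := exists_inner_mem ht'
        exact ⟨n, hn, fun e => hvd (hi.eq_of_eq (e ▸ iP)), fun e => hvd (hi.eq_of_eq (e ▸ iQ)),
          fun e => hvd (hi.eq_of_eq (e ▸ iW)), hi.ne_sideChain d⟩
    · have : ∃ i, chain e i ∈ t := by
        rcases he with ⟨-, i, rfl⟩ | ⟨-, i, rfl⟩ <;> exact ⟨_, Or.inl rfl⟩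
      obtain ⟨i, hi⟩ := this
      refine ⟨_, hi, (iP.ne_chain e i).symm, (iQ.ne_chain e i).symm, (iW.ne_chain e i).symm, ?_⟩
      intro m j hj
      have := mem_channelNodes_iff.1 (show chain e i ∈ channelNodes d from ⟨m, j, hj⟩)
      obtain ⟨e', i', h1, h2⟩ := this
      rw [← (Node.chain.inj h1).1] at h2
      exact hed h2
  have hT' : S ⊆ X.mixed U J := fun t ht => Or.inl (hSG ht)
  have m1 : {sideChain d (!m) 0, sideChain d m 0, P} ∈ X.mixed U J := hT' (Or.inl rfl)
  have m2 : {sideChain d (!m) 0, P, Q} ∈ X.mixed U J := hT' (Or.inr (Or.inl rfl))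
  have m3 : {P, Q, W} ∈ X.mixed U J := hT' (Or.inr (Or.inr rfl))
  obtain ⟨g1, g2, g3⟩ := h.geometry hX
  have m1' : {sideChain d (!m) 0, P, sideChain d m 0} ∈ X.mixed U J := by
    rwa [triple_perm_right]
  have m2' : {P, Q, sideChain d (!m) 0} ∈ X.mixed U J := by rwa [triple_rotate]
  -- What the placement leaves open is supplied by the current triangulation: adjacent triangles are
  -- on opposite sides of their common edge, and `W` is not inside a triangle of which it is not a
  -- vertex.
  obtain ⟨x1, x2⟩ := cap_crossings (hX.chan d m) g3 g1 (hX.port_beyond h) g2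
    (hT.opposite_sides m1' m2 (iQ.ne_sideChain d _ _).symm)
    (hT.opposite_sides m2' m3 (iW.ne_sideChain d _ _).symm) (by
      intro hw
      have := hT.mem_of_mem_hull m1' (p := W) (by rwa [hull_triple])
      rcases this with e | e | e
      · exact iW.ne_sideChain d _ _ e
      · exact hPW e.symm
      · exact iW.ne_sideChain d _ _ e)
  rw [e1, e2]
  -- Both inclinations reach the same star at `W`, so the second path is run backwards.
  exact (hX.flipPath_star h hRn x1 x2 false).trans (hX.flipPath_star h hRn x1 x2 true).symm

theorem flipPath_unlock (hX : X.IsConstruction) (S : Finset V) (J : Set (Sym2 V)) :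
    FlipPath X.pt S.card (X.mixed ∅ J) (X.mixed S J) := by
  classical
  induction S using Finset.induction_on with
  | empty => simp [FlipPath]
  | insert v S hv ih =>
    rw [Finset.card_insert_of_notMem hv, Finset.coe_insert]
    exact ⟨_, ih, hX.flipStep_unlock (by simpa using hv) J⟩

/-- Each edge has an end in the cover, and the gadget at this end is unlocked. The channels are
converted one at a time, each step relying on the current set being a triangulation. -/
theorem flipPath_channels (hX : X.IsConstruction) (S : Finset V)
    (hS : G.IsVertexCover (S : Set V)) (J : Finset (Sym2 V)) (hJ : (J : Set (Sym2 V)) ⊆ G.edgeSet) :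
    FlipPath X.pt (28 * J.card) (X.mixed S ∅) (X.mixed S J) := by
  classical
  induction J using Finset.induction_on with
  | empty => simp [FlipPath]
  | insert e J he ih =>
    rw [Finset.coe_insert, Set.insert_subset_iff] at hJ
    have p := ih hJ.2
    have : ∃ d : G.Dart, d.edge = e ∧ d.fst ∈ S := by
      induction e using Sym2.ind with
      | _ v w =>
        have hvw : G.Adj v w := hJ.1
        rcases hS hvw with hv | hw
        · exact ⟨⟨(v, w), hvw⟩, rfl, hv⟩
        · exact ⟨⟨(w, v), hvw.symm⟩, Sym2.eq_swap, hw⟩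
    obtain ⟨d, rfl, hd⟩ := this
    have hT := p.isTriangulation ((hX.flipPath_unlock S ∅).isTriangulation hX.isTriangulation)
    rw [Finset.card_insert_of_notMem he, Finset.coe_insert, mul_add, mul_one]
    exact p.trans (hX.flipPath_channel hd (by simpa using he) hT)

theorem flipPath (hX : X.IsConstruction) [Finite V] (S : Finset V)
    (hS : G.IsVertexCover (S : Set V)) :
    FlipPath X.pt (2 * S.card + 28 * G.edgeSet.ncard) X.T₁ X.T₂ := by
  have hJ : (G.edgeSet.toFinite.toFinset : Set (Sym2 V)) = G.edgeSet := by simp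
  have p1 := hX.flipPath_unlock S ∅
  have p2 := hX.flipPath_channels S hS G.edgeSet.toFinite.toFinset hJ.subset
  have p3 := (hX.flipPath_unlock S G.edgeSet).symm
  rw [hJ, ← Set.ncard_eq_toFinset_card] at p2
  rw [T₁_eq, T₂_eq]
  have := (p1.trans p2).trans p3
  convert this using 1
  ring

end IsConstruction

end Layout

/-! ### Leaving a part of a triangulation along a segment -/

/-- A segment that leaves the part `K` of a triangulation passes through a common face of a
triangle in `K` and a triangle not in `K`. -/
theorem IsTriangulation.exists_exit {N : Type*} [Finite N] {pt : N → Plane} {R : Set Plane}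
    {T : Set (Set N)} (h : IsTriangulation pt R T) {K : Set (Set N)} (hK : K ⊆ T) {p : Plane}
    {t : Set N} (ht : t ∈ K) (hp : p ∈ hull pt t) {x : N} (hx : ∀ t ∈ K, x ∉ t)
    (hpx : segment ℝ p (pt x) ⊆ R) :
    ∃ t₁ ∈ K, ∃ t₂ ∈ T, t₂ ∉ K ∧ ∃ z ∈ segment ℝ p (pt x), z ∈ hull pt (t₁ ∩ t₂) := by
  have hc : ∀ K : Set (Set N), IsClosed (⋃ t ∈ K, hull pt t) := fun K =>
    K.toFinite.isClosed_biUnion fun t _ => isClosed_hull t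
  have hcov : segment ℝ p (pt x) ⊆ (⋃ t ∈ K, hull pt t) ∪ ⋃ t ∈ T \ K, hull pt t := by
    intro z hz
    have := hpx hz
    rw [← h.covers] at this
    obtain ⟨t, ht, hzt⟩ := Set.mem_iUnion₂.1 this
    by_cases htK : t ∈ K
    · exact Or.inl (Set.mem_iUnion₂.2 ⟨t, htK, hzt⟩)
    · exact Or.inr (Set.mem_iUnion₂.2 ⟨t, ⟨ht, htK⟩, hzt⟩)
  have hx' : pt x ∉ ⋃ t ∈ K, hull pt t := by
    intro hxK
    obtain ⟨t, ht, hxt⟩ := Set.mem_iUnion₂.1 hxK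
    exact hx t ht (h.mem_of_mem_hull (hK ht) hxt)
  -- The segment is connected and covered by two closed sets, the union of the triangles in `K` and
  -- that of the others, and it meets both of them.
  have hconn := isPreconnected_closed_iff.1 (convex_segment (𝕜 := ℝ) p (pt x)).isPreconnected
    _ _ (hc K) (hc (T \ K)) hcov
    ⟨p, left_mem_segment _ _ _, Set.mem_iUnion₂.2 ⟨t, ht, hp⟩⟩
    ⟨pt x, right_mem_segment _ _ _, (hcov (right_mem_segment _ _ _)).resolve_left hx'⟩
  obtain ⟨z, hz, hz1, hz2⟩ := hconn
  obtain ⟨t₁, ht₁, hz1⟩ := Set.mem_iUnion₂.1 hz1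
  obtain ⟨t₂, ht₂, hz2⟩ := Set.mem_iUnion₂.1 hz2
  exact ⟨t₁, ht₁, t₂, ht₂.1, ht₂.2, z, hz, h.face_to_face _ (hK ht₁) _ ht₂.1 ▸ ⟨hz1, hz2⟩⟩

/-- A line of sight from inside a channel through its near end to a point that is not entirely
outside the right hand chain stays in the closed wide mouth. -/
theorem Chan.mem_mouth {σ : ℝ} {l r : Fin 7 → Plane} (h : Chan σ l r) {M x q p : Plane}
    (hgM : 0 < σ * orient (l 0) (r 0) M) (hlM : 0 ≤ σ * orient (l 0) (l 1) M)
    (hq : q ∈ segment ℝ (l 0) (r 0))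
    (hqM : q ∈ segment ℝ M x) (hp : p ∈ segment ℝ q x)
    (hx : ∃ j : Fin 6, 0 < σ * orient (r j.castSucc) (r j.succ) x) :
    σ * orient (l 0) (l 1) p ≤ 0 ∧ 0 ≤ σ * orient (r 0) (r 1) p ∧
      σ * orient (l 0) (r 0) p ≤ 0 := by
  have hgq : σ * orient (l 0) (r 0) q = 0 := by
    obtain ⟨a, b, -, -, hab, rfl⟩ := hq
    rw [orient_combo hab]; simp
  have hlq : σ * orient (l 0) (l 1) q ≤ 0 := by
    obtain ⟨a, b, ha, hb, hab, rfl⟩ := hq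
    rw [orient_combo hab]
    have := h.visible_left 0 1 0 (by decide)
    simp only [orient_self_outer]
    nlinarith
  have hfq : 0 ≤ σ * orient (r 0) (r 1) q := by
    obtain ⟨a, b, ha, hb, hab, rfl⟩ := hq
    rw [orient_combo hab]
    have := h.visible_right 0 1 0 (by decide)
    simp only [orient_self_outer]
    nlinarith
  obtain ⟨a, b, ha, hb, hab, e⟩ := hqM
  -- `M` is strictly inside the end line and `q` is on it, so `q` differs from `M` and signs at `x`
  -- can be inferred by extending the segment beyond `q`.
  have hb0 : 0 < b := by
    refine hb.lt_of_ne ?_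
    rintro rfl
    obtain rfl : a = 1 := by linarith
    simp only [one_smul, zero_smul, add_zero] at e
    rw [e] at hgM
    exact hgM.ne' hgq
  have hgx : σ * orient (l 0) (r 0) x ≤ 0 := by
    rw [← e, orient_combo hab] at hgq
    by_contra hn
    push Not at hn
    nlinarith [mul_nonneg ha hgM.le, mul_pos hb0 hn]
  have hlx : σ * orient (l 0) (l 1) x ≤ 0 := by
    rw [← e, orient_combo hab] at hlq
    by_contra hn
    push Not at hn
    nlinarith [mul_nonneg ha hlM, mul_pos hb0 hn]
  -- Behind the end line, a point outside the first right chain edge is outside all of them, against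
  -- `hx`.
  have hfx : 0 ≤ σ * orient (r 0) (r 1) x := by
    by_contra hn
    push Not at hn
    obtain ⟨j, hj⟩ := hx
    exact absurd hj (h.outside_of_outside hgx hn j).le.not_gt
  obtain ⟨c, f, hc, hf, hcf, rfl⟩ := hp
  rw [orient_combo hcf, orient_combo hcf, orient_combo hcf]
  refine ⟨?_, ?_, ?_⟩
  · nlinarith [mul_nonneg hc (neg_nonneg.2 hlq), mul_nonneg hf (neg_nonneg.2 hlx)]
  · nlinarith [mul_nonneg hc hfq, mul_nonneg hf hfx]
  · nlinarith [mul_nonneg hf (neg_nonneg.2 hgx)]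

/-! ### Cutting the gadgets -/

namespace Layout

open Node

variable {V : Type*} {G : SimpleGraph V}

instance [Finite V] : Finite G.Dart :=
  Finite.of_injective (fun d : G.Dart => d.toProd) SimpleGraph.Dart.toProd_injective

instance [Finite V] : Finite (Node G) := by
  let f : (G.Dart × Fin 7) ⊕ (V ⊕ V) ⊕ (V ⊕ V) → Node G :=
    Sum.elim (fun p => chain p.1 p.2) (Sum.elim (Sum.elim C D) (Sum.elim E F))
  refine Finite.of_surjective f ?_
  rintro (⟨d, i⟩ | v | v | v | v)
  · exact ⟨Sum.inl (d, i), rfl⟩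
  · exact ⟨Sum.inr (Sum.inl (Sum.inl v)), rfl⟩
  · exact ⟨Sum.inr (Sum.inl (Sum.inr v)), rfl⟩
  · exact ⟨Sum.inr (Sum.inr (Sum.inl v)), rfl⟩
  · exact ⟨Sum.inr (Sum.inr (Sum.inr v)), rfl⟩

/-- The pair `s` of vertices separates the end edge of the channel `d` from `W` in the gadget. -/
def IsCut (X : Layout G) (d : G.Dart) (W : Node G) (s : Set (Node G)) : Prop :=
  ∃ K : Set (Node G), K ⊆ gadgetNodes d.fst ∧ leftEnd d ∈ K ∧ rightEnd d ∈ K ∧ W ∉ K ∧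
    ∀ t ∈ gadget d.fst (X.ports d.fst), t ⊆ K ∨ t ∩ K ⊆ s

variable {X : Layout G}

/-- With `K` the whole gadget nothing is left to cross: a line of sight through the mouth cannot end
outside the gadget. -/
theorem isCut_empty (hX : X.IsConstruction) (d : G.Dart) {W : Node G} (hW : W ∉ gadgetNodes d.fst) :
    X.IsCut d W ∅ := by
  refine ⟨gadgetNodes d.fst, subset_rfl, ?_, ?_, hW, fun t ht => Or.inl ?_⟩
  · exact Or.inr (Or.inr (Or.inr (Or.inr ⟨d, rfl, Or.inl rfl⟩)))
  · exact Or.inr (Or.inr (Or.inr (Or.inr ⟨d, rfl, Or.inr rfl⟩)))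
  · rw [gadget_eq] at ht
    exact hX.gadget_subset_gadgetNodes (by rcases ht with h | h; exacts [Or.inl h, Or.inr (Or.inl h)])

namespace IsPort

variable {d : G.Dart} {m : Bool} {P Q W : Node G}

/-- The placement of the gadget leaves `W` as the only inner vertex that a line of sight through the
wide mouth can reach. -/
theorem outside (hX : X.IsConstruction) (h : X.IsPort d m P Q W) {n : Node G}
    (hn : IsInner d.fst n) (hW : n ≠ W) : X.OutsideWide d n := by
  cases h with
  | @two_fst v d₁ d₂ h =>
    obtain ⟨rfl, -⟩ := hX.fst_two h
    have hg := hX.gadget_placed d.fst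
    rw [h] at hg
    obtain ⟨-, -, -, hC, hD, hE, hF⟩ := hg
    rcases hn with rfl | rfl | rfl | rfl
    · exact Or.inl hC.1
    · exact absurd rfl hW
    · exact Or.inr hE.1
    · exact Or.inr hF.2
  | @two_snd v d₁ d₂ h =>
    obtain ⟨-, rfl, -⟩ := hX.fst_two h
    have hg := hX.gadget_placed d.fst
    rw [h] at hg
    obtain ⟨-, -, -, hC, hD, hE, hF⟩ := hg
    rcases hn with rfl | rfl | rfl | rfl
    · exact Or.inr hC.2
    · exact Or.inl hD.2
    · exact Or.inl hE.2
    · exact absurd rfl hW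
  | @three_fst v d₁ d₂ d₃ h =>
    obtain ⟨rfl, -⟩ := hX.fst_three h
    have hg := hX.gadget_placed d.fst
    rw [h] at hg
    obtain ⟨-, -, -, hC, hD, hE, hF⟩ := hg
    rcases hn with rfl | rfl | rfl | rfl
    · exact hC.1
    · exact absurd rfl hW
    · exact Or.inr hE.1
    · exact Or.inl hF.1
  | @three_snd v d₁ d₂ d₃ h =>
    obtain ⟨-, rfl, -⟩ := hX.fst_three h
    have hg := hX.gadget_placed d.fst
    rw [h] at hg
    obtain ⟨-, -, -, hC, hD, hE, hF⟩ := hg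
    rcases hn with rfl | rfl | rfl | rfl
    · exact Or.inl hC.2.1
    · exact absurd rfl hW
    · exact hE.2.1
    · exact Or.inr hF.2.1
  | @three_trd v d₁ d₂ d₃ h =>
    obtain ⟨-, -, rfl, -⟩ := hX.fst_three h
    have hg := hX.gadget_placed d.fst
    rw [h] at hg
    obtain ⟨-, -, -, hC, hD, hE, hF⟩ := hg
    rcases hn with rfl | rfl | rfl | rfl
    · exact Or.inr hC.2.2
    · exact Or.inr hD.2.2
    · exact Or.inl hE.2.2
    · exact absurd rfl hW

end IsPort

namespace IsPort

variable {d : G.Dart} {m : Bool} {P Q W : Node G}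

/-- The triangle `ABP` is cut off: the vertex `B` is in no other gadget triangle, so only `P` and
`A` are shared with the rest. -/
theorem isCut_fst (hX : X.IsConstruction) (h : X.IsPort d m P Q W) :
    X.IsCut d W {P, sideChain d (!m) 0} := by
  have e6 : (Fin.rev 0 : Fin 7) = 6 := rfl
  obtain ⟨iP, iQ, iW, hPQ, hPW, hQW⟩ := h.inner hX
  refine ⟨{leftEnd d, rightEnd d, P}, ?_, by simp, by simp, ?_, ?_⟩
  · rintro n (rfl | rfl | rfl)
    · exact Or.inr (Or.inr (Or.inr (Or.inr ⟨d, rfl, Or.inl rfl⟩)))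
    · exact Or.inr (Or.inr (Or.inr (Or.inr ⟨d, rfl, Or.inr rfl⟩)))
    · exact iP.mem_gadgetNodes
  · rintro (e | e | e)
    · exact iW.ne_chain _ _ e
    · exact iW.ne_chain _ _ e
    · exact hPW e.symm
  · intro t ht
    cases h with
    | two_fst h =>
      obtain ⟨rfl, -, hne⟩ := hX.fst_two h
      rw [h] at ht
      rcases ht with rfl | rfl | rfl | rfl | rfl | rfl <;>
        first
          | refine Or.inl ?_
            rintro n (rfl | rfl | rfl) <;> simp
            done
          | refine Or.inr ?_
            rintro n ⟨rfl | rfl | rfl, hn⟩ <;>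
              simp_all [leftEnd, rightEnd, sideChain, dart_symm_inj, Ne.symm]
    | two_snd h =>
      obtain ⟨-, rfl, hne⟩ := hX.fst_two h
      rw [h] at ht
      rcases ht with rfl | rfl | rfl | rfl | rfl | rfl <;>
        first
          | refine Or.inl ?_
            rintro n (rfl | rfl | rfl) <;> simp
            done
          | refine Or.inr ?_
            rintro n ⟨rfl | rfl | rfl, hn⟩ <;>
              simp_all [leftEnd, rightEnd, sideChain, dart_symm_inj, Ne.symm]
    | three_fst h =>
      obtain ⟨rfl, -, -, h1, h2, h3⟩ := hX.fst_three h
      rw [h] at ht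
      rcases ht with rfl | rfl | rfl | rfl | rfl | rfl | rfl | rfl <;>
        first
          | refine Or.inl ?_
            rintro n (rfl | rfl | rfl) <;> simp
            done
          | refine Or.inr ?_
            rintro n ⟨rfl | rfl | rfl, hn⟩ <;>
              simp_all [leftEnd, rightEnd, sideChain, dart_symm_inj, Ne.symm]
    | three_snd h =>
      obtain ⟨-, rfl, -, h1, h2, h3⟩ := hX.fst_three h
      rw [h] at ht
      rcases ht with rfl | rfl | rfl | rfl | rfl | rfl | rfl | rfl <;>
        first
          | refine Or.inl ?_
            rintro n (rfl | rfl | rfl) <;> simp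
            done
          | refine Or.inr ?_
            rintro n ⟨rfl | rfl | rfl, hn⟩ <;>
              simp_all [leftEnd, rightEnd, sideChain, dart_symm_inj, Ne.symm]
    | three_trd h =>
      obtain ⟨-, -, rfl, h1, h2, h3⟩ := hX.fst_three h
      rw [h] at ht
      rcases ht with rfl | rfl | rfl | rfl | rfl | rfl | rfl | rfl <;>
        first
          | refine Or.inl ?_
            rintro n (rfl | rfl | rfl) <;> simp
            done
          | refine Or.inr ?_
            rintro n ⟨rfl | rfl | rfl, hn⟩ <;>
              simp_all [leftEnd, rightEnd, sideChain, dart_symm_inj, Ne.symm]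

/-- The triangles `ABP` and `APQ` are cut off. Neither `A` nor `B` is in a further gadget triangle.
-/
theorem isCut_snd (hX : X.IsConstruction) (h : X.IsPort d m P Q W) :
    X.IsCut d W {P, Q} := by
  obtain ⟨iP, iQ, iW, hPQ, hPW, hQW⟩ := h.inner hX
  refine ⟨{leftEnd d, rightEnd d, P, Q}, ?_, by simp, by simp, ?_, ?_⟩
  · rintro n (rfl | rfl | rfl | rfl)
    · exact Or.inr (Or.inr (Or.inr (Or.inr ⟨d, rfl, Or.inl rfl⟩)))
    · exact Or.inr (Or.inr (Or.inr (Or.inr ⟨d, rfl, Or.inr rfl⟩)))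
    · exact iP.mem_gadgetNodes
    · exact iQ.mem_gadgetNodes
  · rintro (e | e | e | e)
    · exact iW.ne_chain _ _ e
    · exact iW.ne_chain _ _ e
    · exact hPW e.symm
    · exact hQW e.symm
  · intro t ht
    cases h with
    | two_fst h =>
      obtain ⟨rfl, -, hne⟩ := hX.fst_two h
      rw [h] at ht
      rcases ht with rfl | rfl | rfl | rfl | rfl | rfl <;>
        first
          | refine Or.inl ?_
            rintro n (rfl | rfl | rfl) <;> simp
            done
          | refine Or.inr ?_
            rintro n ⟨rfl | rfl | rfl, hn⟩ <;>
              simp_all [leftEnd, rightEnd, dart_symm_inj, Ne.symm]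
    | two_snd h =>
      obtain ⟨-, rfl, hne⟩ := hX.fst_two h
      rw [h] at ht
      rcases ht with rfl | rfl | rfl | rfl | rfl | rfl <;>
        first
          | refine Or.inl ?_
            rintro n (rfl | rfl | rfl) <;> simp
            done
          | refine Or.inr ?_
            rintro n ⟨rfl | rfl | rfl, hn⟩ <;>
              simp_all [leftEnd, rightEnd, dart_symm_inj, Ne.symm]
    | three_fst h =>
      obtain ⟨rfl, -, -, h1, h2, h3⟩ := hX.fst_three h
      rw [h] at ht
      rcases ht with rfl | rfl | rfl | rfl | rfl | rfl | rfl | rfl <;>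
        first
          | refine Or.inl ?_
            rintro n (rfl | rfl | rfl) <;> simp
            done
          | refine Or.inr ?_
            rintro n ⟨rfl | rfl | rfl, hn⟩ <;>
              simp_all [leftEnd, rightEnd, dart_symm_inj, Ne.symm]
    | three_snd h =>
      obtain ⟨-, rfl, -, h1, h2, h3⟩ := hX.fst_three h
      rw [h] at ht
      rcases ht with rfl | rfl | rfl | rfl | rfl | rfl | rfl | rfl <;>
        first
          | refine Or.inl ?_
            rintro n (rfl | rfl | rfl) <;> simp
            done
          | refine Or.inr ?_
            rintro n ⟨rfl | rfl | rfl, hn⟩ <;>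
              simp_all [leftEnd, rightEnd, dart_symm_inj, Ne.symm]
    | three_trd h =>
      obtain ⟨-, -, rfl, h1, h2, h3⟩ := hX.fst_three h
      rw [h] at ht
      rcases ht with rfl | rfl | rfl | rfl | rfl | rfl | rfl | rfl <;>
        first
          | refine Or.inl ?_
            rintro n (rfl | rfl | rfl) <;> simp
            done
          | refine Or.inr ?_
            rintro n ⟨rfl | rfl | rfl, hn⟩ <;>
              simp_all [leftEnd, rightEnd, dart_symm_inj, Ne.symm]

/-- `K` is the part of the gadget on the channel's side of the lock. In a degree-3 gadget channels 1
and 2 are on the same side, so `K` contains both end edges. -/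
theorem isCut_lock (hX : X.IsConstruction) (h : X.IsPort d m P Q W) :
    X.IsCut d W {C d.fst, E d.fst} := by
  have hl : ∀ d : G.Dart, leftEnd d ∈ gadgetNodes d.fst := fun d =>
    Or.inr (Or.inr (Or.inr (Or.inr ⟨d, rfl, Or.inl rfl⟩)))
  have hr : ∀ d : G.Dart, rightEnd d ∈ gadgetNodes d.fst := fun d =>
    Or.inr (Or.inr (Or.inr (Or.inr ⟨d, rfl, Or.inr rfl⟩)))
  have hC : ∀ v : V, (C v : Node G) ∈ gadgetNodes v := fun _ => Or.inl rfl
  have hD : ∀ v : V, (D v : Node G) ∈ gadgetNodes v := fun _ => Or.inr (Or.inl rfl)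
  have hE : ∀ v : V, (E v : Node G) ∈ gadgetNodes v := fun _ => Or.inr (Or.inr (Or.inl rfl))
  have hF : ∀ v : V, (F v : Node G) ∈ gadgetNodes v := fun _ =>
    Or.inr (Or.inr (Or.inr (Or.inl rfl)))
  cases h with
  | @two_fst v d d₂ h =>
    obtain ⟨rfl, -, hne⟩ := hX.fst_two h
    refine ⟨{leftEnd d, rightEnd d, C d.fst, F d.fst, E d.fst}, ?_, by simp, by simp, ?_, fun t ht => ?_⟩
    · rintro n (rfl | rfl | rfl | rfl | rfl)
      · exact hl d
      · exact hr d
      · exact hC _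
      · exact hF _
      · exact hE _
    · simp [leftEnd, rightEnd]
    · rw [h] at ht
      rcases ht with rfl | rfl | rfl | rfl | rfl | rfl <;>
        first
          | refine Or.inl ?_
            rintro n (rfl | rfl | rfl) <;> simp
            done
          | refine Or.inr ?_
            rintro n ⟨rfl | rfl | rfl, hn⟩ <;>
              simp_all [leftEnd, rightEnd, dart_symm_inj, Ne.symm]
  | @two_snd v d₁ d h =>
    obtain ⟨-, rfl, hne⟩ := hX.fst_two h
    refine ⟨{leftEnd d, rightEnd d, C d.fst, D d.fst, E d.fst}, ?_, by simp, by simp, ?_, fun t ht => ?_⟩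
    · rintro n (rfl | rfl | rfl | rfl | rfl)
      · exact hl d
      · exact hr d
      · exact hC _
      · exact hD _
      · exact hE _
    · simp [leftEnd, rightEnd]
    · rw [h] at ht
      rcases ht with rfl | rfl | rfl | rfl | rfl | rfl <;>
        first
          | refine Or.inl ?_
            rintro n (rfl | rfl | rfl) <;> simp
            done
          | refine Or.inr ?_
            rintro n ⟨rfl | rfl | rfl, hn⟩ <;>
              simp_all [leftEnd, rightEnd, dart_symm_inj, Ne.symm]
  | @three_fst v d d₂ d₃ h =>
    obtain ⟨rfl, hf, -, h1, h2, h3⟩ := hX.fst_three h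
    refine ⟨{leftEnd d, rightEnd d, leftEnd d₂, rightEnd d₂, C d.fst, F d.fst, E d.fst}, ?_, by simp, by simp, ?_, fun t ht => ?_⟩
    · rintro n (rfl | rfl | rfl | rfl | rfl | rfl | rfl)
      · exact hl _
      · exact hr _
      · rw [← hf]; exact hl _
      · rw [← hf]; exact hr _
      · exact hC _
      · exact hF _
      · exact hE _
    · simp [leftEnd, rightEnd]
    · rw [h] at ht
      rcases ht with rfl | rfl | rfl | rfl | rfl | rfl | rfl | rfl <;>
        first
          | refine Or.inl ?_
            rintro n (rfl | rfl | rfl) <;> simp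
            done
          | refine Or.inr ?_
            rintro n ⟨rfl | rfl | rfl, hn⟩ <;>
              simp_all [leftEnd, rightEnd, dart_symm_inj, Ne.symm]
  | @three_snd v d₁ d d₃ h =>
    obtain ⟨hf, rfl, -, h1, h2, h3⟩ := hX.fst_three h
    refine ⟨{leftEnd d, rightEnd d, leftEnd d₁, rightEnd d₁, C d.fst, F d.fst, E d.fst}, ?_, by simp, by simp, ?_, fun t ht => ?_⟩
    · rintro n (rfl | rfl | rfl | rfl | rfl | rfl | rfl)
      · exact hl _
      · exact hr _
      · rw [← hf]; exact hl _
      · rw [← hf]; exact hr _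
      · exact hC _
      · exact hF _
      · exact hE _
    · simp [leftEnd, rightEnd]
    · rw [h] at ht
      rcases ht with rfl | rfl | rfl | rfl | rfl | rfl | rfl | rfl <;>
        first
          | refine Or.inl ?_
            rintro n (rfl | rfl | rfl) <;> simp
            done
          | refine Or.inr ?_
            rintro n ⟨rfl | rfl | rfl, hn⟩ <;>
              simp_all [leftEnd, rightEnd, dart_symm_inj, Ne.symm]
  | @three_trd v d₁ d₂ d h =>
    obtain ⟨-, -, rfl, h1, h2, h3⟩ := hX.fst_three h
    refine ⟨{leftEnd d, rightEnd d, C d.fst, D d.fst, E d.fst}, ?_, by simp, by simp, ?_, fun t ht => ?_⟩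
    · rintro n (rfl | rfl | rfl | rfl | rfl)
      · exact hl d
      · exact hr d
      · exact hC _
      · exact hD _
      · exact hE _
    · simp [leftEnd, rightEnd]
    · rw [h] at ht
      rcases ht with rfl | rfl | rfl | rfl | rfl | rfl | rfl | rfl <;>
        first
          | refine Or.inl ?_
            rintro n (rfl | rfl | rfl) <;> simp
            done
          | refine Or.inr ?_
            rintro n ⟨rfl | rfl | rfl, hn⟩ <;>
              simp_all [leftEnd, rightEnd, dart_symm_inj, Ne.symm]

end IsPort

/-- The end edges of the other channels are on one side of the wide mouth. -/
theorem IsConstruction.clear (hX : X.IsConstruction) {d e : G.Dart} (hf : e.fst = d.fst)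
    (hne : e ≠ d) :
    (X.LeftOfWide d (leftEnd e) ∧ X.LeftOfWide d (rightEnd e)) ∨
      (X.RightOfWide d (leftEnd e) ∧ X.RightOfWide d (rightEnd e)) := by
  have hg := hX.gadget_placed d.fst
  cases hp : X.ports d.fst with
  | two d₁ d₂ =>
    rw [hp] at hg
    obtain ⟨⟨-, h⟩, -, hm, -⟩ := hg
    rcases (h d).1 rfl with rfl | rfl <;> rcases (h e).1 hf with rfl | rfl
    · exact absurd rfl hne
    · exact Or.inl ⟨hm.1, hm.2.1⟩
    · exact Or.inr hm.2.2
    · exact absurd rfl hne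
  | three d₁ d₂ d₃ =>
    rw [hp] at hg
    obtain ⟨⟨-, -, -, h⟩, -, ⟨h1, h2, h3⟩, -⟩ := hg
    rcases (h d).1 rfl with rfl | rfl | rfl <;> rcases (h e).1 hf with rfl | rfl | rfl
    · exact absurd rfl hne
    · exact Or.inl ⟨h1.1, h1.2.1⟩
    · exact Or.inr h3.2.2
    · exact Or.inr h1.2.2
    · exact absurd rfl hne
    · exact Or.inl ⟨h2.1, h2.2.1⟩
    · exact Or.inl ⟨h3.1, h3.2.1⟩
    · exact Or.inr h2.2.2
    · exact absurd rfl hne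

end Layout

/-! ### Chain edges seen from outside the channel -/

theorem orient_pos_of_mem_hull {N : Type*} {pt : N → Plane} {s : ℝ} {p q x : Plane} {t : Set N}
    (h : ∀ i ∈ t, 0 < s * orient p q (pt i)) (hx : x ∈ hull pt t) : 0 < s * orient p q x := by
  refine convexHull_min ?_ (convex_orient_pos s p q) hx
  rintro _ ⟨i, hi, rfl⟩
  exact h i hi

namespace Layout

open Node

variable {V : Type*} {G : SimpleGraph V} {X : Layout G}

/-- The vertex `x` is not on the inner side of any edge of the chain opposite to
`sideChain d m`. -/
def Tame (X : Layout G) (d : G.Dart) (m : Bool) (x : Node G) : Prop :=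
  ∀ j : Fin 6, sideSign m * orient (X.pt (sideChain d (!m) j.castSucc))
    (X.pt (sideChain d (!m) j.succ)) (X.pt x) ≤ 0

theorem sideSign_not (m : Bool) : sideSign (!m) = -sideSign m := by
  cases m <;> simp [sideSign]

theorem tame_symm {d : G.Dart} {m : Bool} {x : Node G} (h : X.Tame d.symm (!m) x) :
    X.Tame d m x := by
  intro j
  have := h j.rev
  rw [sideSign_not, sideChain_symm, sideChain_symm, Bool.not_not, Fin.rev_castSucc, Fin.rev_succ,
    Fin.rev_rev, orient_swap] at this
  linarith

theorem pair_ends (d : G.Dart) (m : Bool) :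
    ({sideChain d m 0, sideChain d (!m) 0} : Set (Node G)) = {leftEnd d, rightEnd d} := by
  cases m
  · rfl
  · exact Set.pair_comm _ _

theorem mem_T₁ {t : Set (Node G)} (ht : t ∈ X.T₁) :
    (∃ v, t ∈ gadget v (X.ports v)) ∨ ∃ e : G.Dart, t ⊆ channelNodes e := by
  rcases ht with ht | ht
  · exact Or.inl (Set.mem_iUnion.1 ht)
  · obtain ⟨e, he⟩ := Set.mem_iUnion.1 ht
    exact Or.inr ⟨e, subset_channelNodes_of_leftInclined he⟩

theorem channelNodes_congr {d e : G.Dart} (h : e.edge = d.edge) :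
    (channelNodes e : Set (Node G)) = channelNodes d := by
  ext n
  rw [mem_channelNodes_iff, mem_channelNodes_iff, h]

theorem channelNodes_disjoint {d e : G.Dart} {n : Node G} (hd : n ∈ channelNodes d)
    (he : n ∈ channelNodes e) : d.edge = e.edge := by
  obtain ⟨d', i, rfl, h⟩ := mem_channelNodes_iff.1 hd
  obtain ⟨e', j, h1, h2⟩ := mem_channelNodes_iff.1 he
  rw [← h, ← h2, (Node.chain.inj h1).1]

theorem inclined_subset_T₁ (d : G.Dart) : inclined d false ⊆ X.T₁ := by
  rw [← leftInclined_union]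
  rintro t (ht | ht)
  · exact Or.inr (Set.mem_iUnion.2 ⟨_, ht⟩)
  · exact Or.inr (Set.mem_iUnion.2 ⟨_, ht⟩)

theorem inclined_subset_T₂ (d : G.Dart) : inclined d true ⊆ X.T₂ := by
  rw [← rightInclined_union]
  rintro t (ht | ht)
  · exact Or.inr (Set.mem_iUnion.2 ⟨_, ht⟩)
  · exact Or.inr (Set.mem_iUnion.2 ⟨_, ht⟩)

theorem mem_inclined_left (d : G.Dart) (m : Bool) (i : Fin 6) :
    {sideChain d m i.castSucc, sideChain d m i.succ, sideChain d (!m) 6} ∈ inclined d m :=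
  Or.inr ⟨i, triple_rotate _ _ _⟩

theorem mem_inclined_right (d : G.Dart) (m : Bool) (i : Fin 6) :
    {sideChain d m i.castSucc, sideChain d m i.succ, sideChain d (!m) 0} ∈ inclined d !m := by
  refine Or.inl ⟨i, ?_⟩
  rw [Bool.not_not]
  exact triple_rotate _ _ _

/-- The apex of a chain edge in the left-inclined triangulation. -/
def apexLeft (m : Bool) : Fin 7 := if m then 0 else 6

theorem mem_T₁_apex (d : G.Dart) (m : Bool) (i : Fin 6) :
    {sideChain d m i.castSucc, sideChain d m i.succ, sideChain d (!m) (apexLeft m)} ∈ X.T₁ := by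
  cases m
  · exact inclined_subset_T₁ d (mem_inclined_left d false i)
  · exact inclined_subset_T₁ d (mem_inclined_right d true i)

theorem mem_T₂_apex (d : G.Dart) (m : Bool) (i : Fin 6) :
    {sideChain d m i.castSucc, sideChain d m i.succ, sideChain d (!m) (apexLeft !m)} ∈ X.T₂ := by
  cases m
  · exact inclined_subset_T₂ d (mem_inclined_right d false i)
  · exact inclined_subset_T₂ d (mem_inclined_left d true i)

/-! ### Lines of sight from chain edges. -/

namespace IsConstruction

theorem tame_of_mem (hX : X.IsConstruction) (d : G.Dart) (m : Bool) (k : Fin 7) :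
    X.Tame d m (sideChain d (!m) k) := fun j => (hX.chan d m).right_nonpos j k

/-- A reflex chain never enters the channel side of the line through one of its own edges, so a
channel vertex seen by a chain edge is on the opposite chain. -/
theorem mem_opposite_of_mem (hX : X.IsConstruction) {d : G.Dart} {m : Bool} {i : Fin 6} {x : Node G}
    (hs : sideSign m * orient (X.pt (sideChain d m i.castSucc)) (X.pt (sideChain d m i.succ))
      (X.pt x) < 0) (hx : x ∈ channelNodes d) : ∃ k, x = sideChain d (!m) k := by
  obtain ⟨m', k, rfl⟩ := hx
  by_cases h : m' = m
  · subst h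
    exact absurd hs ((hX.chan d m').left_nonneg i k).not_gt
  · obtain rfl : m' = !m := by cases m <;> cases m' <;> simp_all
    exact ⟨k, rfl⟩

theorem notMem_of_not_tame (hX : X.IsConstruction) {d : G.Dart} {m : Bool} {i : Fin 6}
    {x : Node G} (hs : sideSign m * orient (X.pt (sideChain d m i.castSucc))
      (X.pt (sideChain d m i.succ)) (X.pt x) < 0) (hx : ¬ X.Tame d m x) : x ∉ channelNodes d := by
  intro h
  obtain ⟨k, rfl⟩ := hX.mem_opposite_of_mem hs h
  exact hx (hX.tame_of_mem d m k)

/-- If both ends of an edge are outside the wide mouth on the same side, so is the whole edge. The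
conclusion is put into the form that contradicts `Chan.mem_mouth`. -/
theorem outside_side {d : G.Dart} {a b : Node G}
    (h : (X.LeftOfWide d a ∧ X.LeftOfWide d b) ∨ (X.RightOfWide d a ∧ X.RightOfWide d b))
    (m : Bool) {z : Plane} (hz : z ∈ hull X.pt {a, b}) :
    0 < sideSign m * orient (X.pt (sideChain d m 0)) (X.pt (sideChain d m 1)) z ∨
      sideSign m * orient (X.pt (sideChain d (!m) 0)) (X.pt (sideChain d (!m) 1)) z < 0 := by
  have hl : X.LeftOfWide d a ∧ X.LeftOfWide d b →
      0 < 1 * orient (X.pt (chain d 0)) (X.pt (chain d 1)) z := by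
    intro h
    refine orient_pos_of_mem_hull ?_ hz
    rintro n (rfl | rfl)
    · rw [one_mul]; exact h.1
    · rw [one_mul]; exact h.2
  have hr : X.RightOfWide d a ∧ X.RightOfWide d b →
      0 < (-1) * orient (X.pt (chain d.symm 6)) (X.pt (chain d.symm 5)) z := by
    intro h
    refine orient_pos_of_mem_hull ?_ hz
    rintro n (rfl | rfl)
    · have := h.1; unfold RightOfWide at this; linarith
    · have := h.2; unfold RightOfWide at this; linarith
  have e0 : (Fin.rev 0 : Fin 7) = 6 := rfl
  have e1 : (Fin.rev 1 : Fin 7) = 5 := rfl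
  cases m <;> simp only [sideSign, sideChain, Bool.not_false, Bool.not_true, e0, e1]
  · rcases h with h | h
    · exact Or.inl (hl h)
    · have := hr h
      exact Or.inr (by linarith)
  · rcases h with h | h
    · have := hl h
      exact Or.inr (by linarith)
    · exact Or.inl (hr h)

/-- A line of sight from inside a channel to a vertex that is not in the channel leaves the channel
through an end edge. -/
theorem exists_mem_end (hX : X.IsConstruction) [Finite V] {d : G.Dart} {m : Bool} {i : Fin 6}
    {M : Plane} (hM : M ∈ hull X.pt {sideChain d m i.castSucc, sideChain d m i.succ}) {x : Node G}
    (hx : x ∉ channelNodes d) (hMx : segment ℝ M (X.pt x) ⊆ X.region) :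
    ∃ q ∈ segment ℝ M (X.pt x), q ∈ hull X.pt {leftEnd d, rightEnd d} ∨
      q ∈ hull X.pt {leftEnd d.symm, rightEnd d.symm} := by
  have hT := hX.no_overlap
  -- The line of sight may come from any triangulation of the region, but it is followed through
  -- `T₁`, where all faces are known. Channel triangles share vertices only with the gadgets at the
  -- two ends, not with other channels.
  obtain ⟨t₁, ht₁, t₂, ht₂, ht₂', z, hz, hz'⟩ := hT.exists_exit
    (K := {t | t ∈ X.T₁ ∧ t ⊆ channelNodes d}) (fun t ht => ht.1)
    (t := {sideChain d m i.castSucc, sideChain d m i.succ, sideChain d (!m) (apexLeft m)})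
    ⟨mem_T₁_apex d m i, by rintro n (rfl | rfl | rfl) <;> exact ⟨_, _, rfl⟩⟩
    (hull_mono _ (by rintro n (rfl | rfl) <;> simp) hM)
    (fun t ht hxt => hx (ht.2 hxt)) hMx
  refine ⟨z, hz, ?_⟩
  rcases mem_T₁ ht₂ with ⟨w, hw⟩ | ⟨e, he⟩
  · have hw' : t₂ ⊆ gadgetNodes w := by
      rw [gadget_eq] at hw
      exact hX.gadget_subset_gadgetNodes (hw.imp_right Or.inl)
    by_cases hdw : d.fst = w
    · refine Or.inl (hull_mono _ ?_ hz')
      rintro n ⟨h1, h2⟩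
      rcases mem_ends_of_mem (hw' h2) (ht₁.2 h1) with h | h
      · exact h.2
      · exact absurd (hdw.trans h.1.symm) d.fst_ne_snd
    · refine Or.inr (hull_mono _ ?_ hz')
      rintro n ⟨h1, h2⟩
      rcases mem_ends_of_mem (hw' h2) (ht₁.2 h1) with h | h
      · exact absurd h.1 hdw
      · exact h.2
  · have hne : e.edge ≠ d.edge := fun h =>
      ht₂' ⟨ht₂, he.trans (channelNodes_congr h).subset⟩
    have : t₁ ∩ t₂ ⊆ ∅ := by
      rintro n ⟨h1, h2⟩
      exact hne (channelNodes_disjoint (he h2) (ht₁.2 h1))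
    have := hull_mono X.pt this hz'
    simp [hull] at this

/-- A line of sight from inside the channel through the near end passes through every cut of the
gadget between the end edge and the vertex it leads to. -/
theorem exists_mem_cut (hX : X.IsConstruction) [Finite V] {d : G.Dart} {m : Bool} {M q : Plane}
    {x : Node G}
    (hgM : 0 < sideSign m * orient (X.pt (sideChain d m 0)) (X.pt (sideChain d (!m) 0)) M)
    (hlM : 0 ≤ sideSign m * orient (X.pt (sideChain d m 0)) (X.pt (sideChain d m 1)) M)
    (hq : q ∈ hull X.pt {leftEnd d, rightEnd d}) (hqM : q ∈ segment ℝ M (X.pt x))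
    (hMx : segment ℝ M (X.pt x) ⊆ X.region) (hwild : ¬ X.Tame d m x) (hx : x ∉ channelNodes d)
    {s : Set (Node G)} (hs : X.IsCut d x s) :
    ∃ z ∈ segment ℝ q (X.pt x), z ∈ hull X.pt s := by
  have hT := hX.no_overlap
  obtain ⟨K, hK, hKl, hKr, hxK, hcut⟩ := hs
  have hqx : segment ℝ q (X.pt x) ⊆ segment ℝ M (X.pt x) :=
    (convex_segment _ _).segment_subset hqM (right_mem_segment _ _ _)
  -- The part to be left consists of the channel and the piece `K` of the gadget in front of the
  -- cut.
  obtain ⟨t₁, ht₁, t₂, ht₂, ht₂', z, hz, hz'⟩ := hT.exists_exit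
    (K := {t | t ∈ X.T₁ ∧ t ⊆ K ∪ channelNodes d}) (fun t ht => ht.1)
    (t := {sideChain d true (Fin.castSucc 0), sideChain d true (Fin.succ 0),
      sideChain d (!true) (apexLeft true)})
    ⟨mem_T₁_apex d true 0, by
      rintro n (rfl | rfl | rfl) <;> exact Or.inr ⟨_, _, rfl⟩⟩
    (hull_mono _ (by
      rintro n (rfl | rfl)
      · exact Or.inr (Or.inr rfl)
      · exact Or.inl rfl) hq)
    (fun t ht hxt => (ht.2 hxt).elim hxK hx) (hqx.trans hMx)
  have hq' : q ∈ segment ℝ (X.pt (sideChain d m 0)) (X.pt (sideChain d (!m) 0)) := by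
    rwa [← hull_pair, pair_ends]
  unfold Tame at hwild
  push Not at hwild
  obtain ⟨b1, b2, b3⟩ := (hX.chan d m).mem_mouth hgM hlM hq' hqM hz hwild
  simp only [Function.comp] at b1 b2 b3
  rcases mem_T₁ ht₂ with ⟨w, hw⟩ | ⟨e, he⟩
  · have hw' : t₂ ⊆ gadgetNodes w := by
      rw [gadget_eq] at hw
      exact hX.gadget_subset_gadgetNodes (hw.imp_right Or.inl)
    by_cases hdw : d.fst = w
    · subst hdw
      rcases hcut t₂ hw with h | h
      · exact absurd ⟨ht₂, h.trans Set.subset_union_left⟩ ht₂'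
      · refine ⟨z, hz, hull_mono _ ?_ hz'⟩
        rintro n ⟨h1, h2⟩
        refine h ⟨h2, ?_⟩
        rcases ht₁.2 h1 with h1 | h1
        · exact h1
        · rcases mem_ends_of_mem (hw' h2) h1 with ⟨-, rfl | rfl⟩ | h
          · exact hKl
          · exact hKr
          · exact absurd h.1.symm d.fst_ne_snd
    -- An exit into the gadget at the far end is impossible: the far end edge is strictly inside the
    -- end line, whereas `z` is on or beyond it.
    · exfalso
      refine b3.not_gt (orient_pos_of_mem_hull ?_ hz')
      rintro n ⟨h1, h2⟩
      rcases ht₁.2 h1 with h1 | h1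
      · exact absurd (gadgetNodes_disjoint (hK h1) (hw' h2)) hdw
      · rcases mem_ends_of_mem (hw' h2) h1 with h | ⟨-, h⟩
        · exact absurd h.1 hdw
        · have h' : n = sideChain d m 6 ∨ n = sideChain d (!m) 6 := by
            have := pair_ends d.symm (!m)
            rw [sideChain_symm, sideChain_symm, Bool.not_not] at this
            change n ∈ ({leftEnd d.symm, rightEnd d.symm} : Set (Node G)) at h
            rw [← this] at h
            exact h
          rcases h' with rfl | rfl
          · exact (hX.chan d m).left_inside (by decide)
          · exact (hX.chan d m).right_inside (by decide)
  · have hne : e.edge ≠ d.edge := fun h =>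
      ht₂' ⟨ht₂, (he.trans (channelNodes_congr h).subset).trans Set.subset_union_right⟩
    have hmem : ∀ n ∈ t₁ ∩ t₂, n ∈ gadgetNodes d.fst ∧ n ∈ channelNodes e := by
      rintro n ⟨h1, h2⟩
      rcases ht₁.2 h1 with h1 | h1
      · exact ⟨hK h1, he h2⟩
      · exact absurd (channelNodes_disjoint (he h2) h1) hne
    -- An exit into another channel would be at its end edge, which is strictly outside the wide
    -- mouth, whereas `z` is in the closed wide mouth.
    have hcl : ∀ e' : G.Dart, e'.fst = d.fst → e' ≠ d → t₁ ∩ t₂ ⊆ {leftEnd e', rightEnd e'} →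
        False := by
      intro e' h1 h2 h3
      rcases outside_side (hX.clear h1 h2) m (hull_mono _ h3 hz') with h | h
      · exact b1.not_gt h
      · exact b2.not_gt h
    exfalso
    by_cases h1 : e.fst = d.fst
    · refine hcl e h1 (fun h => hne (by rw [h])) fun n hn => ?_
      rcases mem_ends_of_mem (hmem n hn).1 (hmem n hn).2 with h | h
      · exact h.2
      · exact absurd (h1.trans h.1.symm) e.fst_ne_snd
    · by_cases h2 : e.snd = d.fst
      · refine hcl e.symm h2 (fun h => hne (by rw [← h, e.edge_symm])) fun n hn => ?_
        rcases mem_ends_of_mem (hmem n hn).1 (hmem n hn).2 with h | h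
        · exact absurd h.1 h1
        · exact h.2
      · have : t₁ ∩ t₂ ⊆ ∅ := fun n hn => by
          rcases mem_ends_of_mem (hmem n hn).1 (hmem n hn).2 with h | h
          · exact h1 h.1
          · exact h2 h.1
        have := hull_mono X.pt this hz'
        simp [hull] at this

/-- A vertex that is seen through the near end and is not entirely outside the opposite chain is
the vertex of the gadget in the narrow mouth. -/
theorem eq_of_mem_mouth (hX : X.IsConstruction) [Finite V] {d : G.Dart} {m m' : Bool} {M q : Plane}
    {x P Q W : Node G} (hp : X.IsPort d m' P Q W)
    (hgM : 0 < sideSign m * orient (X.pt (sideChain d m 0)) (X.pt (sideChain d (!m) 0)) M)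
    (hlM : 0 ≤ sideSign m * orient (X.pt (sideChain d m 0)) (X.pt (sideChain d m 1)) M)
    (hq : q ∈ hull X.pt {leftEnd d, rightEnd d}) (hqM : q ∈ segment ℝ M (X.pt x))
    (hMx : segment ℝ M (X.pt x) ⊆ X.region) (hwild : ¬ X.Tame d m x) (hx : x ∉ channelNodes d) :
    x = W := by
  have hxg : x ∈ gadgetNodes d.fst := by
    by_contra hn
    obtain ⟨z, -, hz⟩ := hX.exists_mem_cut hgM hlM hq hqM hMx hwild hx (isCut_empty hX d hn)
    simp [hull] at hz
  have hout : ¬ ((X.LeftOfWide d x ∧ X.LeftOfWide d x) ∨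
      (X.RightOfWide d x ∧ X.RightOfWide d x)) := by
    intro h
    have hq' : q ∈ segment ℝ (X.pt (sideChain d m 0)) (X.pt (sideChain d (!m) 0)) := by
      rwa [← hull_pair, pair_ends]
    unfold Tame at hwild
    push Not at hwild
    obtain ⟨b1, b2, -⟩ := (hX.chan d m).mem_mouth hgM hlM hq' hqM (right_mem_segment _ _ _) hwild
    rcases outside_side h m (mem_hull X.pt (Or.inl rfl)) with h | h
    · exact b1.not_gt h
    · exact b2.not_gt h
  by_contra hxW
  have hin : ¬ IsInner d.fst x := by
    intro h
    rcases hp.outside hX h hxW with h | h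
    · exact hout (Or.inl ⟨h, h⟩)
    · exact hout (Or.inr ⟨h, h⟩)
  rcases hxg with h | h | h | h | ⟨e, he, h⟩
  · exact hin (Or.inl h)
  · exact hin (Or.inr (Or.inl h))
  · exact hin (Or.inr (Or.inr (Or.inl h)))
  · exact hin (Or.inr (Or.inr (Or.inr h)))
  · by_cases hed : e = d
    · subst hed
      rcases h with rfl | rfl
      · exact hx ⟨false, 0, rfl⟩
      · exact hx ⟨true, 0, rfl⟩
    · rcases hX.clear he hed with h' | h' <;> rcases h with rfl | rfl
      · exact hout (Or.inl ⟨h'.1, h'.1⟩)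
      · exact hout (Or.inl ⟨h'.2, h'.2⟩)
      · exact hout (Or.inr ⟨h'.1, h'.1⟩)
      · exact hout (Or.inr ⟨h'.2, h'.2⟩)

/-- If a chain edge sees a vertex that is not entirely outside the opposite chain through the near
end of the channel, then the three locking edges of the port there are absent. -/
theorem unlocked_of_mem_mouth (hX : X.IsConstruction) [Finite V] {T : Set (Set (Node G))}
    (hT : IsTriangulation X.pt X.region T) {d : G.Dart} {m m' : Bool} {i : Fin 6}
    {x P Q W : Node G} (ht : {sideChain d m i.castSucc, sideChain d m i.succ, x} ∈ T)
    (hs : sideSign m * orient (X.pt (sideChain d m i.castSucc)) (X.pt (sideChain d m i.succ))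
      (X.pt x) < 0) (hwild : ¬ X.Tame d m x) (hp : X.IsPort d m' P Q W) {q : Plane}
    (hq : q ∈ hull X.pt {leftEnd d, rightEnd d})
    (hqM : q ∈ segment ℝ (midpoint ℝ (X.pt (sideChain d m i.castSucc))
      (X.pt (sideChain d m i.succ))) (X.pt x)) :
    x = W ∧ ∀ t ∈ T, ¬ {C d.fst, E d.fst} ⊆ t ∧ ¬ {P, sideChain d (!m') 0} ⊆ t ∧ ¬ {P, Q} ⊆ t := by
  have hx := hX.notMem_of_not_tame hs hwild
  set l := sideChain d m i.castSucc with hl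
  set l' := sideChain d m i.succ with hl'
  set M := midpoint ℝ (X.pt l) (X.pt l') with hM
  have hMe : M = (1 / 2 : ℝ) • X.pt l + (1 / 2 : ℝ) • X.pt l' := by
    rw [hM, midpoint_eq_smul_add, smul_add]; norm_num
  have hhalf : (1 / 2 : ℝ) + 1 / 2 = 1 := by norm_num
  have hMh : M ∈ hull X.pt {l, l'} := by
    rw [hull_pair]; exact midpoint_mem_segment _ _
  have hMx' : segment ℝ M (X.pt x) ⊆ hull X.pt {l, l', x} :=
    segment_subset_hull X.pt (hull_mono _ (by rintro n (rfl | rfl) <;> simp) hMh)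
      (mem_hull X.pt (by simp))
  have hMx : segment ℝ M (X.pt x) ⊆ X.region := by
    refine hMx'.trans ?_
    rw [← hT.covers]
    exact Set.subset_biUnion_of_mem (u := fun t => hull X.pt t) ht
  have hgM : 0 < sideSign m * orient (X.pt (sideChain d m 0)) (X.pt (sideChain d (!m) 0)) M := by
    rw [hMe, orient_combo hhalf]
    have h2 := (hX.chan d m).left_inside (i := i.succ) (Fin.succ_pos i)
    have h1 : 0 ≤ sideSign m * orient (X.pt (sideChain d m 0)) (X.pt (sideChain d (!m) 0))
        (X.pt l) := by
      rcases (Fin.zero_le i.castSucc).eq_or_lt with h | h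
      · rw [hl, ← h]; simp
      · exact ((hX.chan d m).left_inside h).le
    simp only [Function.comp] at h2
    linarith
  have hlM : 0 ≤ sideSign m * orient (X.pt (sideChain d m 0)) (X.pt (sideChain d m 1)) M := by
    rw [hMe, orient_combo hhalf]
    have h1 := (hX.chan d m).left_nonneg 0 i.castSucc
    have h2 := (hX.chan d m).left_nonneg 0 i.succ
    simp only [Function.comp] at h1 h2
    change 0 ≤ sideSign m * orient (X.pt (sideChain d m 0)) (X.pt (sideChain d m 1)) _ at h1
    change 0 ≤ sideSign m * orient (X.pt (sideChain d m 0)) (X.pt (sideChain d m 1)) _ at h2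
    linarith
  obtain rfl := hX.eq_of_mem_mouth hp hgM hlM hq hqM hMx hwild hx
  obtain ⟨iP, iQ, iW, hPQ, hPW, hQW⟩ := hp.inner hX
  -- The line of sight meets the cut `uw` inside the visible triangle `l`, `l'`, `x`. If `uw` is an
  -- edge of `T`, then a meeting point in its interior makes both ends vertices of that triangle;
  -- otherwise the meeting point is an end, which is a vertex of the triangle on the line of sight.
  have key : ∀ u w : Node G, X.IsCut d x {u, w} → ∀ t ∈ T, {u, w} ⊆ t →
      ∃ n ∈ ({u, w} : Set (Node G)), n ∈ ({l, l', x} : Set (Node G)) ∧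
        ((∀ n ∈ ({u, w} : Set (Node G)), n ∈ ({l, l', x} : Set (Node G))) ∨
          X.pt n ∈ segment ℝ q (X.pt x)) := by
    intro u w hc t htT hut
    obtain ⟨z, hz, hzs⟩ := hX.exists_mem_cut hgM hlM hq hqM hMx hwild hx hc
    have hzt : z ∈ hull X.pt {l, l', x} :=
      hMx' ((convex_segment _ _).segment_subset hqM (right_mem_segment _ _ _) hz)
    rw [hull_pair] at hzs
    rw [← insert_endpoints_openSegment] at hzs
    rcases hzs with rfl | rfl | hzs
    · exact ⟨u, by simp, hT.mem_of_mem_hull ht hzt, Or.inr hz⟩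
    · exact ⟨w, by simp, hT.mem_of_mem_hull ht hzt, Or.inr hz⟩
    · obtain ⟨h1, h2⟩ := hT.mem_of_openSegment ht htT (hut (Or.inl rfl)) (hut (Or.inr rfl)) hzs hzt
      refine ⟨u, by simp, h1, Or.inl ?_⟩
      rintro n (rfl | rfl)
      · exact h1
      · exact h2
  have inner : ∀ n : Node G, IsInner d.fst n → n ∈ ({l, l', x} : Set (Node G)) → n = x := by
    rintro n hn (h | h | h)
    · exact absurd h (hn.ne_sideChain _ _ _)
    · exact absurd h (hn.ne_sideChain _ _ _)
    · exact h
  refine ⟨rfl, fun t htT => ⟨fun h => ?_, fun h => ?_, fun h => ?_⟩⟩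
  · obtain ⟨n, hn, hn', -⟩ := key _ _ (hp.isCut_lock hX) t htT h
    have hCx : (C d.fst : Node G) ≠ x := by cases hp <;> simp
    have hEx : (E d.fst : Node G) ≠ x := by cases hp <;> simp
    rcases hn with rfl | rfl
    · exact hCx (inner _ (Or.inl rfl) hn')
    · exact hEx (inner _ (Or.inr (Or.inr (Or.inl rfl))) hn')
  · obtain ⟨n, hn, hn', h'⟩ := key _ _ (hp.isCut_fst hX) t htT h
    rcases h' with h' | h'
    · exact hPW (inner _ iP (h' _ (Or.inl rfl)))
    rcases hn with rfl | rfl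
    · exact hPW (inner _ iP hn')
    have hg0 : sideSign m * orient (X.pt (sideChain d m 0)) (X.pt (sideChain d (!m) 0))
        (X.pt (sideChain d (!m') 0)) = 0 := by
      cases m <;> cases m' <;> simp
    -- The remaining case is the cut `PA` met at `A`, where `A` is an end of the chain edge itself.
    -- Then `A` is on the line `ll'`, which the line of sight meets only in `M`, but `M` is strictly
    -- inside the end line.
    have ho : orient (X.pt l) (X.pt l') (X.pt (sideChain d (!m') 0)) = 0 := by
      have hmm : m' = !m ∧ i = 0 := by
        have hm : m' = !m := by
          by_contra hne
          obtain rfl : m' = m := by cases m <;> cases m' <;> simp_all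
          rcases hn' with h | h | h
          · exact sideChain_ne _ _ _ _ h.symm
          · exact sideChain_ne _ _ _ _ h.symm
          · exact iW.ne_sideChain _ _ _ h.symm
        refine ⟨hm, ?_⟩
        rw [hm, Bool.not_not] at hn'
        rcases hn' with h | h | h
        · exact (Fin.castSucc_eq_zero_iff.1 (sideChain_injective _ _ h).symm)
        · exact absurd (sideChain_injective _ _ h).symm (Fin.succ_ne_zero i)
        · exact absurd h.symm (iW.ne_sideChain _ _ _)
      obtain ⟨rfl, rfl⟩ := hmm
      rw [hl, Bool.not_not]
      simp
    have hseg := (convex_segment (𝕜 := ℝ) _ _).segment_subset hqM (right_mem_segment _ _ _) h'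
    obtain ⟨a, b, ha, hb, hab, e⟩ := hseg
    rw [← e, orient_combo hab, hMe, orient_combo hhalf, orient_self_outer, orient_self_right] at ho
    have hb0 : b = 0 := by
      rcases mul_eq_zero.1 (show b * orient (X.pt l) (X.pt l') (X.pt x) = 0 by linarith) with h | h
      · exact h
      · exact absurd h (hT.orient_ne_zero ht)
    obtain rfl : a = 1 := by linarith
    rw [hb0, one_smul, zero_smul, add_zero] at e
    rw [← e] at hg0
    exact hgM.ne' hg0
  · obtain ⟨n, hn, hn', -⟩ := key _ _ (hp.isCut_snd hX) t htT h
    rcases hn with rfl | rfl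
    · exact hPW (inner _ iP hn')
    · exact hQW (inner _ iQ hn')

/-- If a chain edge sees a vertex that is not entirely outside the opposite chain, then the locking
edges of a port of the channel are absent. -/
theorem unlocked_of_not_tame (hX : X.IsConstruction) [Finite V] {T : Set (Set (Node G))}
    (hT : IsTriangulation X.pt X.region T) {d : G.Dart} {m : Bool} {i : Fin 6}
    {x : Node G} (ht : {sideChain d m i.castSucc, sideChain d m i.succ, x} ∈ T)
    (hs : sideSign m * orient (X.pt (sideChain d m i.castSucc)) (X.pt (sideChain d m i.succ))
      (X.pt x) < 0) (hwild : ¬ X.Tame d m x) :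
    ∃ e : G.Dart, e.edge = d.edge ∧ ∀ m' P Q W, X.IsPort e m' P Q W → ∀ t ∈ T,
      ¬ {C e.fst, E e.fst} ⊆ t ∧ ¬ {P, sideChain e (!m') 0} ⊆ t ∧ ¬ {P, Q} ⊆ t := by
  have hx := hX.notMem_of_not_tame hs hwild
  have hMh : midpoint ℝ (X.pt (sideChain d m i.castSucc)) (X.pt (sideChain d m i.succ)) ∈
      hull X.pt {sideChain d m i.castSucc, sideChain d m i.succ} := by
    rw [hull_pair]; exact midpoint_mem_segment _ _
  obtain ⟨q, hqM, hq | hq⟩ := hX.exists_mem_end hMh hx (by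
    refine (segment_subset_hull X.pt (hull_mono _ (t := {sideChain d m i.castSucc,
      sideChain d m i.succ, x}) (by rintro n (rfl | rfl) <;> simp) hMh)
      (mem_hull X.pt (by simp))).trans ?_
    rw [← hT.covers]
    exact Set.subset_biUnion_of_mem (u := fun t => hull X.pt t) ht)
  · exact ⟨d, rfl, fun m' P Q W hp => (hX.unlocked_of_mem_mouth hT ht hs hwild hp hq hqM).2⟩
  -- An exit through the far end is an exit through the near end of the reversed channel, whose
  -- chains are exchanged and listed backwards.
  · refine ⟨d.symm, d.edge_symm, fun m' P Q W hp =>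
      (hX.unlocked_of_mem_mouth hT (m := !m) (i := i.rev) (x := x) ?_ ?_ (mt tame_symm hwild) hp hq
        ?_).2⟩
    · rw [sideChain_symm, sideChain_symm, Bool.not_not, Fin.rev_castSucc, Fin.rev_succ, Fin.rev_rev,
        triple_perm_left]
      exact ht
    · rw [sideChain_symm, sideChain_symm, Bool.not_not, Fin.rev_castSucc, Fin.rev_succ, Fin.rev_rev,
        orient_swap, sideSign_not]
      linarith
    · rw [sideChain_symm, sideChain_symm, Bool.not_not, Fin.rev_castSucc, Fin.rev_succ, Fin.rev_rev,
        midpoint_comm]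
      exact hqM

end IsConstruction

end Layout

/-! ### Edges along flip sequences -/

/-- The points of a quadrilateral with crossing diagonals `ab` and `cd` lie in `abc` or `abd`. -/
theorem combo_mem_union {a b c d : Plane}
    (h : (openSegment ℝ a b ∩ openSegment ℝ c d).Nonempty) {α β γ δ : ℝ} (hα : 0 ≤ α) (hβ : 0 ≤ β)
    (hγ : 0 ≤ γ) (hδ : 0 ≤ δ) (h1 : α + β + γ + δ = 1) :
    α • a + β • b + γ • c + δ • d ∈ convexHull ℝ {a, b, c} ∪ convexHull ℝ {a, b, d} := by
  obtain ⟨z, ⟨s, t, hs, ht, hst, rfl⟩, u, v, hu, hv, huv, e⟩ := h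
  rcases le_total (δ * u) (γ * v) with hc | hc
  · left
    rw [mem_convexHull_triple]
    refine ⟨α + δ / v * s, β + δ / v * t, γ - δ / v * u, by positivity, by positivity, ?_, ?_, ?_⟩
    · rw [sub_nonneg, div_mul_eq_mul_div, div_le_iff₀ hv]; exact hc
    · have : δ / v * v = δ := by field_simp
      linear_combination h1 + δ / v * hst - δ / v * huv + this
    · have e' : d = (1 / v) • (s • a + t • b - u • c) := by
        rw [← e]; simp [smul_smul, hv.ne']
      rw [e']
      ext <;> simp only [Prod.fst_add, Prod.snd_add, Prod.smul_fst, Prod.smul_snd, Prod.fst_sub,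
        Prod.snd_sub, smul_eq_mul] <;> ring
  · right
    rw [mem_convexHull_triple]
    refine ⟨α + γ / u * s, β + γ / u * t, δ - γ / u * v, by positivity, by positivity, ?_, ?_, ?_⟩
    · rw [sub_nonneg, div_mul_eq_mul_div, div_le_iff₀ hu]; exact hc
    · have : γ / u * u = γ := by field_simp
      linear_combination h1 + γ / u * hst - γ / u * huv + this
    · have e' : c = (1 / u) • (s • a + t • b - v • d) := by
        rw [← e]; simp [smul_smul, hu.ne']
      rw [e']
      ext <;> simp only [Prod.fst_add, Prod.snd_add, Prod.smul_fst, Prod.smul_snd, Prod.fst_sub,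
        Prod.snd_sub, smul_eq_mul] <;> ring

/-- A flip between two triangulations that replaces the diagonal `ab` by `cd`. -/
structure FlipAt {N : Type*} (pt : N → Plane) (R : Set Plane) (T T' : Set (Set N)) (a b c d : N) :
    Prop where
  source : IsTriangulation pt R T
  target : IsTriangulation pt R T'
  left_mem : {a, b, c} ∈ T
  right_mem : {a, b, d} ∈ T
  crossing : (openSegment ℝ (pt a) (pt b) ∩ openSegment ℝ (pt c) (pt d)).Nonempty
  eq : T' = (T \ {{a, b, c}, {a, b, d}}) ∪ {{a, c, d}, {b, c, d}}

namespace FlipAt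

variable {N : Type*} {pt : N → Plane} {R : Set Plane} {T T' : Set (Set N)} {a b c d : N}

theorem swap_left (h : FlipAt pt R T T' a b c d) : FlipAt pt R T T' b a c d where
  source := h.source
  target := h.target
  left_mem := by rw [triple_perm_left]; exact h.left_mem
  right_mem := by rw [triple_perm_left]; exact h.right_mem
  crossing := by rw [openSegment_symm ℝ (pt b)]; exact h.crossing
  eq := by
    rw [triple_perm_left a b, triple_perm_left a b, Set.pair_comm ({b, c, d} : Set N)]; exact h.eq

theorem swap_right (h : FlipAt pt R T T' a b c d) : FlipAt pt R T T' a b d c where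
  source := h.source
  target := h.target
  left_mem := h.right_mem
  right_mem := h.left_mem
  crossing := by rw [openSegment_symm ℝ (pt d)]; exact h.crossing
  eq := by
    rw [triple_perm_right a c d, triple_perm_right b c d, Set.pair_comm ({a, b, d} : Set N)]; exact h.eq

theorem acd_mem (h : FlipAt pt R T T' a b c d) : {a, c, d} ∈ T' := by
  rw [h.eq]; simp

theorem bcd_mem (h : FlipAt pt R T T' a b c d) : {b, c, d} ∈ T' := by
  rw [h.eq]; simp

theorem distinct (h : FlipAt pt R T T' a b c d) :
    a ≠ b ∧ a ≠ c ∧ a ≠ d ∧ b ≠ c ∧ b ≠ d ∧ c ≠ d := by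
  obtain ⟨h1, h2, h3⟩ := h.source.distinct h.left_mem
  obtain ⟨-, h4, h5⟩ := h.source.distinct h.right_mem
  obtain ⟨-, -, h6⟩ := h.target.distinct h.acd_mem
  exact ⟨h1, h2, h4, h3, h5, h6⟩

theorem not_pair_subset (h : FlipAt pt R T T' a b c d) {t : Set N} (ht : t ∈ T) :
    ¬ {c, d} ⊆ t := by
  intro hcd
  obtain ⟨h1, h2, h3, h4, h5, h6⟩ := h.distinct
  have := h.source.edges_noncrossing h.left_mem ht (Or.inl rfl) (Or.inr (Or.inl rfl)) h1
    (hcd (Or.inl rfl)) (hcd (Or.inr rfl)) h6 h.crossing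
  rcases this.subset (Or.inl rfl) with h | h
  · exact h2 h
  · exact h3 h

/-- An edge in the target that is not an edge of the source is the new diagonal. -/
theorem eq_new (h : FlipAt pt R T T' a b c d) {p q : N} (hpq : p ≠ q) {t : Set N} (ht : t ∈ T')
    (hp : p ∈ t) (hq : q ∈ t) (hT : ∀ t ∈ T, ¬ {p, q} ⊆ t) : ({p, q} : Set N) = {c, d} := by
  rw [h.eq] at ht
  rcases ht with ht | rfl | rfl
  · exact absurd (Set.pair_subset hp hq) (hT _ ht.1)
  · rcases hp with rfl | rfl | rfl <;> rcases hq with rfl | rfl | rfl <;>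
      first
        | rfl
        | exact Set.pair_comm _ _
        | exact absurd rfl hpq
        | (refine absurd (Set.pair_subset ?_ ?_) (hT _ h.left_mem) <;> simp; done)
        | (refine absurd (Set.pair_subset ?_ ?_) (hT _ h.right_mem) <;> simp; done)
  · rcases hp with rfl | rfl | rfl <;> rcases hq with rfl | rfl | rfl <;>
      first
        | rfl
        | exact Set.pair_comm _ _
        | exact absurd rfl hpq
        | (refine absurd (Set.pair_subset ?_ ?_) (hT _ h.left_mem) <;> simp; done)
        | (refine absurd (Set.pair_subset ?_ ?_) (hT _ h.right_mem) <;> simp; done)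

/-- An edge of the source that is not an edge of the target is the old diagonal. -/
theorem eq_old (h : FlipAt pt R T T' a b c d) {p q : N} (hpq : p ≠ q) {t : Set N} (ht : t ∈ T)
    (hp : p ∈ t) (hq : q ∈ t) (hT : ∀ t ∈ T', ¬ {p, q} ⊆ t) : ({p, q} : Set N) = {a, b} := by
  by_cases htT : t ∈ T'
  · exact absurd (Set.pair_subset hp hq) (hT _ htT)
  have : t = {a, b, c} ∨ t = {a, b, d} := by
    by_contra hn
    exact htT (by rw [h.eq]; exact Or.inl ⟨ht, hn⟩)
  rcases this with rfl | rfl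
  · rcases hp with rfl | rfl | rfl <;> rcases hq with rfl | rfl | rfl <;>
      first
        | rfl
        | exact Set.pair_comm _ _
        | exact absurd rfl hpq
        | (refine absurd (Set.pair_subset ?_ ?_) (hT _ h.acd_mem) <;> simp; done)
        | (refine absurd (Set.pair_subset ?_ ?_) (hT _ h.bcd_mem) <;> simp; done)
  · rcases hp with rfl | rfl | rfl <;> rcases hq with rfl | rfl | rfl <;>
      first
        | rfl
        | exact Set.pair_comm _ _
        | exact absurd rfl hpq
        | (refine absurd (Set.pair_subset ?_ ?_) (hT _ h.acd_mem) <;> simp; done)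
        | (refine absurd (Set.pair_subset ?_ ?_) (hT _ h.bcd_mem) <;> simp; done)

/-- The crossing point is strictly between `a` and `b`, and strictly between `c` and `d`. Hence `b`
and `d` are both on its side of the line `ac`. -/
theorem same_side (h : FlipAt pt R T T' a b c d) :
    0 < orient (pt a) (pt c) (pt b) * orient (pt a) (pt c) (pt d) := by
  obtain ⟨z, ⟨s, t, hs, ht, hst, rfl⟩, u, v, hu, hv, huv, e⟩ := h.crossing
  have h1 : orient (pt a) (pt c) (s • pt a + t • pt b) = t * orient (pt a) (pt c) (pt b) := by
    rw [orient_combo hst]; simp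
  rw [← e, orient_combo huv, orient_self_right, mul_zero, zero_add] at h1
  have h2 : orient (pt a) (pt c) (pt b) ≠ 0 := by
    refine h.source.orient_ne_zero ?_
    rw [triple_perm_right]; exact h.left_mem
  have h3 : 0 < orient (pt a) (pt c) (pt b) ^ 2 := by positivity
  have h4 : v * (orient (pt a) (pt c) (pt b) * orient (pt a) (pt c) (pt d)) =
      t * orient (pt a) (pt c) (pt b) ^ 2 := by linear_combination orient (pt a) (pt c) (pt b) * h1
  have h5 := mul_pos ht h3
  rw [← h4] at h5
  exact (mul_pos_iff_of_pos_left hv).1 h5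

theorem apex_side (h : FlipAt pt R T T' a b c d) (hx : ∀ y, {a, c, y} ∈ T ↔ y = b) (y : N) :
    {a, c, y} ∈ T' ↔ y = d := by
  obtain ⟨h1, h2, h3, h4, h5, h6⟩ := h.distinct
  constructor
  · intro hy
    have hd := (h.target.distinct hy).2
    rw [h.eq] at hy
    rcases hy with hy | hy | hy
    · exfalso
      apply hy.2
      rw [(hx y).1 hy.1, triple_perm_right]
      exact Or.inl rfl
    · rcases hy.subset (show y ∈ ({a, c, y} : Set N) by simp) with e | e | e
      · exact absurd e.symm hd.1
      · exact absurd e.symm hd.2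
      · exact e
    · exfalso
      rcases hy.subset (show a ∈ ({a, c, y} : Set N) by simp) with e | e | e
      · exact h1 e
      · exact h2 e
      · exact h3 e
  · rintro rfl
    exact h.acd_mem

/-- A flip changes the only triangle at a boundary edge `pq` by replacing its apex `x` by the
fourth vertex of the quadrilateral, or not at all. -/
theorem apex (h : FlipAt pt R T T' a b c d) {p q x : N} (hx : ∀ y, {p, q, y} ∈ T ↔ y = x) :
    (∀ y, {p, q, y} ∈ T' ↔ y = x) ∨ ∃ x', (∀ y, {p, q, y} ∈ T' ↔ y = x') ∧
      ({a, b, c, d} : Set N) = {p, q, x, x'} ∧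
        0 < orient (pt p) (pt q) (pt x) * orient (pt p) (pt q) (pt x') := by
  have hxT := (hx x).2 rfl
  have hpq := (h.source.distinct hxT).1
  -- Either `pq` is a side of the quadrilateral, and up to relabelling it is the side `ac`, or the
  -- triangle at `pq` is not touched.
  by_cases hside : ∃ r s u v, FlipAt pt R T T' r s u v ∧ ({r, s, u, v} : Set N) = {a, b, c, d} ∧
      ((p = r ∧ q = u) ∨ (p = u ∧ q = r))
  · right
    obtain ⟨r, s, u, v, hf, hq, ⟨rfl, rfl⟩ | ⟨rfl, rfl⟩⟩ := hside
    · have e : s = x := (hx s).1 (by rw [triple_perm_right]; exact hf.left_mem)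
      subst e
      refine ⟨v, hf.apex_side hx, ?_, hf.same_side⟩
      rw [← hq, Set.insert_comm s]
    · have e : s = x := (hx s).1 (by rw [← triple_rotate]; exact hf.left_mem)
      subst e
      refine ⟨v, fun y => ?_, ?_, ?_⟩
      · rw [triple_perm_left]
        exact hf.apex_side (fun y => by rw [triple_perm_left]; exact hx y) y
      · rw [← hq]
        ext n
        simp only [Set.mem_insert_iff, Set.mem_singleton_iff]
        exact Iff.of_eq (by ac_rfl)
      · rw [orient_swap, orient_swap (pt q) (pt p) (pt v), neg_mul_neg]
        exact hf.same_side
  · left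
    have e1 : ({b, a, c, d} : Set N) = {a, b, c, d} := Set.insert_comm _ _ _
    have e2 : ({a, b, d, c} : Set N) = {a, b, c, d} := by rw [Set.pair_comm d c]
    have e3 : ({b, a, d, c} : Set N) = {a, b, c, d} := by rw [Set.pair_comm d c, e1]
    have hn : ∀ r ∈ ({a, b} : Set N), ∀ u ∈ ({c, d} : Set N),
        ¬ ((p = r ∧ q = u) ∨ (p = u ∧ q = r)) := by
      rintro r (rfl | rfl) u (rfl | rfl) hpq
      · exact hside ⟨_, _, _, _, h, rfl, hpq⟩
      · exact hside ⟨_, _, _, _, h.swap_right, e2, hpq⟩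
      · exact hside ⟨_, _, _, _, h.swap_left, e1, hpq⟩
      · exact hside ⟨_, _, _, _, h.swap_left.swap_right, e3, hpq⟩
    have hcd : ¬ {c, d} ⊆ ({p, q, x} : Set N) := h.not_pair_subset hxT
    -- At the old diagonal there are two triangles with different apexes, against the uniqueness in
    -- `hx`.
    have hab : ¬ ((p = a ∧ q = b) ∨ (p = b ∧ q = a)) := by
      intro hab
      have h6 := h.distinct.2.2.2.2.2
      rcases hab with ⟨rfl, rfl⟩ | ⟨rfl, rfl⟩
      · exact h6 (((hx c).1 h.left_mem).trans ((hx d).1 h.right_mem).symm)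
      · refine h6 (((hx c).1 ?_).trans ((hx d).1 ?_).symm)
        · rw [triple_perm_left]; exact h.left_mem
        · rw [triple_perm_left]; exact h.right_mem
    have hcd' : ¬ ((p = c ∧ q = d) ∨ (p = d ∧ q = c)) := by
      rintro (⟨rfl, rfl⟩ | ⟨rfl, rfl⟩)
      · exact hcd (by rintro n (rfl | rfl) <;> simp)
      · exact hcd (by rintro n (rfl | rfl) <;> simp)
    have hno : ∀ y, ∀ t : Set N, t ⊆ {a, b, c, d} → ({p, q, y} : Set N) ≠ t := by
      rintro y t ht rfl
      have hp : p ∈ ({a, b, c, d} : Set N) := ht (by simp)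
      have hq : q ∈ ({a, b, c, d} : Set N) := ht (by simp)
      rcases hp with hp | hp | hp | hp <;> rcases hq with hq | hq | hq | hq <;>
        first
          | exact hpq (hp.trans hq.symm)
          | exact hab (Or.inl ⟨hp, hq⟩)
          | exact hab (Or.inr ⟨hp, hq⟩)
          | exact hcd' (Or.inl ⟨hp, hq⟩)
          | exact hcd' (Or.inr ⟨hp, hq⟩)
          | exact hn a (Or.inl rfl) c (Or.inl rfl) (Or.inl ⟨hp, hq⟩)
          | exact hn a (Or.inl rfl) c (Or.inl rfl) (Or.inr ⟨hp, hq⟩)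
          | exact hn a (Or.inl rfl) d (Or.inr rfl) (Or.inl ⟨hp, hq⟩)
          | exact hn a (Or.inl rfl) d (Or.inr rfl) (Or.inr ⟨hp, hq⟩)
          | exact hn b (Or.inr rfl) c (Or.inl rfl) (Or.inl ⟨hp, hq⟩)
          | exact hn b (Or.inr rfl) c (Or.inl rfl) (Or.inr ⟨hp, hq⟩)
          | exact hn b (Or.inr rfl) d (Or.inr rfl) (Or.inl ⟨hp, hq⟩)
          | exact hn b (Or.inr rfl) d (Or.inr rfl) (Or.inr ⟨hp, hq⟩)
    have habc : ({a, b, c} : Set N) ⊆ {a, b, c, d} := by rintro n (rfl | rfl | rfl) <;> simp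
    have habd : ({a, b, d} : Set N) ⊆ {a, b, c, d} := by rintro n (rfl | rfl | rfl) <;> simp
    have hacd : ({a, c, d} : Set N) ⊆ {a, b, c, d} := by rintro n (rfl | rfl | rfl) <;> simp
    have hbcd : ({b, c, d} : Set N) ⊆ {a, b, c, d} := by rintro n (rfl | rfl | rfl) <;> simp
    intro y
    rw [h.eq, ← hx y]
    constructor
    · rintro (hy | hy | hy)
      · exact hy.1
      · exact absurd hy (hno y _ hacd)
      · exact absurd hy (hno y _ hbcd)
    · intro hy
      refine Or.inl ⟨hy, ?_⟩
      rintro (hy | hy)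
      · exact absurd hy (hno y _ habc)
      · exact absurd hy (hno y _ habd)

end FlipAt

theorem exists_last_true {P : ℕ → Prop} {n : ℕ} (h0 : P 0) (hn : ¬ P n) :
    ∃ i < n, P i ∧ ¬ P (i + 1) := by
  by_contra h
  push Not at h
  have : ∀ i ≤ n, P i := by
    intro i hi
    induction i with
    | zero => exact h0
    | succ i ih => exact h i hi (ih (Nat.le_of_succ_le hi))
  exact hn (this n le_rfl)

theorem exists_change {P : ℕ → Prop} {k n : ℕ} (hkn : k ≤ n) (hk : P k) (hn : ¬ P n) :
    ∃ i, k ≤ i ∧ i < n ∧ P i ∧ ¬ P (i + 1) := by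
  obtain ⟨j, rfl⟩ := Nat.exists_eq_add_of_le hkn
  obtain ⟨i, hi, h1, h2⟩ := exists_last_true (P := fun i => P (k + i)) (n := j) hk hn
  exact ⟨k + i, by omega, by omega, h1, h2⟩

/-- A sequence of `n` flips through triangulations. -/
structure FlipSeq {N : Type*} (pt : N → Plane) (R : Set Plane) (n : ℕ) where
  T : ℕ → Set (Set N)
  a : ℕ → N
  b : ℕ → N
  c : ℕ → N
  d : ℕ → N
  flipAt : ∀ i < n, FlipAt pt R (T i) (T (i + 1)) (a i) (b i) (c i) (d i)

namespace FlipSeq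

variable {N : Type*} {pt : N → Plane} {R : Set Plane} {n : ℕ}

/-- `Nonempty` supplies dummy labels after the last flip, where the sequences are defined but carry
no information. -/
theorem exists_of_isFlip [Nonempty N] {S : ℕ → Set (Set N)}
    (hS : ∀ i ≤ n, IsTriangulation pt R (S i)) (hf : ∀ i < n, IsFlip pt (S i) (S (i + 1))) :
    ∃ F : FlipSeq pt R n, F.T = S := by
  have : ∀ i, ∃ a b c d, i < n → FlipAt pt R (S i) (S (i + 1)) a b c d := by
    intro i
    by_cases hi : i < n
    · obtain ⟨a, b, c, d, h1, h2, h3, h4⟩ := hf i hi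
      exact ⟨a, b, c, d, fun _ => ⟨hS i hi.le, hS (i + 1) hi, h1, h2, h3, h4⟩⟩
    · obtain ⟨a⟩ := ‹Nonempty N›
      exact ⟨a, a, a, a, fun h => absurd h hi⟩
  choose a b c d h using this
  exact ⟨⟨S, a, b, c, d, h⟩, rfl⟩

variable (F : FlipSeq pt R n)

/-- The vertices of the quadrilateral of the flip number `i`. -/
def quad (i : ℕ) : Set N := {F.a i, F.b i, F.c i, F.d i}

theorem quad_subset_of_mem (i : ℕ) : ({F.a i, F.b i, F.c i} : Set N) ⊆ F.quad i ∧
    ({F.a i, F.b i, F.d i} : Set N) ⊆ F.quad i := by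
  constructor <;> rintro n (rfl | rfl | rfl) <;> simp [quad]

/-- Uniqueness of the triangle at `pq` is inherited from one triangulation to the next by
`FlipAt.apex`, so only the initial triangulation has to be inspected. Each change of apex keeps the
side of the line `pq`. -/
theorem exists_apex {p q x₀ : N} (hne : orient (pt p) (pt q) (pt x₀) ≠ 0)
    (h0 : ∀ y, {p, q, y} ∈ F.T 0 ↔ y = x₀) :
    ∃ x : ℕ → N, x 0 = x₀ ∧ (∀ i ≤ n, ∀ y, {p, q, y} ∈ F.T i ↔ y = x i) ∧
      (∀ i < n, x (i + 1) ≠ x i → F.quad i = {p, q, x i, x (i + 1)}) ∧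
      ∀ i ≤ n, 0 < orient (pt p) (pt q) (pt x₀) * orient (pt p) (pt q) (pt (x i)) := by
  have hex : ∀ i, ∃ x, i ≤ n → ∀ y, {p, q, y} ∈ F.T i ↔ y = x := by
    intro i
    induction i with
    | zero => exact ⟨x₀, fun _ => h0⟩
    | succ i ih =>
      obtain ⟨x, hx⟩ := ih
      by_cases hi : i < n
      · rcases (F.flipAt i hi).apex (hx hi.le) with h | ⟨x', h, -⟩
        · exact ⟨x, fun _ => h⟩
        · exact ⟨x', fun _ => h⟩
      · exact ⟨x, fun h => absurd h hi⟩
  choose x hx using hex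
  have hx0 : x 0 = x₀ := ((h0 _).1 ((hx 0 (Nat.zero_le _) _).2 rfl))
  have hstep : ∀ i < n, x (i + 1) = x i ∨ (F.quad i = {p, q, x i, x (i + 1)} ∧
      0 < orient (pt p) (pt q) (pt (x i)) * orient (pt p) (pt q) (pt (x (i + 1)))) := by
    intro i hi
    have hxi := (hx (i + 1) hi (x (i + 1))).2 rfl
    rcases (F.flipAt i hi).apex (hx i hi.le) with h | ⟨x', h, h1, h2⟩
    · exact Or.inl ((h _).1 hxi)
    · obtain rfl := (h _).1 hxi
      exact Or.inr ⟨h1, h2⟩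
  refine ⟨x, hx0, hx, fun i hi hne => ((hstep i hi).resolve_left hne).1, fun i hi => ?_⟩
  induction i with
  | zero => rw [hx0, ← sq]; positivity
  | succ i ih =>
    rcases hstep i hi with h | ⟨-, h⟩
    · rw [h]; exact ih (Nat.le_of_succ_le hi)
    · have h1 := ih (Nat.le_of_succ_le hi)
      have h2 := mul_pos h1 h
      by_contra hn
      push Not at hn
      nlinarith [mul_nonneg (sq_nonneg (orient (pt p) (pt q) (pt (x i)))) (neg_nonneg.2 hn)]

/-- The flips that remove or insert the edge `g`. -/
noncomputable def flipsOf (g : Set N) : Finset ℕ :=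
  open Classical in (Finset.range n).filter fun i => g = {F.a i, F.b i} ∨ g = {F.c i, F.d i}

theorem mem_flipsOf {g : Set N} {i : ℕ} :
    i ∈ F.flipsOf g ↔ i < n ∧ (g = {F.a i, F.b i} ∨ g = {F.c i, F.d i}) := by
  simp [flipsOf]

/-- An edge of the first and the last triangulation that is not always present is removed and
inserted. -/
theorem two_le_card_flipsOf {p q : N} (hpq : p ≠ q) (h0 : ∃ t ∈ F.T 0, {p, q} ⊆ t)
    (hn : ∃ t ∈ F.T n, {p, q} ⊆ t) {k : ℕ} (hkn : k ≤ n) (hk : ∀ t ∈ F.T k, ¬ {p, q} ⊆ t) :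
    2 ≤ (F.flipsOf {p, q}).card := by
  have hk' : ¬ ∃ t ∈ F.T k, {p, q} ⊆ t := by push Not; exact hk
  obtain ⟨i, hi, ⟨t, ht, hpt⟩, h2⟩ := exists_last_true (P := fun i => ∃ t ∈ F.T i, {p, q} ⊆ t) h0 hk'
  obtain ⟨j, hkj, hj, h3, h4⟩ :=
    exists_change (P := fun i => ¬ ∃ t ∈ F.T i, {p, q} ⊆ t) hkn hk' (not_not.2 hn)
  push Not at h2 h3 h4
  obtain ⟨t', ht', hpt'⟩ := h4
  have hi' : i ∈ F.flipsOf {p, q} := F.mem_flipsOf.2 ⟨hi.trans_le hkn,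
    Or.inl ((F.flipAt i (hi.trans_le hkn)).eq_old hpq ht (hpt (Or.inl rfl)) (hpt (Or.inr rfl)) h2)⟩
  have hj' : j ∈ F.flipsOf {p, q} := F.mem_flipsOf.2 ⟨hj,
    Or.inr ((F.flipAt j hj).eq_new hpq ht' (hpt' (Or.inl rfl)) (hpt' (Or.inr rfl)) h3)⟩
  exact Finset.one_lt_card.2 ⟨i, hi', j, hj', by omega⟩

/-- A flip concerns at most one edge of a triangulation. -/
theorem eq_of_mem_flipsOf {T₀ : Set (Set N)} (hT : IsTriangulation pt R T₀) {p q p' q' : N}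
    (h : ∃ t ∈ T₀, {p, q} ⊆ t) (h' : ∃ t ∈ T₀, {p', q'} ⊆ t) {i : ℕ}
    (hi : i ∈ F.flipsOf {p, q}) (hi' : i ∈ F.flipsOf {p', q'}) :
    ({p, q} : Set N) = {p', q'} := by
  rw [mem_flipsOf] at hi hi'
  obtain ⟨t, ht, hpt⟩ := h
  obtain ⟨t', ht', hpt'⟩ := h'
  obtain ⟨h1, h2, h3, h4, h5, h6⟩ := (F.flipAt i hi.1).distinct
  -- If a flip removed one of the two edges and inserted the other, they would cross, although both
  -- are edges of `T₀`.
  have key : ∀ {t t' : Set N}, t ∈ T₀ → t' ∈ T₀ → {F.a i, F.b i} ⊆ t → {F.c i, F.d i} ⊆ t' →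
      ({F.a i, F.b i} : Set N) = {F.c i, F.d i} := fun ht ht' hs hs' =>
    hT.edges_noncrossing ht ht' (hs (Or.inl rfl)) (hs (Or.inr rfl)) h1 (hs' (Or.inl rfl))
      (hs' (Or.inr rfl)) h6 (F.flipAt i hi.1).crossing
  rcases hi.2 with e | e <;> rcases hi'.2 with e' | e' <;> rw [e] at hpt <;> rw [e'] at hpt' <;>
    rw [e, e']
  · exact key ht ht' hpt hpt'
  · exact (key ht' ht hpt' hpt).symm

theorem ncard_quad_le (i : ℕ) : (F.quad i).ncard ≤ 4 := by
  refine (Set.ncard_insert_le _ _).trans ?_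
  have := Set.ncard_insert_le (F.b i) {F.c i, F.d i}
  have := Set.ncard_insert_le (F.c i) {F.d i}
  have := Set.ncard_singleton (F.d i)
  omega

end FlipSeq

/-! ### Flips in a channel -/

theorem FlipAt.hull_quad_subset {N : Type*} {pt : N → Plane} {R : Set Plane} {T T' : Set (Set N)}
    {a b c d : N} (h : FlipAt pt R T T' a b c d) :
    hull pt {a, b, c, d} ⊆ hull pt {a, b, c} ∪ hull pt {a, b, d} := by
  intro z hz
  rw [hull, Set.image_insert_eq, convexHull_insert (by simp), mem_convexJoin] at hz
  obtain ⟨_, rfl, y, hy, u, v, hu, hv, huv, rfl⟩ := hz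
  rw [Set.image_insert_eq, Set.image_pair, mem_convexHull_triple] at hy
  obtain ⟨β, γ, δ, hβ, hγ, hδ, h1, rfl⟩ := hy
  rw [hull_triple, hull_triple]
  have := combo_mem_union h.crossing hu (mul_nonneg hv hβ) (mul_nonneg hv hγ) (mul_nonneg hv hδ)
    (by linear_combination huv + v * h1)
  convert this using 1
  rw [smul_add, smul_add, smul_smul, smul_smul, smul_smul]
  abel

/-- If the line from `M` to `M'` separates `u` from `w`, and `M'` is on a line that separates `M`
from `u` and `w`, then `M'` is in the triangle. -/
theorem mem_triangle_of_separated {s s' : ℝ} {M M' u w p q : Plane} (hu : 0 < s * orient M M' u)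
    (hw : s * orient M M' w ≤ 0) (hM : 0 < s' * orient p q M) (hM' : s' * orient p q M' = 0)
    (hpu : s' * orient p q u ≤ 0) (hpw : s' * orient p q w ≤ 0) :
    M' ∈ convexHull ℝ {M, u, w} := by
  have e : (-s * orient u w M') * (s' * orient p q M) + (-s * orient M M' w) * (s' * orient p q u) +
      (s * orient M M' u) * (s' * orient p q w) =
        -s * orient M u w * (s' * orient p q M') := by
    unfold orient; ring
  rw [hM', mul_zero] at e
  -- `M'` is on the same side of `uw` as `M`; the other two sides of the triangle are given by `hu`
  -- and `hw`.
  have hA : 0 ≤ -s * orient u w M' := by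
    by_contra hn
    push Not at hn
    nlinarith [mul_neg_of_neg_of_pos hn hM, mul_nonneg (neg_nonneg.2 hw) (neg_nonneg.2 hpu),
      mul_nonneg hu.le (neg_nonneg.2 hpw)]
  have hs := orient_sum M u w M'
  have e1 : orient w M M' = orient M M' w := orient_rotate' _ _ _
  have e2 : orient M u M' = -orient M M' u := orient_swap_right _ _ _
  rw [e1, e2] at hs
  refine mem_convexHull_triple_of_orient (σ := -s) ?_ hA ?_ ?_
  · rw [← hs]; linarith
  · rw [e1]; linarith
  · rw [e2]; linarith

theorem midpoint_eq (p q : Plane) : midpoint ℝ p q = (1 / 2 : ℝ) • p + (1 / 2 : ℝ) • q := by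
  rw [midpoint_eq_smul_add, smul_add]; norm_num

theorem orient_midpoint (p q x y : Plane) :
    orient p q (midpoint ℝ x y) = (orient p q x + orient p q y) / 2 := by
  rw [midpoint_eq, orient_combo (by norm_num)]; ring

namespace Chan

variable {σ : ℝ} {l r : Fin 7 → Plane}

theorem orient_midpoint_pos (h : Chan σ l r) (a : Fin 6) {i j : Fin 7} (hij : i < j) :
    0 < σ * orient (r i) (r j) (midpoint ℝ (l a.castSucc) (l a.succ)) := by
  rw [orient_midpoint]
  have h1 := h.visible_right i j a.castSucc hij
  have h2 := h.visible_right i j a.succ hij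
  linarith

/-- Seen from a midpoint of the left chain, the vertices of the right chain appear in monotone
angular order, so a line to a midpoint of the right chain has the two ends of that chain on
different sides. -/
theorem separates (h : Chan σ l r) (a b : Fin 6) :
    0 < σ * orient (midpoint ℝ (l a.castSucc) (l a.succ)) (midpoint ℝ (r b.castSucc) (r b.succ))
      (r 6) ∧
    σ * orient (midpoint ℝ (l a.castSucc) (l a.succ)) (midpoint ℝ (r b.castSucc) (r b.succ))
      (r 0) < 0 := by
  set M := midpoint ℝ (l a.castSucc) (l a.succ)
  have e : ∀ x, orient M (midpoint ℝ (r b.castSucc) (r b.succ)) x =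
      (orient (r b.castSucc) x M + orient (r b.succ) x M) / 2 := by
    intro x
    have h1 : ∀ y, orient M y x = orient x M y := fun y => orient_rotate _ _ _
    rw [h1, orient_midpoint, orient_rotate (r b.castSucc) x M, orient_rotate (r b.succ) x M]
  have hp : ∀ i j : Fin 7, i ≤ j → 0 ≤ σ * orient (r i) (r j) M := by
    intro i j hij
    rcases hij.eq_or_lt with rfl | hij
    · simp
    · exact (h.orient_midpoint_pos a hij).le
  rw [e, e]
  constructor
  · have h1 := h.orient_midpoint_pos a (i := b.castSucc) (j := 6)
      (Fin.castSucc_lt_succ.trans_le (Fin.le_last _))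
    have h2 := hp b.succ 6 (Fin.le_last _)
    linarith
  · have h1 := h.orient_midpoint_pos a (i := 0) (j := b.succ) (Fin.succ_pos b)
    have h2 := hp 0 b.castSucc (Fin.zero_le _)
    rw [orient_swap (r 0), orient_swap (r 0)]
    linarith

end Chan

namespace Layout

open Node

variable {V : Type*} {G : SimpleGraph V} {X : Layout G}

theorem eq_of_mem_inclined {d : G.Dart} {m k : Bool} {i : Fin 6} {y : Node G}
    (h : {sideChain d m i.castSucc, sideChain d m i.succ, y} ∈ inclined d k) :
    y = sideChain d (!m) (if m = k then 6 else 0) := by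
  have key : ∀ j : Fin 6, ∀ c : Fin 7, ∀ m' : Bool,
      ({sideChain d m i.castSucc, sideChain d m i.succ, y} : Set (Node G)) =
        {sideChain d (!m') c, sideChain d m' j.castSucc, sideChain d m' j.succ} →
      m' = m ∧ y = sideChain d (!m') c := by
    intro j c m' e
    have h1 : sideChain d m i.castSucc ∈ ({sideChain d (!m') c, sideChain d m' j.castSucc,
      sideChain d m' j.succ} : Set (Node G)) := e ▸ (by simp)
    have h2 : sideChain d m i.succ ∈ ({sideChain d (!m') c, sideChain d m' j.castSucc,
      sideChain d m' j.succ} : Set (Node G)) := e ▸ (by simp)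
    have hm : m' = m := by
      by_contra hm
      obtain rfl : m' = !m := by cases m <;> cases m' <;> simp_all
      rw [Bool.not_not] at h1 h2
      have e1 : sideChain d m i.castSucc = sideChain d m c := by
        rcases h1 with h | h | h
        · exact h
        · exact absurd h (sideChain_ne _ _ _ _)
        · exact absurd h (sideChain_ne _ _ _ _)
      have e2 : sideChain d m i.succ = sideChain d m c := by
        rcases h2 with h | h | h
        · exact h
        · exact absurd h (sideChain_ne _ _ _ _)
        · exact absurd h (sideChain_ne _ _ _ _)
      exact Fin.castSucc_lt_succ.ne (sideChain_injective _ _ (e1.trans e2.symm))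
    refine ⟨hm, ?_⟩
    subst hm
    have h3 : sideChain d (!m') c ∈
        ({sideChain d m' i.castSucc, sideChain d m' i.succ, y} : Set (Node G)) := e ▸ (by simp)
    rcases h3 with h | h | h
    · exact absurd h.symm (sideChain_ne _ _ _ _)
    · exact absurd h.symm (sideChain_ne _ _ _ _)
    · exact h.symm
  rcases h with ⟨j, hj⟩ | ⟨j, hj⟩
  · have := key j 0 (!k) (by rw [Bool.not_not]; exact hj)
    rw [← this.1, Bool.not_not]
    simpa using this.2
  · have := key j 6 k hj
    rw [← this.1]
    simpa using this.2

namespace IsConstruction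

/-- A chain edge is a boundary edge: it is in one channel triangle, and in no gadget triangle, since
a gadget contains at most one vertex of each chain. This starts the tracking of apexes. -/
theorem mem_T₁_iff_apex (hX : X.IsConstruction) {d : G.Dart} {m : Bool} {i : Fin 6} {y : Node G} :
    {sideChain d m i.castSucc, sideChain d m i.succ, y} ∈ X.T₁ ↔
      y = sideChain d (!m) (apexLeft m) := by
  constructor
  · intro h
    have hc : ∀ j, sideChain d m j ∈ channelNodes d := fun j => ⟨m, j, rfl⟩
    rw [T₁_eq] at h
    rcases h with h | ⟨e, ⟨-, he⟩ | ⟨he, -⟩⟩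
    · exfalso
      obtain ⟨v, hv⟩ := mem_gadgets h
      have hsub := hX.gadget_subset_gadgetNodes hv
      have h1 := mem_ends_of_mem (hsub (Or.inl rfl)) (hc _)
      have h2 := mem_ends_of_mem (hsub (Or.inr (Or.inl rfl))) (hc _)
      have e1 : ∀ j, sideChain d m j = leftEnd d ∨ sideChain d m j = rightEnd d → j = 0 := by
        intro j hj
        change sideChain d m j ∈ ({leftEnd d, rightEnd d} : Set (Node G)) at hj
        rw [← pair_ends d m] at hj
        rcases hj with h | h
        · exact sideChain_injective _ _ h
        · exact absurd h (sideChain_ne _ _ _ _)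
      have e2 : ∀ j, sideChain d m j = leftEnd d.symm ∨ sideChain d m j = rightEnd d.symm →
          j = 6 := by
        intro j hj
        change sideChain d m j ∈ ({leftEnd d.symm, rightEnd d.symm} : Set (Node G)) at hj
        rw [← pair_ends d.symm (!m), sideChain_symm, sideChain_symm, Bool.not_not] at hj
        rcases hj with h | h
        · exact sideChain_injective _ _ h
        · exact absurd h (sideChain_ne _ _ _ _)
      rcases h1 with h1 | h1 <;> rcases h2 with h2 | h2
      · exact Fin.succ_ne_zero i (e1 _ h2.2)
      · exact d.fst_ne_snd (h1.1.trans h2.1.symm)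
      · exact d.fst_ne_snd (h2.1.trans h1.1.symm)
      · exact (Fin.castSucc_lt_last i).ne (e2 _ h1.2)
    · have hed : e.edge = d.edge := channelNodes_disjoint
        (subset_channelNodes_of_leftInclined he (Or.inl rfl)) (hc _)
      have : {sideChain d m i.castSucc, sideChain d m i.succ, y} ∈ inclined d false := by
        rw [← leftInclined_union]
        rcases (SimpleGraph.dart_edge_eq_iff _ _).1 hed with rfl | rfl
        · exact Or.inl he
        · exact Or.inr he
      rw [eq_of_mem_inclined this]
      cases m <;> rfl
    · exact absurd he (Set.notMem_empty _)
  · rintro rfl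
    exact mem_T₁_apex d m i

end IsConstruction

/-! ### Apexes of chain edges along a flip sequence. -/

/-- `x t` is the apex of the triangle at the chain edge number `i` of `sideChain d m` before the
flip number `t`. -/
structure IsApexSeq {n : ℕ} (F : FlipSeq X.pt X.region n) (d : G.Dart) (m : Bool) (i : Fin 6)
    (x : ℕ → Node G) : Prop where
  first : x 0 = sideChain d (!m) (apexLeft m)
  last : x n = sideChain d (!m) (apexLeft !m)
  mem : ∀ t ≤ n, {sideChain d m i.castSucc, sideChain d m i.succ, x t} ∈ F.T t
  side : ∀ t ≤ n, sideSign m * orient (X.pt (sideChain d m i.castSucc))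
    (X.pt (sideChain d m i.succ)) (X.pt (x t)) < 0
  quad : ∀ t < n, x (t + 1) ≠ x t →
    F.quad t = {sideChain d m i.castSucc, sideChain d m i.succ, x t, x (t + 1)}

theorem exists_isApexSeq (hX : X.IsConstruction) {n : ℕ} (F : FlipSeq X.pt X.region n)
    (h0 : F.T 0 = X.T₁) (hn : F.T n = X.T₂) (d : G.Dart) (m : Bool) (i : Fin 6) :
    ∃ x, IsApexSeq F d m i x := by
  have hs := (hX.chan d m).visible_left i.castSucc i.succ (apexLeft m) Fin.castSucc_lt_succ
  simp only [Function.comp] at hs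
  have hne : orient (X.pt (sideChain d m i.castSucc)) (X.pt (sideChain d m i.succ))
      (X.pt (sideChain d (!m) (apexLeft m))) ≠ 0 := by
    intro h
    rw [h, mul_zero] at hs
    exact hs.ne rfl
  obtain ⟨x, hx0, hx, hq, ho⟩ := F.exists_apex hne (fun y => by rw [h0]; exact hX.mem_T₁_iff_apex)
  refine ⟨x, hx0, ?_, fun t ht => (hx t ht _).2 rfl, fun t ht => ?_, hq⟩
  · refine ((hx n le_rfl _).1 ?_).symm
    rw [hn]
    exact mem_T₂_apex d m i
  · have := ho t ht
    by_contra hn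
    push Not at hn
    nlinarith [mul_nonneg (neg_nonneg.2 hs.le) hn, sq_nonneg (sideSign m),
      mul_nonneg (sq_nonneg (sideSign m)) this.le, show sideSign m ^ 2 = 1 by
        cases m <;> simp [sideSign]]

namespace IsApexSeq

variable {n : ℕ} {F : FlipSeq X.pt X.region n} {d : G.Dart} {m : Bool} {a b : Fin 6}
  {x y : ℕ → Node G}

/-- If an edge of one chain only sees vertices outside the other chain, then every edge of that
chain takes part in a common flip with it. -/
theorem exists_common_flip (hX : X.IsConstruction) (hx : IsApexSeq F d m a x)
    (hy : IsApexSeq F d (!m) b y) (htame : ∀ t ≤ n, X.Tame d m (x t)) :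
    ∃ t < n, F.quad t = {sideChain d m a.castSucc, sideChain d m a.succ,
      sideChain d (!m) b.castSucc, sideChain d (!m) b.succ} := by
  set M := midpoint ℝ (X.pt (sideChain d m a.castSucc)) (X.pt (sideChain d m a.succ)) with hM
  set M' := midpoint ℝ (X.pt (sideChain d (!m) b.castSucc)) (X.pt (sideChain d (!m) b.succ)) with hM'
  obtain ⟨s6, s0⟩ := (hX.chan d m).separates a b
  simp only [Function.comp] at s6 s0
  rw [← hM, ← hM'] at s6 s0
  have hfM := (hX.chan d m).orient_midpoint_pos a (Fin.castSucc_lt_succ (i := b))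
  simp only [Function.comp] at hfM
  rw [← hM] at hfM
  have hfM' : sideSign m * orient (X.pt (sideChain d (!m) b.castSucc))
      (X.pt (sideChain d (!m) b.succ)) M' = 0 := by
    rw [hM', orient_midpoint]; simp
  -- The line from `M` to `M'` separates the first apex from the last one, so some flip carries the
  -- apex across. The direction of travel depends on the chain.
  have hchange : ∃ t < n, ∃ u w, ({u, w} : Set (Node G)) = {x t, x (t + 1)} ∧
      0 < sideSign m * orient M M' (X.pt u) ∧ sideSign m * orient M M' (X.pt w) ≤ 0 := by
    have h0 := hx.first
    have hn := hx.last
    cases m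
    · obtain ⟨t, ht, h1, h2⟩ := exists_last_true
        (P := fun t => 0 < sideSign false * orient M M' (X.pt (x t))) (n := n)
        (by rw [h0]; exact s6) (by rw [hn]; exact s0.le.not_gt)
      exact ⟨t, ht, x t, x (t + 1), rfl, h1, not_lt.1 h2⟩
    · obtain ⟨t, ht, h1, h2⟩ := exists_last_true
        (P := fun t => ¬ 0 < sideSign true * orient M M' (X.pt (x t))) (n := n)
        (by rw [h0]; exact s0.le.not_gt) (by rw [hn]; exact not_not.2 s6)
      exact ⟨t, ht, x (t + 1), x t, Set.pair_comm _ _, not_not.1 h2, not_lt.1 h1⟩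
  obtain ⟨t, ht, u, w, huw, hu, hw⟩ := hchange
  have htm : ∀ z ∈ ({u, w} : Set (Node G)), X.Tame d m z := by
    intro z hz
    rw [huw] at hz
    rcases hz with rfl | rfl
    · exact htame t ht.le
    · exact htame (t + 1) ht
  -- Tameness keeps both apexes on the outer side of the opposite edge, so the region between them,
  -- as seen from `M`, contains `M'`.
  have hmem := mem_triangle_of_separated hu hw hfM hfM' (htm u (by simp) b) (htm w (by simp) b)
  have hne : x (t + 1) ≠ x t := by
    intro e
    rw [e, Set.pair_eq_singleton] at huw
    have h1 : u = x t := huw.subset (by simp)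
    have h2 : w = x t := huw.subset (by simp)
    rw [h1] at hu
    rw [h2] at hw
    exact hw.not_gt hu
  have hquad := hx.quad t ht hne
  have hsub : ({u, w} : Set (Node G)) ⊆ F.quad t := by
    rw [huw, hquad]
    rintro z (rfl | rfl) <;> simp
  have hM'q : M' ∈ hull X.pt (F.quad t) := by
    refine convexHull_min ?_ (convex_hull X.pt _) hmem
    rintro z (rfl | rfl | rfl)
    · refine hull_mono X.pt (s := {sideChain d m a.castSucc, sideChain d m a.succ}) ?_ ?_
      · rw [hquad]
        rintro z (rfl | rfl) <;> simp
      · rw [hull_pair]; exact midpoint_mem_segment _ _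
    · exact mem_hull X.pt (hsub (by simp))
    · exact mem_hull X.pt (hsub (by simp))
  have hR : sideChain d (!m) b.castSucc ≠ sideChain d (!m) b.succ := fun h =>
    Fin.castSucc_lt_succ.ne (sideChain_injective _ _ h)
  have hopen : M' ∈ openSegment ℝ (X.pt (sideChain d (!m) b.castSucc))
      (X.pt (sideChain d (!m) b.succ)) := by
    rw [hM', midpoint_eq]
    exact ⟨1 / 2, 1 / 2, by norm_num, by norm_num, by norm_num, rfl⟩
  have hf := F.flipAt t ht
  -- `M'` is in one of the two triangles being flipped and in the interior of an edge of the current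
  -- triangulation. That triangle therefore contains both ends of the edge.
  have hboth : sideChain d (!m) b.castSucc ∈ F.quad t ∧ sideChain d (!m) b.succ ∈ F.quad t := by
    rcases hf.hull_quad_subset hM'q with h | h
    · have := hf.source.mem_of_openSegment hf.left_mem (hy.mem t ht.le) (by simp) (by simp) hopen h
      exact ⟨(F.quad_subset_of_mem t).1 this.1, (F.quad_subset_of_mem t).1 this.2⟩
    · have := hf.source.mem_of_openSegment hf.right_mem (hy.mem t ht.le) (by simp) (by simp) hopen h
      exact ⟨(F.quad_subset_of_mem t).2 this.1, (F.quad_subset_of_mem t).2 this.2⟩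
  refine ⟨t, ht, ?_⟩
  rw [hquad] at hboth ⊢
  have key : ∀ k, sideChain d (!m) k ∈ ({sideChain d m a.castSucc, sideChain d m a.succ, x t,
      x (t + 1)} : Set (Node G)) → sideChain d (!m) k = x t ∨ sideChain d (!m) k = x (t + 1) := by
    rintro k (h | h | h | h)
    · exact absurd h.symm (sideChain_ne _ _ _ _)
    · exact absurd h.symm (sideChain_ne _ _ _ _)
    · exact Or.inl h
    · exact Or.inr h
  rcases key _ hboth.1 with h1 | h1 <;> rcases key _ hboth.2 with h2 | h2
  · exact absurd (h1.trans h2.symm) hR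
  · rw [h1, h2]
  · rw [h1, h2, Set.pair_comm (x t)]
  · exact absurd (h1.trans h2.symm) hR

/-- A chain edge that is in a triangle with a vertex outside the channel takes part in two flips
with exactly one vertex outside the channel. -/
theorem exists_external_flips (hX : X.IsConstruction) (hx : IsApexSeq F d m a x) {k : ℕ}
    (hk : k ≤ n) (hext : x k ∉ channelNodes d) :
    ∃ t₁ < n, ∃ t₂ < n, t₁ ≠ t₂ ∧ ∀ t, t = t₁ ∨ t = t₂ → ∃ j, F.quad t ∩ channelNodes d =
      {sideChain d m a.castSucc, sideChain d m a.succ, sideChain d (!m) j} := by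
  have key : ∀ t < n, ∀ u w, ({x t, x (t + 1)} : Set (Node G)) = {u, w} → u ∈ channelNodes d →
      w ∉ channelNodes d → ∃ j, F.quad t ∩ channelNodes d =
      {sideChain d m a.castSucc, sideChain d m a.succ, sideChain d (!m) j} := by
    intro t ht u w he hu hw
    have hne : x (t + 1) ≠ x t := by
      intro e
      rw [e, Set.pair_eq_singleton] at he
      have h1 : u = x t := he.symm.subset (by simp)
      have h2 : w = x t := he.symm.subset (by simp)
      exact hw (h2 ▸ h1 ▸ hu)
    have hside : sideSign m * orient (X.pt (sideChain d m a.castSucc))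
        (X.pt (sideChain d m a.succ)) (X.pt u) < 0 := by
      have : u ∈ ({x t, x (t + 1)} : Set (Node G)) := he ▸ (by simp)
      rcases this with rfl | rfl
      · exact hx.side t ht.le
      · exact hx.side (t + 1) ht
    obtain ⟨j, rfl⟩ := hX.mem_opposite_of_mem hside hu
    refine ⟨j, ?_⟩
    rw [hx.quad t ht hne, he]
    ext z
    simp only [Set.mem_inter_iff, Set.mem_insert_iff, Set.mem_singleton_iff]
    constructor
    · rintro ⟨h | h | h | h, hz⟩
      · exact Or.inl h
      · exact Or.inr (Or.inl h)
      · exact Or.inr (Or.inr h)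
      · exact absurd (h ▸ hz) hw
    · rintro (rfl | rfl | rfl)
      · exact ⟨by simp, _, _, rfl⟩
      · exact ⟨by simp, _, _, rfl⟩
      · exact ⟨by simp, _, _, rfl⟩
  -- The apex starts and finishes in the channel, so it leaves before time `k` and returns
  -- afterwards.
  obtain ⟨t₁, h1, h2, h3⟩ := exists_last_true (P := fun t => x t ∈ channelNodes d) (n := k)
    (by rw [hx.first]; exact ⟨_, _, rfl⟩) hext
  obtain ⟨t₂, h4, h5, h6, h7⟩ := exists_change (P := fun t => x t ∉ channelNodes d) hk hext
    (by rw [hx.last]; exact not_not.2 ⟨_, _, rfl⟩)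
  refine ⟨t₁, h1.trans_le hk, t₂, h5, by omega, ?_⟩
  rintro t (rfl | rfl)
  · exact key _ (h1.trans_le hk) _ _ rfl h2 h3
  · exact key _ h5 _ _ (Set.pair_comm _ _) (not_not.1 h7) h6

end IsApexSeq

end Layout

/-! ### Counting flips -/

theorem eq_of_succ_pair : ∀ {i i' : Fin 6}, (∀ k : Fin 7, (k = i.castSucc ∨ k = i.succ) ↔
    (k = i'.castSucc ∨ k = i'.succ)) → i = i' := by decide

theorem succ_pair_ne_singleton : ∀ {i : Fin 6} {j : Fin 7},
    ¬ ∀ k : Fin 7, (k = i.castSucc ∨ k = i.succ) ↔ k = j := by decide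

namespace Layout

open Node

variable {V : Type*} {G : SimpleGraph V} {X : Layout G} {n : ℕ} (F : FlipSeq X.pt X.region n)

/-- The flip number `t` involves the chain edge number `i` of `sideChain d m` and no other vertices
of that chain. -/
def UsesEdge (d : G.Dart) (m : Bool) (i : Fin 6) (t : ℕ) : Prop :=
  ∀ k, sideChain d m k ∈ F.quad t ↔ k = i.castSucc ∨ k = i.succ

/-- The flip number `t` involves exactly one vertex of `sideChain d m`. -/
def UsesVertex (d : G.Dart) (m : Bool) (t : ℕ) : Prop :=
  ∃ j, ∀ k, sideChain d m k ∈ F.quad t ↔ k = j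

/-- At least three vertices of the quadrilateral of the flip number `t` are in the channel. -/
def InChannel (d : G.Dart) (t : ℕ) : Prop := 3 ≤ (F.quad t ∩ channelNodes d).ncard

/-- The flips in the channel of `d`. -/
noncomputable def channelFlips (d : G.Dart) : Finset ℕ :=
  open Classical in (Finset.range n).filter (InChannel F d)

variable {F}

theorem UsesEdge.eq {d : G.Dart} {m : Bool} {i i' : Fin 6} {t : ℕ} (h : UsesEdge F d m i t)
    (h' : UsesEdge F d m i' t) : i = i' :=
  eq_of_succ_pair fun k => (h k).symm.trans (h' k)

theorem UsesEdge.not_usesVertex {d : G.Dart} {m : Bool} {i : Fin 6} {t : ℕ}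
    (h : UsesEdge F d m i t) : ¬ UsesVertex F d m t := by
  rintro ⟨j, hj⟩
  exact succ_pair_ne_singleton fun k => (h k).symm.trans (hj k)

theorem inChannel_of_mem {d : G.Dart} {m : Bool} {i : Fin 6} {j : Fin 7} {t : ℕ}
    (h1 : sideChain d m i.castSucc ∈ F.quad t) (h2 : sideChain d m i.succ ∈ F.quad t)
    (h3 : sideChain d (!m) j ∈ F.quad t) : InChannel F d t := by
  have hf : (F.quad t).Finite := Set.toFinite {F.a t, F.b t, F.c t, F.d t}
  have hne : sideChain d m i.castSucc ≠ sideChain d m i.succ := fun h =>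
    Fin.castSucc_lt_succ.ne (sideChain_injective _ _ h)
  have h : ({sideChain d m i.castSucc, sideChain d m i.succ, sideChain d (!m) j} :
      Set (Node G)).ncard = 3 :=
    Set.ncard_eq_three.2 ⟨_, _, _, hne, sideChain_ne _ _ _ _, sideChain_ne _ _ _ _, rfl⟩
  rw [InChannel, ← h]
  refine Set.ncard_le_ncard ?_ (hf.inter_of_left _)
  rintro z (rfl | rfl | rfl)
  · exact ⟨h1, _, _, rfl⟩
  · exact ⟨h2, _, _, rfl⟩
  · exact ⟨h3, _, _, rfl⟩

theorem usesEdge_of_quad_eq {d : G.Dart} {a b : Fin 6} {t : ℕ}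
    (h : F.quad t = {sideChain d false a.castSucc, sideChain d false a.succ,
      sideChain d true b.castSucc, sideChain d true b.succ}) :
    UsesEdge F d false a t ∧ UsesEdge F d true b t ∧ InChannel F d t := by
  refine ⟨fun k => ?_, fun k => ?_, inChannel_of_mem (m := false) (i := a) (j := b.succ) ?_ ?_ ?_⟩
  · rw [h]
    simp only [Set.mem_insert_iff, Set.mem_singleton_iff, (sideChain_injective d _).eq_iff,
      show ∀ i j, sideChain d false i ≠ sideChain d true j from sideChain_ne d false, or_false]
  · rw [h]
    simp only [Set.mem_insert_iff, Set.mem_singleton_iff, (sideChain_injective d _).eq_iff,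
      show ∀ i j, sideChain d true i ≠ sideChain d false j from sideChain_ne d true, false_or]
  · rw [h]; simp
  · rw [h]; simp
  · rw [h]; simp

theorem usesEdge_of_inter_eq {d : G.Dart} {m : Bool} {i : Fin 6} {j : Fin 7} {t : ℕ}
    (h : F.quad t ∩ channelNodes d =
      {sideChain d m i.castSucc, sideChain d m i.succ, sideChain d (!m) j}) :
    UsesEdge F d m i t ∧ UsesVertex F d (!m) t ∧ InChannel F d t := by
  have hmem : ∀ m' k, sideChain d m' k ∈ F.quad t ↔ sideChain d m' k ∈
      ({sideChain d m i.castSucc, sideChain d m i.succ, sideChain d (!m) j} : Set (Node G)) := by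
    intro m' k
    rw [← h]
    exact ⟨fun h => ⟨h, _, _, rfl⟩, fun h => h.1⟩
  have hne : ∀ i j, sideChain d (!m) j ≠ sideChain d m i := fun i j h =>
    sideChain_ne d m i j h.symm
  refine ⟨fun k => ?_, ⟨j, fun k => ?_⟩, inChannel_of_mem (m := m) (i := i) (j := j) ?_ ?_ ?_⟩
  · rw [hmem]
    simp only [Set.mem_insert_iff, Set.mem_singleton_iff, (sideChain_injective d _).eq_iff,
      sideChain_ne, or_false]
  · rw [hmem]
    simp only [Set.mem_insert_iff, Set.mem_singleton_iff, (sideChain_injective d _).eq_iff,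
      hne, false_or]
  · rw [hmem]; simp
  · rw [hmem]; simp
  · rw [hmem]; simp

/-- The flips counted are pairwise distinct: a flip using an edge of a chain determines that edge,
and it cannot also use just a single vertex of that chain. Pairs in `A` give flips with an edge on
both sides, members of `E` give flips with an edge on one side and a vertex on the other. -/
theorem card_le_channelFlips {d : G.Dart} (A : Finset (Fin 6 × Fin 6)) (E : Bool → Finset (Fin 6))
    (hA : ∀ p ∈ A, ∃ t < n, UsesEdge F d false p.1 t ∧ UsesEdge F d true p.2 t ∧ InChannel F d t)
    (hE : ∀ m, ∀ i ∈ E m, ∃ t₁ < n, ∃ t₂ < n, t₁ ≠ t₂ ∧ ∀ t, t = t₁ ∨ t = t₂ →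
      UsesEdge F d m i t ∧ UsesVertex F d (!m) t ∧ InChannel F d t) :
    A.card + (2 * (E false).card + 2 * (E true).card) ≤ (channelFlips F d).card := by
  classical
  let fA : Fin 6 × Fin 6 → Finset ℕ := fun p => (channelFlips F d).filter fun t =>
    UsesEdge F d false p.1 t ∧ UsesEdge F d true p.2 t
  let fE : Bool → Fin 6 → Finset ℕ := fun m i => (channelFlips F d).filter fun t =>
    UsesEdge F d m i t ∧ UsesVertex F d (!m) t
  have cA : A.card ≤ (A.biUnion fA).card := by
    rw [Finset.card_biUnion, Finset.card_eq_sum_ones]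
    · refine Finset.sum_le_sum fun p hp => Finset.card_pos.2 ?_
      obtain ⟨t, ht, h1, h2, h3⟩ := hA p hp
      exact ⟨t, by simp [fA, channelFlips, *]⟩
    · intro p _ q _ hpq
      refine Finset.disjoint_left.2 fun t ht ht' => hpq ?_
      simp only [fA, Finset.mem_filter] at ht ht'
      exact Prod.ext (ht.2.1.eq ht'.2.1) (ht.2.2.eq ht'.2.2)
  have cE : ∀ m, 2 * (E m).card ≤ ((E m).biUnion (fE m)).card := by
    intro m
    rw [Finset.card_biUnion, mul_comm, ← smul_eq_mul, ← Finset.sum_const]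
    · refine Finset.sum_le_sum fun i hi => ?_
      obtain ⟨t₁, h1, t₂, h2, hne, h⟩ := hE m i hi
      refine Finset.one_lt_card.2 ⟨t₁, ?_, t₂, ?_, hne⟩
      · have := h t₁ (Or.inl rfl)
        simp [fE, channelFlips, *]
      · have := h t₂ (Or.inr rfl)
        simp [fE, channelFlips, *]
    · intro p _ q _ hpq
      refine Finset.disjoint_left.2 fun t ht ht' => hpq ?_
      simp only [fE, Finset.mem_filter] at ht ht'
      exact ht.2.1.eq ht'.2.1
  have d1 : Disjoint ((E false).biUnion (fE false)) ((E true).biUnion (fE true)) := by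
    refine Finset.disjoint_left.2 fun t ht ht' => ?_
    simp only [fE, Finset.mem_biUnion, Finset.mem_filter] at ht ht'
    obtain ⟨i, -, -, h1, -⟩ := ht
    obtain ⟨j, -, -, -, h2⟩ := ht'
    exact h1.not_usesVertex h2
  have d2 : Disjoint (A.biUnion fA) ((E false).biUnion (fE false) ∪ (E true).biUnion (fE true)) := by
    refine Finset.disjoint_left.2 fun t ht ht' => ?_
    simp only [fA, fE, Finset.mem_union, Finset.mem_biUnion, Finset.mem_filter] at ht ht'
    obtain ⟨p, -, -, h1, h2⟩ := ht
    rcases ht' with ⟨i, -, -, -, h3⟩ | ⟨i, -, -, -, h3⟩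
    · exact h2.not_usesVertex h3
    · exact h1.not_usesVertex h3
  have hsub : A.biUnion fA ∪ ((E false).biUnion (fE false) ∪ (E true).biUnion (fE true)) ⊆
      channelFlips F d := by
    refine Finset.union_subset ?_ (Finset.union_subset ?_ ?_) <;>
      exact Finset.biUnion_subset.2 fun _ _ => Finset.filter_subset _ _
  have := Finset.card_le_card hsub
  rw [Finset.card_union_of_disjoint d2, Finset.card_union_of_disjoint d1] at this
  have := cE false
  have := cE true
  omega

/-- Every channel takes 24 flips; it takes 36 flips unless a gadget is unlocked. -/
theorem channel_dichotomy (hX : X.IsConstruction) [Finite V] (h0 : F.T 0 = X.T₁)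
    (hn : F.T n = X.T₂) (htri : ∀ t ≤ n, IsTriangulation X.pt X.region (F.T t)) (d : G.Dart) :
    36 ≤ (channelFlips F d).card ∨ (24 ≤ (channelFlips F d).card ∧
      ∃ e : G.Dart, e.edge = d.edge ∧ ∃ k ≤ n, ∀ m P Q W, X.IsPort e m P Q W → ∀ t ∈ F.T k,
      ¬ {C e.fst, E e.fst} ⊆ t ∧ ¬ {P, sideChain e (!m) 0} ⊆ t ∧ ¬ {P, Q} ⊆ t) := by
  classical
  choose x hx using exists_isApexSeq hX F h0 hn d
  have htame : ∀ m i, (∀ t ≤ n, x m i t ∈ channelNodes d) → ∀ t ≤ n, X.Tame d m (x m i t) := by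
    intro m i h t ht
    obtain ⟨k, hk⟩ := hX.mem_opposite_of_mem ((hx m i).side t ht) (h t ht)
    rw [hk]
    exact hX.tame_of_mem d m k
  by_cases hwild : ∀ i, ∀ t ≤ n, X.Tame d false (x false i t)
  · left
    have := card_le_channelFlips (F := F) (d := d) Finset.univ (fun _ => ∅) (fun p _ => by
      obtain ⟨t, ht, h⟩ := (hx false p.1).exists_common_flip hX (hx true p.2) (hwild p.1)
      exact ⟨t, ht, usesEdge_of_quad_eq h⟩) (by simp)
    simpa using this
  · right
    push Not at hwild
    obtain ⟨i, k, hk, hw⟩ := hwild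
    refine ⟨?_, ?_⟩
    -- The edges that ever have an apex outside the channel. For a pair not in the product of the
    -- two sets, one of the edges always has its apex on the opposite chain, which is tame, so the
    -- pair has a common flip.
    · let Ex : Bool → Finset (Fin 6) := fun m =>
        Finset.univ.filter fun i => ∃ t ≤ n, x m i t ∉ channelNodes d
      have := card_le_channelFlips (F := F) (d := d) (Finset.univ \ Ex false ×ˢ Ex true) Ex
        (fun p hp => by
          simp only [Ex, Finset.mem_sdiff, Finset.mem_univ, true_and, Finset.mem_product,
            Finset.mem_filter, not_and_or] at hp
          push Not at hp
          rcases hp with hp | hp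
          · obtain ⟨t, ht, h⟩ := (hx false p.1).exists_common_flip hX (hx true p.2)
              (htame _ _ hp)
            exact ⟨t, ht, usesEdge_of_quad_eq h⟩
          · obtain ⟨t, ht, h⟩ := (hx true p.2).exists_common_flip hX (hx false p.1)
              (htame _ _ hp)
            refine ⟨t, ht, usesEdge_of_quad_eq ?_⟩
            rw [h]
            ext z
            simp only [Set.mem_insert_iff, Set.mem_singleton_iff, Bool.not_true]
            exact Iff.of_eq (by ac_rfl))
        (fun m i hi => by
          simp only [Ex, Finset.mem_filter, Finset.mem_univ, true_and] at hi
          obtain ⟨k, hk, hext⟩ := hi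
          obtain ⟨t₁, h1, t₂, h2, hne, h⟩ := (hx m i).exists_external_flips hX hk hext
          refine ⟨t₁, h1, t₂, h2, hne, fun t ht => ?_⟩
          obtain ⟨j, hj⟩ := h t ht
          exact usesEdge_of_inter_eq hj)
      rw [Finset.card_sdiff_of_subset (Finset.subset_univ _), Finset.card_product,
        Finset.card_univ, Fintype.card_prod, Fintype.card_fin] at this
      have h1 : (Ex false).card ≤ 6 := (Finset.card_le_univ _).trans (by simp)
      have h2 : (Ex true).card ≤ 6 := (Finset.card_le_univ _).trans (by simp)
      -- It remains that 36 - ab + 2a + 2b ≥ 24 for a, b ≤ 6, that is, (a - 2)(b - 2) ≤ 16.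
      generalize (Ex false).card = a at *
      generalize (Ex true).card = b at *
      refine le_trans ?_ this
      interval_cases a <;> omega
    · obtain ⟨e, he, h⟩ := hX.unlocked_of_not_tame (htri k hk) ((hx false i).mem k hk)
        ((hx false i).side k hk) hw
      exact ⟨e, he, k, hk, h⟩

/-! ### Locking edges -/

/-- Of the at most four vertices of the quadrilateral, two are outside the channel. -/
theorem not_inChannel {d : G.Dart} {t : ℕ} {p q : Node G} (hpq : p ≠ q) (hp : p ∈ F.quad t)
    (hq : q ∈ F.quad t) (hp' : p ∉ channelNodes d) (hq' : q ∉ channelNodes d) :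
    ¬ InChannel F d t := by
  have hf : (F.quad t).Finite := Set.toFinite {F.a t, F.b t, F.c t, F.d t}
  have h1 : F.quad t ∩ channelNodes d ⊆ F.quad t \ {p, q} := by
    rintro z ⟨hz, hz'⟩
    refine ⟨hz, ?_⟩
    rintro (rfl | rfl)
    · exact hp' hz'
    · exact hq' hz'
  have h2 := Set.ncard_le_ncard h1 hf.sdiff
  rw [Set.ncard_sdiff (Set.pair_subset hp hq), Set.ncard_pair hpq] at h2
  have := F.ncard_quad_le t
  unfold InChannel
  omega

theorem IsInner.notMem_channelNodes {v : V} {p : Node G} (h : IsInner v p) (d : G.Dart) :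
    p ∉ channelNodes d := by
  rintro ⟨m, i, hi⟩
  exact h.ne_sideChain d m i hi

theorem subset_quad_of_mem_flipsOf {p q : Node G} {t : ℕ} (h : t ∈ F.flipsOf {p, q}) :
    p ∈ F.quad t ∧ q ∈ F.quad t := by
  have : ({p, q} : Set (Node G)) ⊆ F.quad t := by
    rcases (F.mem_flipsOf.1 h).2 with h | h <;> rw [h] <;> rintro z (rfl | rfl) <;>
      simp [FlipSeq.quad]
  exact ⟨this (Or.inl rfl), this (Or.inr rfl)⟩

/-- A flip with the edge from the end of a channel to the apex `P` as a diagonal is not a flip in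
that channel. -/
theorem not_inChannel_of_mem_flipsOf (hX : X.IsConstruction) {d e : G.Dart} {m : Bool}
    {P Q W : Node G} (h : X.IsPort e m P Q W) {t : ℕ}
    (ht : t ∈ F.flipsOf {P, sideChain e (!m) 0}) : ¬ InChannel F d t := by
  obtain ⟨iP, -⟩ := h.inner hX
  obtain ⟨hP, hA⟩ := subset_quad_of_mem_flipsOf ht
  have hne := iP.ne_sideChain e (!m) 0
  intro hin
  have hall : ∀ z ∈ F.quad t, z ≠ P → z ∈ channelNodes d := by
    intro z hz hzP
    by_contra hn
    exact not_inChannel hzP hz hP hn (iP.notMem_channelNodes d) hin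
  have hed : e.edge = d.edge := channelNodes_disjoint ⟨_, _, rfl⟩ (hall _ hA hne.symm)
  have hbey := hX.port_beyond h
  have hnn : ∀ z ∈ channelNodes d, 0 ≤ sideSign m * orient (X.pt (sideChain e m 0))
      (X.pt (sideChain e (!m) 0)) (X.pt z) := by
    intro z hz
    rw [← channelNodes_congr hed] at hz
    obtain ⟨m', k, rfl⟩ := hz
    have h1 := (hX.chan e m).left_inside (i := k)
    have h2 := (hX.chan e m).right_inside (i := k)
    simp only [Function.comp] at h1 h2
    rcases (Fin.zero_le k).eq_or_lt with rfl | hk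
    · cases m <;> cases m' <;> simp
    · cases m <;> cases m' <;> first | exact (h1 hk).le | exact (h2 hk).le
  -- If the flip were in the channel, the other diagonal would join two channel vertices, which are
  -- not beyond the end line. But all interior points of `PA` are strictly beyond it.
  have key : ∀ y y' : Node G, y ∈ F.quad t → y' ∈ F.quad t → y ≠ P → y' ≠ P →
      (openSegment ℝ (X.pt P) (X.pt (sideChain e (!m) 0)) ∩
        openSegment ℝ (X.pt y) (X.pt y')).Nonempty → False := by
    rintro y y' hy hy' hyP hyP' ⟨z, ⟨a, b, ha, hb, hab, rfl⟩, u, v, hu, hv, huv, huv'⟩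
    have h1 := hnn y (hall y hy hyP)
    have h2 := hnn y' (hall y' hy' hyP')
    have h3 : 0 ≤ sideSign m * orient (X.pt (sideChain e m 0)) (X.pt (sideChain e (!m) 0))
        (u • X.pt y + v • X.pt y') := by
      rw [orient_combo huv]
      nlinarith [mul_nonneg hu.le h1, mul_nonneg hv.le h2]
    rw [huv', orient_combo hab] at h3
    simp only [orient_self_right, mul_zero, add_zero] at h3
    nlinarith [mul_neg_of_pos_of_neg ha hbey]
  obtain ⟨htn, ht⟩ := F.mem_flipsOf.1 ht
  have hf := F.flipAt t htn
  obtain ⟨h1, h2, h3, h4, h5, h6⟩ := hf.distinct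
  have hq : ∀ z, z = F.a t ∨ z = F.b t ∨ z = F.c t ∨ z = F.d t → z ∈ F.quad t := fun z hz => hz
  have hcr := hf.crossing
  rcases ht with ht | ht <;> rcases Set.pair_eq_pair_iff.1 ht with ⟨e1, e2⟩ | ⟨e1, e2⟩
  · refine key (F.c t) (F.d t) (hq _ (by simp)) (hq _ (by simp)) ?_ ?_ ?_
    · rw [e1]; exact h2.symm
    · rw [e1]; exact h3.symm
    · rw [e1, e2]; exact hcr
  · refine key (F.c t) (F.d t) (hq _ (by simp)) (hq _ (by simp)) ?_ ?_ ?_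
    · rw [e1]; exact h4.symm
    · rw [e1]; exact h5.symm
    · rw [e1, e2, openSegment_symm]; exact hcr
  · refine key (F.a t) (F.b t) (hq _ (by simp)) (hq _ (by simp)) ?_ ?_ ?_
    · rw [e1]; exact h2
    · rw [e1]; exact h4
    · rw [e1, e2, Set.inter_comm]; exact hcr
  · refine key (F.a t) (F.b t) (hq _ (by simp)) (hq _ (by simp)) ?_ ?_ ?_
    · rw [e1]; exact h3
    · rw [e1]; exact h5
    · rw [e1, e2, openSegment_symm ℝ (X.pt (F.d t)), Set.inter_comm]; exact hcr

/-- The edges `PQ` of the ports of one gadget are different sides of its quadrilateral `CDEF`. -/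
theorem IsPort.eq_of_pair_eq {d d' : G.Dart} {m m' : Bool} {P Q W P' Q' W' : Node G}
    (h : X.IsPort d m P Q W) (h' : X.IsPort d' m' P' Q' W') (e : ({P, Q} : Set (Node G)) = {P', Q'}) :
    d = d' := by
  cases h <;> cases h' <;> simp only [Set.pair_eq_pair_iff, reduceCtorEq, C.injEq, D.injEq,
    E.injEq, F.injEq, false_and, and_false, or_false, and_self] at e <;> simp_all

theorem IsPort.pair_ne_lock {d : G.Dart} {m : Bool} {P Q W : Node G} (h : X.IsPort d m P Q W)
    (v : V) : ({P, Q} : Set (Node G)) ≠ {C v, E v} := by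
  intro e
  cases h <;> simp [Set.pair_eq_pair_iff] at e

end Layout

/-! ### The lower bound -/

namespace Layout

open Node

variable {V : Type*} {G : SimpleGraph V} {X : Layout G} {n : ℕ} {F : FlipSeq X.pt X.region n}

/-- The flip number `t` is in the channel of `d` or concerns one of the two outer locking edges of
a port of it. -/
def NearChannel (F : FlipSeq X.pt X.region n) (d : G.Dart) (t : ℕ) : Prop :=
  InChannel F d t ∨ ∃ e m P Q W, e.edge = d.edge ∧ X.IsPort e m P Q W ∧
    (t ∈ F.flipsOf {P, sideChain e (!m) 0} ∨ t ∈ F.flipsOf {P, Q})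

/-- The flips that are accounted for by the edge of `d`. -/
noncomputable def nearFlips (F : FlipSeq X.pt X.region n) (d : G.Dart) : Finset ℕ :=
  open Classical in (Finset.range n).filter (NearChannel F d)

/-- The gadget of `v` is unlocked at some time. -/
def Unlocked (F : FlipSeq X.pt X.region n) (v : V) : Prop :=
  ∃ k ≤ n, ∀ t ∈ F.T k, ¬ {C v, E v} ⊆ t

theorem gadget_subset_T₁ (v : V) : gadgetOuter v (X.ports v) ∪ lockedQuad v ⊆ X.T₁ := by
  rw [← gadget_eq]
  exact fun t ht => Or.inl (Set.mem_iUnion.2 ⟨v, ht⟩)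

theorem gadget_subset_T₂ (v : V) : gadgetOuter v (X.ports v) ∪ lockedQuad v ⊆ X.T₂ := by
  rw [← gadget_eq]
  exact fun t ht => Or.inl (Set.mem_iUnion.2 ⟨v, ht⟩)

theorem exists_lock_subset (v : V) :
    ∃ t ∈ gadgetOuter v (X.ports v) ∪ lockedQuad v, {C v, E v} ⊆ t :=
  ⟨{C v, E v, F v}, Or.inr (Or.inl rfl), by rintro z (rfl | rfl) <;> simp⟩

namespace IsPort

variable {d : G.Dart} {m : Bool} {P Q W : Node G}

theorem exists_fst_subset (hX : X.IsConstruction) (h : X.IsPort d m P Q W) :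
    ∃ t ∈ gadgetOuter d.fst (X.ports d.fst) ∪ lockedQuad d.fst, {P, sideChain d (!m) 0} ⊆ t :=
  ⟨_, Or.inl (h.triangles hX).1, by rintro z (rfl | rfl) <;> simp⟩

theorem exists_snd_subset (hX : X.IsConstruction) (h : X.IsPort d m P Q W) :
    ∃ t ∈ gadgetOuter d.fst (X.ports d.fst) ∪ lockedQuad d.fst, {P, Q} ⊆ t :=
  ⟨_, Or.inl (h.triangles hX).2.1, by rintro z (rfl | rfl) <;> simp⟩

end IsPort

/-- The flips near a channel. -/
theorem nearFlips_dichotomy (hX : X.IsConstruction) [Finite V] (h0 : F.T 0 = X.T₁)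
    (hn : F.T n = X.T₂) (htri : ∀ t ≤ n, IsTriangulation X.pt X.region (F.T t)) (d : G.Dart) :
    30 ≤ (nearFlips F d).card ∨ (28 ≤ (nearFlips F d).card ∧
      ∃ e : G.Dart, e.edge = d.edge ∧ Unlocked F e.fst) := by
  classical
  have hsub : channelFlips F d ⊆ nearFlips F d := by
    intro t ht
    simp only [channelFlips, nearFlips, Finset.mem_filter] at ht ⊢
    exact ⟨ht.1, Or.inl ht.2⟩
  rcases channel_dichotomy hX h0 hn htri d with h | ⟨h, e, hed, k, hk, hun⟩
  · left
    have := Finset.card_le_card hsub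
    omega
  · right
    obtain ⟨m, P, Q, W, hp⟩ := hX.exists_isPort e
    obtain ⟨iP, iQ, iW, hPQ, hPW, hQW⟩ := hp.inner hX
    have hun' := hun m P Q W hp
    obtain ⟨t₁, ht₁, hs₁⟩ := hp.exists_fst_subset hX
    obtain ⟨t₂, ht₂, hs₂⟩ := hp.exists_snd_subset hX
    -- `PA` and `PQ` are edges of both `T₁` and `T₂` but absent at time `k`, so each is removed and
    -- reinserted: 24 + 2 + 2 = 28.
    have c1 := F.two_le_card_flipsOf (iP.ne_sideChain e (!m) 0)
      (h0 ▸ ⟨t₁, gadget_subset_T₁ _ ht₁, hs₁⟩) (hn ▸ ⟨t₁, gadget_subset_T₂ _ ht₁, hs₁⟩) hk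
      fun t ht => (hun' t ht).2.1
    have c2 := F.two_le_card_flipsOf hPQ
      (h0 ▸ ⟨t₂, gadget_subset_T₁ _ ht₂, hs₂⟩) (hn ▸ ⟨t₂, gadget_subset_T₂ _ ht₂, hs₂⟩) hk
      fun t ht => (hun' t ht).2.2
    refine ⟨?_, e, hed, k, hk, fun t ht => (hun' t ht).1⟩
    have d1 : Disjoint (F.flipsOf {P, sideChain e (!m) 0}) (F.flipsOf {P, Q}) := by
      refine Finset.disjoint_left.2 fun t ht ht' => ?_
      have := F.eq_of_mem_flipsOf hX.no_overlap ⟨t₁, gadget_subset_T₁ _ ht₁, hs₁⟩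
        ⟨t₂, gadget_subset_T₁ _ ht₂, hs₂⟩ ht ht'
      rcases this.subset (Or.inr rfl) with h | h
      · exact iP.ne_sideChain e (!m) 0 h.symm
      · exact iQ.ne_sideChain e (!m) 0 h.symm
    have d2 : Disjoint (channelFlips F d)
        (F.flipsOf {P, sideChain e (!m) 0} ∪ F.flipsOf {P, Q}) := by
      refine Finset.disjoint_left.2 fun t ht ht' => ?_
      simp only [channelFlips, Finset.mem_filter] at ht
      rcases Finset.mem_union.1 ht' with h | h
      · exact not_inChannel_of_mem_flipsOf hX hp h ht.2
      · obtain ⟨h1, h2⟩ := subset_quad_of_mem_flipsOf h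
        exact not_inChannel hPQ h1 h2 (iP.notMem_channelNodes d) (iQ.notMem_channelNodes d) ht.2
    have hsub' : channelFlips F d ∪ (F.flipsOf {P, sideChain e (!m) 0} ∪ F.flipsOf {P, Q}) ⊆
        nearFlips F d := by
      refine Finset.union_subset hsub fun t ht => ?_
      have ht' := Finset.mem_union.1 ht
      have hlt : t < n := by
        rcases ht' with h | h
        · exact (F.mem_flipsOf.1 h).1
        · exact (F.mem_flipsOf.1 h).1
      simp only [nearFlips, Finset.mem_filter, Finset.mem_range]
      exact ⟨hlt, Or.inr ⟨e, m, P, Q, W, hed, hp, ht'⟩⟩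
    have := Finset.card_le_card hsub'
    rw [Finset.card_union_of_disjoint d2, Finset.card_union_of_disjoint d1] at this
    omega

/-- Two disjoint channels would need six vertices in a quadrilateral. -/
theorem not_inChannel_of_inChannel {d e : G.Dart} (hde : d.edge ≠ e.edge) {t : ℕ}
    (hd : InChannel F d t) (he : InChannel F e t) : False := by
  have hf : (F.quad t).Finite := Set.toFinite {F.a t, F.b t, F.c t, F.d t}
  have hdis : Disjoint (F.quad t ∩ channelNodes d) (F.quad t ∩ channelNodes e) :=
    Set.disjoint_left.2 fun z hz hz' => hde (channelNodes_disjoint hz.2 hz'.2)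
  have h := Set.ncard_union_eq hdis (hf.inter_of_left _) (hf.inter_of_left _)
  have h' := Set.ncard_le_ncard (Set.union_subset (Set.inter_subset_left (t := channelNodes d))
    (Set.inter_subset_left (t := channelNodes e))) hf
  have := F.ncard_quad_le t
  unfold InChannel at *
  omega

/-- A flip of a locking edge is not a flip in a channel. -/
theorem not_inChannel_of_port (hX : X.IsConstruction) {d e : G.Dart} {m : Bool} {P Q W : Node G}
    (h : X.IsPort e m P Q W) {t : ℕ}
    (ht : t ∈ F.flipsOf {P, sideChain e (!m) 0} ∨ t ∈ F.flipsOf {P, Q}) : ¬ InChannel F d t := by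
  rcases ht with ht | ht
  · exact not_inChannel_of_mem_flipsOf hX h ht
  · obtain ⟨iP, iQ, -, hPQ, -⟩ := h.inner hX
    obtain ⟨h1, h2⟩ := subset_quad_of_mem_flipsOf ht
    exact not_inChannel hPQ h1 h2 (iP.notMem_channelNodes d) (iQ.notMem_channelNodes d)

/-- Flips of `PA` or `PQ` are in no channel at all, and no flip is in two channels. A flip concerns
at most one edge of `T₁`, and ports of different edges of the graph have different edges `PA` and
`PQ`. -/
theorem disjoint_nearFlips (hX : X.IsConstruction) {d d' : G.Dart} (hd : d.edge ≠ d'.edge) :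
    Disjoint (nearFlips F d) (nearFlips F d') := by
  refine Finset.disjoint_left.2 fun t ht ht' => ?_
  simp only [nearFlips, Finset.mem_filter] at ht ht'
  rcases ht.2 with h | ⟨e, m, P, Q, W, hed, hp, h⟩ <;>
    rcases ht'.2 with h' | ⟨e', m', P', Q', W', hed', hp', h'⟩
  · exact not_inChannel_of_inChannel hd h h'
  · exact not_inChannel_of_port hX hp' h' h
  · exact not_inChannel_of_port hX hp h h'
  · obtain ⟨iP, iQ, -⟩ := hp.inner hX
    obtain ⟨iP', iQ', -⟩ := hp'.inner hX
    obtain ⟨t₁, ht₁, hs₁⟩ := hp.exists_fst_subset hX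
    obtain ⟨t₂, ht₂, hs₂⟩ := hp.exists_snd_subset hX
    obtain ⟨t₁', ht₁', hs₁'⟩ := hp'.exists_fst_subset hX
    obtain ⟨t₂', ht₂', hs₂'⟩ := hp'.exists_snd_subset hX
    rcases h with h | h <;> rcases h' with h' | h'
    · have e1 := F.eq_of_mem_flipsOf hX.no_overlap ⟨t₁, gadget_subset_T₁ _ ht₁, hs₁⟩
        ⟨t₁', gadget_subset_T₁ _ ht₁', hs₁'⟩ h h'
      rcases e1.subset (Or.inr rfl) with h | h
      · exact iP'.ne_sideChain _ _ _ h.symm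
      · refine hd (hed.symm.trans ((channelNodes_disjoint
          (n := sideChain e (!m) 0) ⟨_, _, rfl⟩ ⟨_, _, h⟩).trans hed'))
    · have e1 := F.eq_of_mem_flipsOf hX.no_overlap ⟨t₁, gadget_subset_T₁ _ ht₁, hs₁⟩
        ⟨t₂', gadget_subset_T₁ _ ht₂', hs₂'⟩ h h'
      rcases e1.subset (Or.inr rfl) with h | h
      · exact iP'.ne_sideChain _ _ _ h.symm
      · exact iQ'.ne_sideChain _ _ _ h.symm
    · have e1 := F.eq_of_mem_flipsOf hX.no_overlap ⟨t₂, gadget_subset_T₁ _ ht₂, hs₂⟩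
        ⟨t₁', gadget_subset_T₁ _ ht₁', hs₁'⟩ h h'
      rcases e1.symm.subset (Or.inr rfl) with h | h
      · exact iP.ne_sideChain _ _ _ h.symm
      · exact iQ.ne_sideChain _ _ _ h.symm
    · have e1 := F.eq_of_mem_flipsOf hX.no_overlap ⟨t₂, gadget_subset_T₁ _ ht₂, hs₂⟩
        ⟨t₂', gadget_subset_T₁ _ ht₂', hs₂'⟩ h h'
      exact hd (hed.symm.trans ((hp.eq_of_pair_eq hp' e1 ▸ rfl : e.edge = e'.edge).trans hed'))

theorem disjoint_nearFlips_lock (hX : X.IsConstruction) (d : G.Dart) (v : V) :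
    Disjoint (nearFlips F d) (F.flipsOf {C v, E v}) := by
  refine Finset.disjoint_left.2 fun t ht ht' => ?_
  simp only [nearFlips, Finset.mem_filter] at ht
  have hC : IsInner v (C v : Node G) := Or.inl rfl
  have hE : IsInner v (E v : Node G) := Or.inr (Or.inr (Or.inl rfl))
  obtain ⟨t₀, ht₀, hs₀⟩ := exists_lock_subset (X := X) v
  rcases ht.2 with h | ⟨e, m, P, Q, W, hed, hp, h | h⟩
  · obtain ⟨h1, h2⟩ := subset_quad_of_mem_flipsOf ht'
    exact not_inChannel (by simp) h1 h2 (hC.notMem_channelNodes d) (hE.notMem_channelNodes d) h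
  · obtain ⟨t₁, ht₁, hs₁⟩ := hp.exists_fst_subset hX
    have e1 := F.eq_of_mem_flipsOf hX.no_overlap ⟨t₁, gadget_subset_T₁ _ ht₁, hs₁⟩
      ⟨t₀, gadget_subset_T₁ _ ht₀, hs₀⟩ h ht'
    rcases e1.subset (Or.inr rfl) with h | h
    · exact hC.ne_sideChain _ _ _ h.symm
    · exact hE.ne_sideChain _ _ _ h.symm
  · obtain ⟨t₂, ht₂, hs₂⟩ := hp.exists_snd_subset hX
    exact hp.pair_ne_lock v (F.eq_of_mem_flipsOf hX.no_overlap ⟨t₂, gadget_subset_T₁ _ ht₂, hs₂⟩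
      ⟨t₀, gadget_subset_T₁ _ ht₀, hs₀⟩ h ht')

theorem disjoint_lock (hX : X.IsConstruction) {v w : V} (hvw : v ≠ w) :
    Disjoint (F.flipsOf {C v, E v}) (F.flipsOf {C w, E w}) := by
  refine Finset.disjoint_left.2 fun t ht ht' => ?_
  obtain ⟨t₀, ht₀, hs₀⟩ := exists_lock_subset (X := X) v
  obtain ⟨t₁, ht₁, hs₁⟩ := exists_lock_subset (X := X) w
  have e1 := F.eq_of_mem_flipsOf hX.no_overlap ⟨t₀, gadget_subset_T₁ _ ht₀, hs₀⟩
    ⟨t₁, gadget_subset_T₁ _ ht₁, hs₁⟩ ht ht'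
  rcases e1.subset (Or.inl rfl) with h | h
  · exact hvw (C.inj h)
  · simp at h

/-- A flip sequence from the left-inclined to the right-inclined triangulation yields a vertex
cover. -/
theorem exists_cover (hX : X.IsConstruction) [Finite V] (h0 : F.T 0 = X.T₁) (hn : F.T n = X.T₂)
    (htri : ∀ t ≤ n, IsTriangulation X.pt X.region (F.T t)) :
    ∃ S : Finset V, G.IsVertexCover (S : Set V) ∧ 28 * G.edgeSet.ncard + 2 * S.card ≤ n := by
  classical
  have := Fintype.ofFinite V
  have hD : ∀ e : G.edgeSet, ∃ d : G.Dart, d.edge = e := by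
    rintro ⟨e, he⟩
    induction e using Sym2.ind with
    | _ v w => exact ⟨⟨(v, w), he⟩, rfl⟩
  choose D hD using hD
  have := Fintype.ofFinite G.edgeSet
  -- An edge whose channel was crossed without unlocking costs at least two flips more than 28,
  -- which pay for adding one of its ends to the cover.
  let E₁ : Finset G.edgeSet := Finset.univ.filter fun e => 30 ≤ (nearFlips F (D e)).card
  let U : Finset V := Finset.univ.filter (Unlocked F)
  have hdich := fun e : G.edgeSet => nearFlips_dichotomy hX h0 hn htri (D e)
  refine ⟨U ∪ E₁.image fun e => (D e).fst, ?_, ?_⟩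
  · intro v w hvw
    have hfst : ∀ d : G.Dart, d.edge = s(v, w) → d.fst = v ∨ d.fst = w := by
      intro d hd
      have : d.fst ∈ d.edge := Sym2.mem_mk_left _ _
      rw [hd] at this
      exact Sym2.mem_iff.1 this
    have hcov : ∃ d : G.Dart, d.edge = s(v, w) ∧
        d.fst ∈ ((U ∪ E₁.image fun e => (D e).fst : Finset V) : Set V) := by
      rcases hdich ⟨s(v, w), hvw⟩ with h | ⟨-, e, he, hu⟩
      · refine ⟨D ⟨s(v, w), hvw⟩, hD _, ?_⟩
        exact Finset.mem_union_right _ (Finset.mem_image_of_mem (fun e => (D e).fst)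
          (Finset.mem_filter.2 ⟨Finset.mem_univ _, h⟩))
      · exact ⟨e, he.trans (hD _), Finset.mem_union_left _
          (Finset.mem_filter.2 ⟨Finset.mem_univ _, hu⟩)⟩
    obtain ⟨d, hd, hdS⟩ := hcov
    rcases hfst d hd with h | h
    · exact Or.inl (h ▸ hdS)
    · exact Or.inr (h ▸ hdS)
  · have hS : (U ∪ E₁.image fun e => (D e).fst).card ≤ U.card + E₁.card :=
      (Finset.card_union_le _ _).trans (Nat.add_le_add_left Finset.card_image_le _)
    have hinj : ∀ e e' : G.edgeSet, e ≠ e' → (D e).edge ≠ (D e').edge := by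
      intro e e' hne h
      rw [hD, hD] at h
      exact hne (Subtype.ext h)
    have c1 : 28 * Fintype.card G.edgeSet + 2 * E₁.card ≤
        (Finset.univ.biUnion fun e => nearFlips F (D e)).card := by
      rw [Finset.card_biUnion fun e _ e' _ hne => disjoint_nearFlips hX (hinj e e' hne)]
      -- The bound is distributed over the edges: 28 for each, and two more for those in `E₁`.
      have : 28 * Fintype.card G.edgeSet + 2 * E₁.card =
          ∑ e : G.edgeSet, (28 + if 30 ≤ (nearFlips F (D e)).card then 2 else 0) := by
        rw [Finset.sum_add_distrib, Finset.sum_const, ← Finset.sum_filter, Finset.sum_const,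
          Finset.card_univ, smul_eq_mul, smul_eq_mul, mul_comm, mul_comm 2]
      rw [this]
      refine Finset.sum_le_sum fun e _ => ?_
      split_ifs with h
      · exact h
      · exact ((hdich e).resolve_left h).1
    have c2 : 2 * U.card ≤ (U.biUnion fun v => F.flipsOf {C v, E v}).card := by
      rw [Finset.card_biUnion fun v _ w _ hne => disjoint_lock hX hne, mul_comm, ← smul_eq_mul,
        ← Finset.sum_const]
      refine Finset.sum_le_sum fun v hv => ?_
      obtain ⟨k, hk, hun⟩ := (Finset.mem_filter.1 hv).2
      obtain ⟨t, ht, hs⟩ := exists_lock_subset (X := X) v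
      exact F.two_le_card_flipsOf (by simp) (h0 ▸ ⟨t, gadget_subset_T₁ _ ht, hs⟩)
        (hn ▸ ⟨t, gadget_subset_T₂ _ ht, hs⟩) hk hun
    have hdis : Disjoint (Finset.univ.biUnion fun e => nearFlips F (D e))
        (U.biUnion fun v => F.flipsOf {C v, E v}) := by
      rw [Finset.disjoint_biUnion_left]
      intro e _
      rw [Finset.disjoint_biUnion_right]
      intro v _
      exact disjoint_nearFlips_lock hX _ _
    have hsub : (Finset.univ.biUnion fun e => nearFlips F (D e)) ∪
        (U.biUnion fun v => F.flipsOf {C v, E v}) ⊆ Finset.range n := by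
      refine Finset.union_subset ?_ ?_ <;> refine Finset.biUnion_subset.2 fun _ _ => ?_
      · exact Finset.filter_subset _ _
      · exact Finset.filter_subset _ _
    have := Finset.card_le_card hsub
    rw [Finset.card_union_of_disjoint hdis, Finset.card_range] at this
    rw [← Nat.card_coe_set_eq, Nat.card_eq_fintype_card]
    omega

end Layout

/-! ### The equivalence. -/

/-- A finite bound excludes the infimum of the empty set, which is `⊤`, and a nonempty set of
extended naturals attains its infimum. -/
theorem exists_seq_of_flipDist_le {N : Type*} {pt : N → Plane} {R : Set Plane}
    {T T' : Set (Set N)} {n : ℕ} (h : flipDist pt R T T' ≤ n) :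
    ∃ m ≤ n, ∃ S : ℕ → Set (Set N), S 0 = T ∧ S m = T' ∧
      (∀ i ≤ m, IsTriangulation pt R (S i)) ∧ ∀ i < m, IsFlip pt (S i) (S (i + 1)) := by
  unfold flipDist at h
  set A := {n : ℕ∞ | ∃ m : ℕ, n = (m : ℕ∞) ∧ ∃ S : ℕ → Set (Set N), S 0 = T ∧ S m = T' ∧
    (∀ i ≤ m, IsTriangulation pt R (S i)) ∧ ∀ i < m, IsFlip pt (S i) (S (i + 1))} with hA
  have hne : A.Nonempty := by
    by_contra hn
    rw [Set.not_nonempty_iff_eq_empty] at hn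
    rw [hn, sInf_empty] at h
    exact absurd h (by simp)
  obtain ⟨m, hm, S, hS⟩ := csInf_mem hne
  rw [hm] at h
  exact ⟨m, by exact_mod_cast h, S, hS⟩

theorem lemma1 {V : Type*} [Finite V] (G : SimpleGraph V) (X : Layout G)
    (hX : X.IsConstruction) (k : ℕ) :
    IsTriangulation X.pt X.region X.T₂ ∧
    ((∃ S : Finset V, S.card ≤ k ∧ G.IsVertexCover (S : Set V)) ↔
      flipDist X.pt X.region X.T₁ X.T₂ ≤ ((2 * k + 28 * G.edgeSet.ncard : ℕ) : ℕ∞)) := by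
  have := Fintype.ofFinite V
  -- The set of all vertices is a vertex cover, so `T₂` is reached from `T₁` by flips and is a
  -- triangulation too.
  refine ⟨(hX.flipPath Finset.univ fun _ _ _ => by simp).isTriangulation hX.no_overlap, ?_, ?_⟩
  · rintro ⟨S, hk, hS⟩
    refine ((hX.flipPath S hS).flipDist_le hX.no_overlap).trans ?_
    exact_mod_cast Nat.add_le_add_right (Nat.mul_le_mul_left 2 hk) _
  · intro h
    -- Without vertices there are no nodes to label flips with, and the empty cover works.
    rcases isEmpty_or_nonempty V with hV | ⟨⟨v⟩⟩
    · exact ⟨∅, by simp, fun v => hV.elim v⟩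
    obtain ⟨m, hm, S, h0, hSm, htri, hflip⟩ := exists_seq_of_flipDist_le h
    have : Nonempty (Node G) := ⟨.C v⟩
    obtain ⟨F, rfl⟩ := FlipSeq.exists_of_isFlip htri hflip
    obtain ⟨S, hS, hcard⟩ := Layout.exists_cover hX h0 hSm htri
    exact ⟨S, by omega, hS⟩
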